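/- Let $M$ be a smooth manifold of odd dimension $n$, let $F\in\Omega^2(M)$ be closed and let $H\in\Omega^3(M)$ satisfy $dH=-F\wedge F$. Let $E=TM\oplus T^*M\oplus\mathbb R$ be the Courant algebroid of type $B_n$ twisted by $(H,F)$, i.e. with scalar product $\langle X+\xi+\lambda,Y+\eta+\mu\rangle=\frac12(\eta(X)+\xi(Y))+\lambda\mu$, anchor $\pi:E\to TM$ the projection, and Dorfman bracket $$[X+\xi+\lambda,Y+\eta+\mu]=\mathcal L_XY+\mathcal L_X\eta-i_Yd\xi+2\mu\,d\lambda+i_Xi_YH-2(\mu\, i_XF-\lambda\, i_YF)+X(\mu)-Y(\lambda)+F(X,Y).$$ A generalized metric is a rank $n$ subbundle $E_-\subset E$ on which $\langle\cdot,\cdot\rangle$ is non-degenerate and which $\pi$ maps isomorphically onto $TM$; put $E_+=E_-^\perp$ and let $\mathcal G^{\mathrm{end}}=\pm\mathrm{Id}$ on $E_\pm$. A $B_n$-generalized almost complex structure is an isotropic complex subbundle $L\subset E_{\mathbb C}$ of rank $n$ with $L\cap\bar L=0$, identified with the endomorphism $\mathcal F$ of $E$ that has $i$-eigenbundle $L$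 and $(-i)$-eigenbundle $\bar L$ and vanishes on $(L\oplus\bar L)^\perp$; it is called a $B_n$-generalized complex structure if $\Gamma(L)$ is closed under the Dorfman bracket. A $B_n$-generalized almost pseudo-Hermitian structure $(\mathcal G,\mathcal F)$ consists of a generalized metric and a $B_n$-generalized almost complex structure with $\mathcal G^{\mathrm{end}}\mathcal F=\mathcal F\mathcal G^{\mathrm{end}}$; it is $B_n$-generalized pseudo-Kähler if $\mathcal F$ and $\mathcal G^{\mathrm{end}}\mathcal F$ are $B_n$-generalized complex structures. Let $(\mathcal G,\mathcal F)$ be a $B_n$-generalized almost pseudo-Hermitian structure on $E$ whose generalized metric is in standard form, $E_-=\{X-i_Xg\mid X\in TM\}$ with $g$ a pseudo-Riemannian metric. Let $(g,J_+,J_-,X_+,X_-)$ be its components: $X_-=\pi(u_-)$, where $u_-\in\Gamma(\operatorname{Ker}\mathcal F)$ satisfies $\langle u_-,u_-\rangle=-1$; $J_-$ is the endomorphism of $TM$ corresponding to $\mathcal F|_{E_-}$ under the isomorphism $TM\cong E_-$, $X\mapsto X-i_Xg$; and under $TM\oplus\mathbb R\cong E_+$, $X+a\mapsto X+i_Xg+a$,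 the restriction $\mathcal F|_{E_+}$ becomes $X+a\mapsto J_+X+aX_+-g(X_+,X)$. Denote by $T^{(1,0)}_{J_\pm}M\subset(TM)_{\mathbb C}$ the $i$-eigenbundle of $J_\pm$, by $\nabla$ the Levi-Civita connection of $g$, and by $F(X)$ and $H(X,Y)$ the vector fields $g$-dual to $i_XF$ and $i_Yi_XH$. Define connections on $TM$ by $$\nabla^-_XY=\nabla_XY+\tfrac12H(X,Y),\qquad \nabla^+_XY=\nabla_XY-\tfrac12H(X,Y)-g(J_+F(X),Y)\,X_+ .$$ Theorem. $(\mathcal G,\mathcal F)$ is $B_n$-generalized pseudo-Kähler if and only if the following two conditions hold: (i) $\nabla^+$ preserves $T^{(1,0)}_{J_+}M$, $\nabla^-$ preserves $T^{(1,0)}_{J_-}M$, and $\nabla^-_XX_-=0$ and $\nabla^+_XX_+=-J_+F(X)$ for all $X\in\mathfrak X(M)$; (ii) $H|_{\Lambda^3T^{(1,0)}_{J_+}M}=0$, $H|_{\Lambda^3T^{(1,0)}_{J_-}M}=0$, $(i_{X_+}H)|_{\Lambda^2T^{(1,0)}_{J_+}M}=i\,F|_{\Lambda^2T^{(1,0)}_{J_+}M}$,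 $(i_{X_-}H)|_{\Lambda^2T^{(1,0)}_{J_-}M}=0$, $F|_{\Lambda^2T^{(1,0)}_{J_-}M}=0$ and $i_{X_-}F=0$. -/

import Mathlib

open scoped Manifold ContDiff

namespace BnGeom

open Bundle VectorField FiberBundle

set_option linter.unusedSectionVars false
set_option linter.unusedVariables false

section
variable {n : ℕ} {M : Type*} [TopologicalSpace M] [ChartedSpace (EuclideanSpace ℝ (Fin n)) M]

/-- The model space `ℝⁿ`. -/
abbrev Model (n : ℕ) : Type := EuclideanSpace ℝ (Fin n)

/-- The tangent space at `x` of the `n`-dimensional manifold `M`. -/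
abbrev Tan (n : ℕ) {M : Type*} [TopologicalSpace M] [ChartedSpace (EuclideanSpace ℝ (Fin n)) M]
    (x : M) : Type := TangentSpace (𝓡 n) x

/-- The cotangent space at `x`. -/
abbrev Cotan (n : ℕ) {M : Type*} [TopologicalSpace M]
    [ChartedSpace (EuclideanSpace ℝ (Fin n)) M] (x : M) : Type := Tan n x →L[ℝ] ℝ

/-! ### Vector fields, functions and one-forms -/

instance instFiniteDimensionalTan (x : M) : FiniteDimensional ℝ (Tan n x) :=
  inferInstanceAs (FiniteDimensional ℝ (EuclideanSpace ℝ (Fin n)))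

instance instT2SpaceTan (x : M) : T2Space (Tan n x) :=
  inferInstanceAs (T2Space (EuclideanSpace ℝ (Fin n)))

variable [IsManifold (𝓡 n) ∞ M]

/-- Differentiability of a vector field at a point. -/
def DiffFieldAt (X : ∀ x : M, Tan n x) (x : M) : Prop :=
  MDifferentiableAt (𝓡 n) ((𝓡 n).prod 𝓘(ℝ, Model n))
    (fun y => (TotalSpace.mk' (Model n) y (X y) : TangentBundle (𝓡 n) M)) x

/-- Smoothness of a vector field. -/
def SmoothField (X : ∀ x : M, Tan n x) : Prop :=
  ContMDiff (𝓡 n) ((𝓡 n).prod 𝓘(ℝ, Model n)) ∞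
    (fun x => (TotalSpace.mk' (Model n) x (X x) : TangentBundle (𝓡 n) M))

/-- Smoothness of a function on `M`. -/
def SmoothFun (n : ℕ) {M : Type*} [TopologicalSpace M]
    [ChartedSpace (EuclideanSpace ℝ (Fin n)) M] (f : M → ℝ) : Prop := ContMDiff (𝓡 n) 𝓘(ℝ, ℝ) ∞ f

/-- Smoothness of a one-form, as a section of the cotangent bundle. -/
def SmoothOneForm (ξ : ∀ x : M, Cotan n x) : Prop :=
  ContMDiff (𝓡 n) ((𝓡 n).prod 𝓘(ℝ, Model n →L[ℝ] ℝ)) ∞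
    (fun x => TotalSpace.mk' (Model n →L[ℝ] ℝ) (E := fun x : M => Tan n x →L[ℝ] ℝ) x (ξ x))

/-- Differentiability of a one-form at a point. -/
def DiffOneFormAt (ξ : ∀ x : M, Cotan n x) (x : M) : Prop :=
  MDifferentiableAt (𝓡 n) ((𝓡 n).prod 𝓘(ℝ, Model n →L[ℝ] ℝ))
    (fun x => TotalSpace.mk' (Model n →L[ℝ] ℝ) (E := fun x : M => Tan n x →L[ℝ] ℝ) x (ξ x)) x

/-- Smoothness of a field of bilinear forms. -/
def Smooth2 (g : ∀ x : M, Tan n x →L[ℝ] Tan n x →L[ℝ] ℝ) : Prop :=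
  ContMDiff (𝓡 n) ((𝓡 n).prod 𝓘(ℝ, Model n →L[ℝ] Model n →L[ℝ] ℝ)) ∞
    (fun x => TotalSpace.mk' (Model n →L[ℝ] Model n →L[ℝ] ℝ)
      (E := fun x : M => Tan n x →L[ℝ] Tan n x →L[ℝ] ℝ) x (g x))

theorem DiffOneFormAt.apply {ξ : ∀ x : M, Cotan n x} {x : M} (hξ : DiffOneFormAt ξ x)
    {X : ∀ x : M, Tan n x} (hX : DiffFieldAt X x) :
    MDifferentiableAt (𝓡 n) 𝓘(ℝ, ℝ) (fun y => ξ y (X y)) x := by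
  have := MDifferentiableAt.clm_bundle_apply (F₁ := Model n) (F₂ := ℝ) (E₁ := fun x : M => Tan n x)
    (E₂ := Bundle.Trivial M ℝ) (b := id) (ϕ := ξ) (v := X) hξ hX
  exact ((mdifferentiableAt_totalSpace _ _).1 this).2

theorem Smooth2.apply {g : ∀ x : M, Tan n x →L[ℝ] Tan n x →L[ℝ] ℝ} {x : M} (hg : Smooth2 g)
    {X Y : ∀ x : M, Tan n x} (hX : DiffFieldAt X x) (hY : DiffFieldAt Y x) :
    MDifferentiableAt (𝓡 n) 𝓘(ℝ, ℝ) (fun y => g y (X y) (Y y)) x := by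
  have h1 := (hg.mdifferentiable (by simp)) x
  have := MDifferentiableAt.clm_bundle_apply₂ (F₁ := Model n) (F₂ := Model n) (F₃ := ℝ)
    (E₁ := fun x : M => Tan n x) (E₂ := fun x : M => Tan n x)
    (E₃ := Bundle.Trivial M ℝ) (b := id) (ψ := g) (v := X) (w := Y) h1 hX hY
  exact ((mdifferentiableAt_totalSpace _ _).1 this).2

/-- The derivative of a function `f` at `x` as a covector. -/
noncomputable def dFun (f : M → ℝ) (x : M) : Cotan n x := mvfderiv (𝓡 n) f x

theorem dFun_add {f g : M → ℝ} {x : M} (hf : MDifferentiableAt (𝓡 n) 𝓘(ℝ, ℝ) f x)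
    (hg : MDifferentiableAt (𝓡 n) 𝓘(ℝ, ℝ) g x) :
    (dFun (fun y => f y + g y) x : Cotan n x) = dFun f x + dFun g x :=
  mvfderiv_fun_add hf hg

theorem dFun_mul {f g : M → ℝ} {x : M} (hf : MDifferentiableAt (𝓡 n) 𝓘(ℝ, ℝ) f x)
    (hg : MDifferentiableAt (𝓡 n) 𝓘(ℝ, ℝ) g x) :
    (dFun (fun y => f y * g y) x : Cotan n x) = f x • dFun g x + g x • dFun f x :=
  mvfderiv_fun_mul hf hg

/-- The Lie bracket of vector fields. -/
noncomputable def lie (X Y : ∀ x : M, Tan n x) (x : M) : Tan n x := mlieBracket (𝓡 n) X Y x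

theorem lie_add_left {X X' Y : ∀ x : M, Tan n x} {x : M} (hX : DiffFieldAt X x)
    (hX' : DiffFieldAt X' x) : lie (X + X') Y x = lie X Y x + lie X' Y x :=
  mlieBracket_add_left hX hX'

theorem lie_add_right {X Y Y' : ∀ x : M, Tan n x} {x : M} (hY : DiffFieldAt Y x)
    (hY' : DiffFieldAt Y' x) : lie X (Y + Y') x = lie X Y x + lie X Y' x :=
  mlieBracket_add_right hY hY'

theorem lie_smul_left {f : M → ℝ} {X Y : ∀ x : M, Tan n x} {x : M}
    (hf : MDifferentiableAt (𝓡 n) 𝓘(ℝ, ℝ) f x) (hX : DiffFieldAt X x) :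
    lie (f • X) Y x = -(dFun f x (Y x)) • X x + f x • lie X Y x :=
  mlieBracket_smul_left hf hX

theorem lie_smul_right {f : M → ℝ} {X Y : ∀ x : M, Tan n x} {x : M}
    (hf : MDifferentiableAt (𝓡 n) 𝓘(ℝ, ℝ) f x) (hY : DiffFieldAt Y x) :
    lie X (f • Y) x = (dFun f x (X x)) • Y x + f x • lie X Y x :=
  mlieBracket_smul_right hf hY

/-! ### Exterior and Lie derivatives of one-forms -/

/-- `X(ξ(Y)) - Y(ξ(X)) - ξ([X,Y])` at `x`. -/
noncomputable def dOneFormula (ξ : ∀ x : M, Cotan n x) (x : M) (X Y : ∀ x : M, Tan n x) : ℝ :=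
  dFun (fun y => ξ y (Y y)) x (X x) - dFun (fun y => ξ y (X y)) x (Y x) - ξ x (lie X Y x)

theorem dOneFormula_tensorial_left {ξ : ∀ x : M, Cotan n x} {x : M}
    (hξ : DiffOneFormAt ξ x) (Y : ∀ x : M, Tan n x) (hY : DiffFieldAt Y x) :
    TensorialAt (𝓡 n) (Model n) (fun X : ∀ x : M, Tan n x => dOneFormula ξ x X Y) x where
  smul {f X} hf hX := by
    have e : (fun y => ξ y ((f • X) y)) = fun y => f y * ξ y (X y) := by
      funext y; simp
    simp only [dOneFormula, e]
    rw [dFun_mul hf (hξ.apply hX), lie_smul_left hf hX]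
    simp
    ring
  add {X X'} hX hX' := by
    have e : (fun y => ξ y ((X + X') y)) = fun y => ξ y (X y) + ξ y (X' y) := by
      funext y; simp
    simp only [dOneFormula, e]
    rw [dFun_add (hξ.apply hX) (hξ.apply hX'), lie_add_left hX hX']
    simp
    ring

theorem dOneFormula_tensorial_right {ξ : ∀ x : M, Cotan n x} {x : M}
    (hξ : DiffOneFormAt ξ x) (X : ∀ x : M, Tan n x) (hX : DiffFieldAt X x) :
    TensorialAt (𝓡 n) (Model n) (fun Y : ∀ x : M, Tan n x => dOneFormula ξ x X Y) x where
  smul {f Y} hf hY := by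
    have e : (fun y => ξ y ((f • Y) y)) = fun y => f y * ξ y (Y y) := by
      funext y; simp
    simp only [dOneFormula, e]
    rw [dFun_mul hf (hξ.apply hY), lie_smul_right hf hY]
    simp
    ring
  add {Y Y'} hY hY' := by
    have e : (fun y => ξ y ((Y + Y') y)) = fun y => ξ y (Y y) + ξ y (Y' y) := by
      funext y; simp
    simp only [dOneFormula, e]
    rw [dFun_add (hξ.apply hY) (hξ.apply hY'), lie_add_right hY hY']
    simp
    ring

open Classical in
/-- The exterior derivative `dξ` of a one-form `ξ`, as a bilinear form on each tangent space
(zero by convention where `ξ` is not differentiable). -/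
noncomputable def dOne (ξ : ∀ x : M, Cotan n x) (x : M) : Tan n x →L[ℝ] Tan n x →L[ℝ] ℝ :=
  if h : DiffOneFormAt ξ x then
    TensorialAt.mkHom₂ (I := 𝓡 n) (F := Model n) (F' := Model n)
      (fun X Y : ∀ x : M, Tan n x => dOneFormula ξ x X Y) x
      (fun Y hY => dOneFormula_tensorial_left h Y hY)
      (fun X hX => dOneFormula_tensorial_right h X hX)
  else 0

theorem dOne_apply {ξ : ∀ x : M, Cotan n x} {x : M} (hξ : DiffOneFormAt ξ x)
    {X Y : ∀ x : M, Tan n x} (hX : DiffFieldAt X x) (hY : DiffFieldAt Y x) :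
    dOne ξ x (X x) (Y x) =
      dFun (fun y => ξ y (Y y)) x (X x) - dFun (fun y => ξ y (X y)) x (Y x) -
        ξ x (lie X Y x) := by
  rw [dOne, dif_pos hξ]
  exact TensorialAt.mkHom₂_apply _ _ hX hY

/-- `X(ξ(Y)) - ξ([X,Y])` at `x`. -/
noncomputable def lieDerivFormula (X : ∀ x : M, Tan n x) (ξ : ∀ x : M, Cotan n x) (x : M)
    (Y : ∀ x : M, Tan n x) : ℝ :=
  dFun (fun y => ξ y (Y y)) x (X x) - ξ x (lie X Y x)

theorem lieDerivFormula_tensorial {X : ∀ x : M, Tan n x} {ξ : ∀ x : M, Cotan n x} {x : M}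
    (hξ : DiffOneFormAt ξ x) :
    TensorialAt (𝓡 n) (Model n) (fun Y : ∀ x : M, Tan n x => lieDerivFormula X ξ x Y) x where
  smul {f Y} hf hY := by
    have e : (fun y => ξ y ((f • Y) y)) = fun y => f y * ξ y (Y y) := by
      funext y; simp
    simp only [lieDerivFormula, e]
    rw [dFun_mul hf (hξ.apply hY), lie_smul_right hf hY]
    simp
    ring
  add {Y Y'} hY hY' := by
    have e : (fun y => ξ y ((Y + Y') y)) = fun y => ξ y (Y y) + ξ y (Y' y) := by
      funext y; simp
    simp only [lieDerivFormula, e]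
    rw [dFun_add (hξ.apply hY) (hξ.apply hY'), lie_add_right hY hY']
    simp
    ring

open Classical in
/-- The Lie derivative of a one-form `ξ` in the direction of the vector field `X`:
`(𝓛_X ξ)(Y) = X(ξ(Y)) - ξ([X,Y])` (zero by convention where `ξ` is not differentiable). -/
noncomputable def lieDeriv (X : ∀ x : M, Tan n x) (ξ : ∀ x : M, Cotan n x) (x : M) : Cotan n x :=
  if h : DiffOneFormAt ξ x then
    TensorialAt.mkHom (I := 𝓡 n) (F := Model n)
      (fun Y : ∀ x : M, Tan n x => lieDerivFormula X ξ x Y) x (lieDerivFormula_tensorial h)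
  else 0

theorem lieDeriv_apply {X : ∀ x : M, Tan n x} {ξ : ∀ x : M, Cotan n x} {x : M}
    (hξ : DiffOneFormAt ξ x) {Y : ∀ x : M, Tan n x} (hY : DiffFieldAt Y x) :
    lieDeriv X ξ x (Y x) = dFun (fun y => ξ y (Y y)) x (X x) - ξ x (lie X Y x) := by
  rw [lieDeriv, dif_pos hξ]
  exact TensorialAt.mkHom_apply (lieDerivFormula_tensorial (X := X) hξ) hY

/-! ### Pseudo-Riemannian metrics and the Levi-Civita connection -/

variable (n M) in
/-- A pseudo-Riemannian metric (of arbitrary signature). -/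
structure PseudoRiemannianMetric where
  /-- the bilinear form on each tangent space -/
  val : ∀ x : M, Tan n x →L[ℝ] Tan n x →L[ℝ] ℝ
  symm : ∀ x v w, val x v w = val x w v
  nondegenerate : ∀ x v, (∀ w, val x v w = 0) → v = 0
  smooth : Smooth2 val

theorem PseudoRiemannianMetric.injective (g : PseudoRiemannianMetric n M) (x : M) :
    Function.Injective (g.val x : Tan n x →ₗ[ℝ] Cotan n x) := by
  rw [← LinearMap.ker_eq_bot, LinearMap.ker_eq_bot']
  intro v hv
  refine g.nondegenerate x v fun w => ?_
  exact DFunLike.congr_fun (F := Tan n x →L[ℝ] ℝ) hv w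

theorem finrank_cotan (x : M) : Module.finrank ℝ (Tan n x) = Module.finrank ℝ (Cotan n x) := by
  rw [← (LinearMap.toContinuousLinearMap (𝕜 := ℝ) (E := Tan n x) (F' := ℝ)).finrank_eq]
  exact (Subspace.dual_finrank_eq (K := ℝ) (V := Tan n x)).symm

/-- The musical isomorphism `TM → T*M`, `X ↦ i_X g`. -/
noncomputable def PseudoRiemannianMetric.flat (g : PseudoRiemannianMetric n M) (x : M) : Tan n x ≃ₗ[ℝ] Cotan n x :=
  haveI : FiniteDimensional ℝ (Cotan n x) :=
    (LinearMap.toContinuousLinearMap (𝕜 := ℝ) (E := Tan n x) (F' := ℝ)).finiteDimensional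
  LinearEquiv.ofInjectiveOfFinrankEq (g.val x : Tan n x →ₗ[ℝ] Cotan n x) (g.injective x)
    (finrank_cotan x)

/-- The vector identified with a covector by means of the metric. -/
noncomputable def PseudoRiemannianMetric.sharp (g : PseudoRiemannianMetric n M) (x : M) : Cotan n x ≃ₗ[ℝ] Tan n x :=
  (g.flat x).symm

theorem PseudoRiemannianMetric.val_sharp (g : PseudoRiemannianMetric n M) (x : M) (α : Cotan n x) (w : Tan n x) :
    g.val x (g.sharp x α) w = α w :=
  DFunLike.congr_fun (F := Tan n x →L[ℝ] ℝ) ((g.flat x).apply_symm_apply α) w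


/-- Twice `g(∇_X Y, Z)` at `x`, as given by the Koszul formula. -/
noncomputable def PseudoRiemannianMetric.koszul (g : PseudoRiemannianMetric n M) (Y : ∀ x : M, Tan n x) (x : M)
    (X Z : ∀ x : M, Tan n x) : ℝ :=
  dFun (fun y => g.val y (Y y) (Z y)) x (X x) + dFun (fun y => g.val y (Z y) (X y)) x (Y x)
    - dFun (fun y => g.val y (X y) (Y y)) x (Z x)
    + g.val x (lie X Y x) (Z x) - g.val x (lie Y Z x) (X x) + g.val x (lie Z X x) (Y x)

theorem PseudoRiemannianMetric.koszul_tensorial_left (g : PseudoRiemannianMetric n M) {Y : ∀ x : M, Tan n x} {x : M}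
    (hY : DiffFieldAt Y x) (Z : ∀ x : M, Tan n x) (hZ : DiffFieldAt Z x) :
    TensorialAt (𝓡 n) (Model n) (fun X : ∀ x : M, Tan n x => g.koszul Y x X Z) x where
  smul {f X} hf hX := by
    have e1 : (fun y => g.val y (Z y) ((f • X) y)) = fun y => f y * g.val y (Z y) (X y) := by
      funext y; simp
    have e2 : (fun y => g.val y ((f • X) y) (Y y)) = fun y => f y * g.val y (X y) (Y y) := by
      funext y; simp
    simp only [PseudoRiemannianMetric.koszul, e1, e2]
    rw [dFun_mul hf (g.smooth.apply hZ hX), dFun_mul hf (g.smooth.apply hX hY),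
      lie_smul_left hf hX, lie_smul_right hf hX]
    simp [g.symm x (Z x) (X x)]
    ring
  add {X X'} hX hX' := by
    have e1 : (fun y => g.val y (Z y) ((X + X') y)) =
        fun y => g.val y (Z y) (X y) + g.val y (Z y) (X' y) := by
      funext y; simp
    have e2 : (fun y => g.val y ((X + X') y) (Y y)) =
        fun y => g.val y (X y) (Y y) + g.val y (X' y) (Y y) := by
      funext y; simp
    simp only [PseudoRiemannianMetric.koszul, e1, e2]
    rw [dFun_add (g.smooth.apply hZ hX) (g.smooth.apply hZ hX'),
      dFun_add (g.smooth.apply hX hY) (g.smooth.apply hX' hY),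
      lie_add_left hX hX', lie_add_right hX hX']
    simp
    ring

theorem PseudoRiemannianMetric.koszul_tensorial_right (g : PseudoRiemannianMetric n M) {Y : ∀ x : M, Tan n x} {x : M}
    (hY : DiffFieldAt Y x) (X : ∀ x : M, Tan n x) (hX : DiffFieldAt X x) :
    TensorialAt (𝓡 n) (Model n) (fun Z : ∀ x : M, Tan n x => g.koszul Y x X Z) x where
  smul {f Z} hf hZ := by
    have e1 : (fun y => g.val y (Y y) ((f • Z) y)) = fun y => f y * g.val y (Y y) (Z y) := by
      funext y; simp
    have e2 : (fun y => g.val y ((f • Z) y) (X y)) = fun y => f y * g.val y (Z y) (X y) := by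
      funext y; simp
    simp only [PseudoRiemannianMetric.koszul, e1, e2]
    rw [dFun_mul hf (g.smooth.apply hY hZ), dFun_mul hf (g.smooth.apply hZ hX),
      lie_smul_left hf hZ, lie_smul_right hf hZ]
    simp [g.symm x (Y x) (Z x)]
    ring
  add {Z Z'} hZ hZ' := by
    have e1 : (fun y => g.val y (Y y) ((Z + Z') y)) =
        fun y => g.val y (Y y) (Z y) + g.val y (Y y) (Z' y) := by
      funext y; simp
    have e2 : (fun y => g.val y ((Z + Z') y) (X y)) =
        fun y => g.val y (Z y) (X y) + g.val y (Z' y) (X y) := by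
      funext y; simp
    simp only [PseudoRiemannianMetric.koszul, e1, e2]
    rw [dFun_add (g.smooth.apply hY hZ) (g.smooth.apply hY hZ'),
      dFun_add (g.smooth.apply hZ hX) (g.smooth.apply hZ' hX),
      lie_add_left hZ hZ', lie_add_right hZ hZ']
    simp
    ring

/-- The Koszul expression as a bilinear form in the values of `X` and `Z` at `x`. -/
noncomputable def PseudoRiemannianMetric.koszulForm (g : PseudoRiemannianMetric n M) {Y : ∀ x : M, Tan n x} {x : M}
    (h : DiffFieldAt Y x) : Tan n x →L[ℝ] Tan n x →L[ℝ] ℝ :=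
  TensorialAt.mkHom₂ (I := 𝓡 n) (F := Model n) (F' := Model n)
    (fun X Z : ∀ x : M, Tan n x => g.koszul Y x X Z) x
    (fun Z hZ => g.koszul_tensorial_left h Z hZ)
    (fun X hX => g.koszul_tensorial_right h X hX)

theorem PseudoRiemannianMetric.koszulForm_apply (g : PseudoRiemannianMetric n M) {X Y Z : ∀ x : M, Tan n x} {x : M}
    (hY : DiffFieldAt Y x) (hX : DiffFieldAt X x) (hZ : DiffFieldAt Z x) :
    g.koszulForm hY (X x) (Z x) = g.koszul Y x X Z :=
  TensorialAt.mkHom₂_apply _ _ hX hZ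

open Classical in
/-- `v ↦ ∇_v Y` at `x`, for the Levi-Civita connection of `g`
(zero by convention where `Y` is not differentiable). -/
noncomputable def PseudoRiemannianMetric.covDeriv (g : PseudoRiemannianMetric n M) (Y : ∀ x : M, Tan n x) (x : M) :
    Tan n x →L[ℝ] Tan n x :=
  if h : DiffFieldAt Y x then
    LinearMap.toContinuousLinearMap
      ((1 / 2 : ℝ) • ((g.sharp x : Cotan n x →ₗ[ℝ] Tan n x) ∘ₗ
        (g.koszulForm h : Tan n x →ₗ[ℝ] Cotan n x)))
  else 0

theorem diffFieldAt_extend {x : M} (v : Tan n x) :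
    DiffFieldAt (fun y : M => (FiberBundle.extend (Model n) v y : Tan n y)) x :=
  mdifferentiableAt_extend (𝓡 n) (Model n) v

theorem PseudoRiemannianMetric.val_covDeriv (g : PseudoRiemannianMetric n M) {X Y Z : ∀ x : M, Tan n x} {x : M}
    (hX : DiffFieldAt X x) (hY : DiffFieldAt Y x) (hZ : DiffFieldAt Z x) :
    g.val x (g.covDeriv Y x (X x)) (Z x) = (1 / 2) * g.koszul Y x X Z := by
  rw [covDeriv, dif_pos hY, ← g.koszulForm_apply hY hX hZ]
  simp [PseudoRiemannianMetric.val_sharp]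

theorem PseudoRiemannianMetric.ext_val (g : PseudoRiemannianMetric n M) {x : M} {v w : Tan n x}
    (h : ∀ Z : ∀ x : M, Tan n x, DiffFieldAt Z x → g.val x v (Z x) = g.val x w (Z x)) :
    v = w := by
  rw [← sub_eq_zero]
  refine g.nondegenerate x _ fun z => ?_
  have := h _ (diffFieldAt_extend z)
  simp only [FiberBundle.extend_apply_self] at this
  rw [map_sub, _root_.sub_apply, this, sub_self]

theorem DiffFieldAt.add {X X' : ∀ x : M, Tan n x} {x : M} (hX : DiffFieldAt X x)
    (hX' : DiffFieldAt X' x) : DiffFieldAt (X + X') x :=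
  mdifferentiableAt_add_section hX hX'

theorem DiffFieldAt.smul {f : M → ℝ} {X : ∀ x : M, Tan n x} {x : M}
    (hf : MDifferentiableAt (𝓡 n) 𝓘(ℝ, ℝ) f x) (hX : DiffFieldAt X x) :
    DiffFieldAt (f • X) x :=
  MDifferentiableAt.smul_section hf hX

theorem PseudoRiemannianMetric.isCovariantDerivativeOn_covDeriv (g : PseudoRiemannianMetric n M) :
    IsCovariantDerivativeOn (I := 𝓡 n) (Model n) (V := fun x : M => TangentSpace (𝓡 n) x)
      g.covDeriv Set.univ where
  add {Y Y' x} hY hY' _ := by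
    ext1 v
    refine g.ext_val fun Z hZ => ?_
    obtain ⟨X, hX, rfl⟩ : ∃ X : ∀ x : M, Tan n x, DiffFieldAt X x ∧ X x = v :=
      ⟨_, diffFieldAt_extend v, by simp⟩
    rw [_root_.add_apply, map_add, _root_.add_apply,
      g.val_covDeriv hX (DiffFieldAt.add hY hY') hZ, g.val_covDeriv hX hY hZ,
      g.val_covDeriv hX hY' hZ]
    have e1 : (fun y => g.val y ((Y + Y') y) (Z y)) =
        fun y => g.val y (Y y) (Z y) + g.val y (Y' y) (Z y) := by
      funext y; simp
    have e2 : (fun y => g.val y (X y) ((Y + Y') y)) =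
        fun y => g.val y (X y) (Y y) + g.val y (X y) (Y' y) := by
      funext y; simp
    simp only [PseudoRiemannianMetric.koszul, e1, e2]
    rw [dFun_add (g.smooth.apply hY hZ) (g.smooth.apply hY' hZ),
      dFun_add (g.smooth.apply hX hY) (g.smooth.apply hX hY'),
      lie_add_left hY hY', lie_add_right hY hY']
    simp
    ring
  leibniz {Y f x} hY hf _ := by
    ext1 v
    refine g.ext_val fun Z hZ => ?_
    obtain ⟨X, hX, rfl⟩ : ∃ X : ∀ x : M, Tan n x, DiffFieldAt X x ∧ X x = v :=
      ⟨_, diffFieldAt_extend v, by simp⟩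
    have e0 : (f x • g.covDeriv Y x + (mvfderiv (𝓡 n) f x).smulRight (Y x)) (X x) =
        f x • g.covDeriv Y x (X x) + (dFun f x (X x)) • Y x := rfl
    rw [e0, map_add, _root_.add_apply, map_smul, map_smul,
      _root_.smul_apply, _root_.smul_apply,
      g.val_covDeriv hX (DiffFieldAt.smul hf hY) hZ, g.val_covDeriv hX hY hZ]
    have e1 : (fun y => g.val y ((f • Y) y) (Z y)) = fun y => f y * g.val y (Y y) (Z y) := by
      funext y; simp
    have e2 : (fun y => g.val y (X y) ((f • Y) y)) = fun y => f y * g.val y (X y) (Y y) := by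
      funext y; simp
    simp only [PseudoRiemannianMetric.koszul, e1, e2]
    rw [dFun_mul hf (g.smooth.apply hY hZ), dFun_mul hf (g.smooth.apply hX hY),
      lie_smul_left hf hY, lie_smul_right hf hY]
    simp [g.symm x (X x) (Y x)]
    ring

/-- The Levi-Civita connection of `g`; `g.leviCivita Y x v` is `∇_v Y`. -/
noncomputable def PseudoRiemannianMetric.leviCivita (g : PseudoRiemannianMetric n M) :
    CovariantDerivative (𝓡 n) (Model n) (fun x : M => TangentSpace (𝓡 n) x) where
  toFun := g.covDeriv
  isCovariantDerivativeOnUniv := g.isCovariantDerivativeOn_covDeriv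

/-- The Levi-Civita connection is torsion-free. -/
theorem PseudoRiemannianMetric.leviCivita_torsion (g : PseudoRiemannianMetric n M) {X Y : ∀ x : M, Tan n x} {x : M}
    (hX : DiffFieldAt X x) (hY : DiffFieldAt Y x) :
    g.leviCivita Y x (X x) - g.leviCivita X x (Y x) = lie X Y x := by
  refine g.ext_val fun Z hZ => ?_
  have e : g.val x (g.leviCivita Y x (X x) - g.leviCivita X x (Y x)) (Z x) =
      g.val x (g.covDeriv Y x (X x)) (Z x) - g.val x (g.covDeriv X x (Y x)) (Z x) := by
    rw [map_sub]; rfl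
  rw [e, g.val_covDeriv hX hY hZ, g.val_covDeriv hY hX hZ]
  have s (A B : ∀ x : M, Tan n x) :
      (fun y => g.val y (A y) (B y)) = fun y => g.val y (B y) (A y) := by
    funext y; exact g.symm ..
  have l (A B : ∀ x : M, Tan n x) : lie A B x = - lie B A x := mlieBracket_swap_apply ..
  simp only [PseudoRiemannianMetric.koszul, s Z X, s Y X, s Z Y, l Y X, l Z X, l Z Y]
  simp
  ring

/-- The Levi-Civita connection is metric. -/
theorem PseudoRiemannianMetric.leviCivita_metric (g : PseudoRiemannianMetric n M) {X Y Z : ∀ x : M, Tan n x} {x : M}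
    (hX : DiffFieldAt X x) (hY : DiffFieldAt Y x) (hZ : DiffFieldAt Z x) :
    dFun (fun y => g.val y (Y y) (Z y)) x (X x) =
      g.val x (g.leviCivita Y x (X x)) (Z x) + g.val x (Y x) (g.leviCivita Z x (X x)) := by
  rw [g.symm x (Y x)]
  have e1 : g.val x (g.leviCivita Y x (X x)) (Z x) = _ := g.val_covDeriv hX hY hZ
  have e2 : g.val x (g.leviCivita Z x (X x)) (Y x) = _ := g.val_covDeriv hX hZ hY
  rw [e1, e2]
  have s (A B : ∀ x : M, Tan n x) :
      (fun y => g.val y (A y) (B y)) = fun y => g.val y (B y) (A y) := by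
    funext y; exact g.symm ..
  have l (A B : ∀ x : M, Tan n x) : lie A B x = - lie B A x := mlieBracket_swap_apply ..
  simp only [PseudoRiemannianMetric.koszul, s Z X, s Y X, s Z Y, l Y X, l Z X, l Z Y]
  simp
  ring

end

/-! ### Complexification of a real vector space -/

/-- The complexification `V ⊕ iV` of a real vector space `V`. -/
@[ext]
structure Cx (V : Type*) where
  /-- real part -/
  re : V
  /-- imaginary part -/
  im : V

namespace Cx

variable {V W : Type*} [AddCommGroup V] [Module ℝ V] [AddCommGroup W] [Module ℝ W]

instance : Zero (Cx V) := ⟨⟨0, 0⟩⟩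
instance : Add (Cx V) := ⟨fun z w => ⟨z.re + w.re, z.im + w.im⟩⟩
instance : Neg (Cx V) := ⟨fun z => ⟨-z.re, -z.im⟩⟩
instance : SMul ℂ (Cx V) := ⟨fun c z => ⟨c.re • z.re - c.im • z.im, c.re • z.im + c.im • z.re⟩⟩

@[simp] theorem zero_re : (0 : Cx V).re = 0 := rfl
@[simp] theorem zero_im : (0 : Cx V).im = 0 := rfl
@[simp] theorem add_re (z w : Cx V) : (z + w).re = z.re + w.re := rfl
@[simp] theorem add_im (z w : Cx V) : (z + w).im = z.im + w.im := rfl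
@[simp] theorem neg_re (z : Cx V) : (-z).re = -z.re := rfl
@[simp] theorem neg_im (z : Cx V) : (-z).im = -z.im := rfl
@[simp] theorem smul_re (c : ℂ) (z : Cx V) : (c • z).re = c.re • z.re - c.im • z.im := rfl
@[simp] theorem smul_im (c : ℂ) (z : Cx V) : (c • z).im = c.re • z.im + c.im • z.re := rfl

instance : AddCommGroup (Cx V) where
  add_assoc a b c := by ext <;> simp [add_assoc]
  zero_add a := by ext <;> simp
  add_zero a := by ext <;> simp
  nsmul := nsmulRec
  zsmul := zsmulRec
  neg_add_cancel a := by ext <;> simp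
  add_comm a b := by ext <;> simp [add_comm]

instance : Module ℂ (Cx V) where
  one_smul a := by ext <;> simp
  mul_smul c d a := by ext <;> simp <;> module
  smul_zero c := by ext <;> simp
  smul_add c a b := by ext <;> simp <;> module
  add_smul c d a := by ext <;> simp <;> module
  zero_smul a := by ext <;> simp

/-- The complex-linear extension of a real-linear map. -/
def map (A : V →ₗ[ℝ] W) : Cx V →ₗ[ℂ] Cx W where
  toFun z := ⟨A z.re, A z.im⟩
  map_add' z w := by ext <;> simp
  map_smul' c z := by ext <;> simp

/-- The `i`-eigenspace, in the complexification, of a real endomorphism. -/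
def iEigen (A : Module.End ℝ V) : Submodule ℂ (Cx V) :=
  Module.End.eigenspace (map A) Complex.I

/-- The complex-bilinear extension of a real bilinear form. -/
def bilin (B : V → V → ℝ) (z w : Cx V) : ℂ :=
  ⟨B z.re w.re - B z.im w.im, B z.re w.im + B z.im w.re⟩

/-- The complex-trilinear extension of a real trilinear form. -/
noncomputable def trilin (T : V → V → V → ℝ) (a b c : Cx V) : ℂ :=
  bilin (T a.re) b c + Complex.I * bilin (T a.im) b c

end Cx

section

variable {n : ℕ} {M : Type*} [TopologicalSpace M] [ChartedSpace (EuclideanSpace ℝ (Fin n)) M]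
  [IsManifold (𝓡 n) ∞ M]

/-! ### Courant algebroids of type `Bₙ` -/

/-- The invariant formula for the exterior derivative of a two-form. -/
noncomputable def dTwo (F : ∀ x : M, Tan n x →L[ℝ] Tan n x →L[ℝ] ℝ)
    (X Y Z : ∀ x : M, Tan n x) (x : M) : ℝ :=
  dFun (fun y => F y (Y y) (Z y)) x (X x) - dFun (fun y => F y (X y) (Z y)) x (Y x)
    + dFun (fun y => F y (X y) (Y y)) x (Z x)
    - F x (lie X Y x) (Z x) + F x (lie X Z x) (Y x) - F x (lie Y Z x) (X x)

/-- The invariant formula for the exterior derivative of a three-form. -/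
noncomputable def dThree (H : ∀ x : M, Tan n x →L[ℝ] Tan n x →L[ℝ] Tan n x →L[ℝ] ℝ)
    (X Y Z W : ∀ x : M, Tan n x) (x : M) : ℝ :=
  dFun (fun y => H y (Y y) (Z y) (W y)) x (X x) - dFun (fun y => H y (X y) (Z y) (W y)) x (Y x)
    + dFun (fun y => H y (X y) (Y y) (W y)) x (Z x) - dFun (fun y => H y (X y) (Y y) (Z y)) x (W x)
    - H x (lie X Y x) (Z x) (W x) + H x (lie X Z x) (Y x) (W x) - H x (lie X W x) (Y x) (Z x)
    - H x (lie Y Z x) (X x) (W x) + H x (lie Y W x) (X x) (Z x) - H x (lie Z W x) (X x) (Y x)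

variable (n M) in
/-- The twisting data `(H, F)` of a Courant algebroid of type `Bₙ` on `M`: a closed two-form `F`
and a three-form `H` with `dH = - F ∧ F`. -/
structure TypeBn where
  /-- the two-form -/
  F : ∀ x : M, Tan n x →L[ℝ] Tan n x →L[ℝ] ℝ
  /-- the three-form -/
  H : ∀ x : M, Tan n x →L[ℝ] Tan n x →L[ℝ] Tan n x →L[ℝ] ℝ
  F_alt : ∀ x v, F x v v = 0
  H_alt_left : ∀ x v w, H x v v w = 0
  H_alt_right : ∀ x v w, H x v w w = 0
  F_smooth : Smooth2 F
  H_smooth : ∀ X Y Z : ∀ x : M, Tan n x, SmoothField X → SmoothField Y → SmoothField Z →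
    SmoothFun n (fun x => H x (X x) (Y x) (Z x))
  F_closed : ∀ X Y Z : ∀ x : M, Tan n x, SmoothField X → SmoothField Y → SmoothField Z →
    ∀ x, dTwo F X Y Z x = 0
  /-- `dH = - F ∧ F`, where `F ∧ F` is written out on four vectors -/
  dH_eq : ∀ X Y Z W : ∀ x : M, Tan n x,
    SmoothField X → SmoothField Y → SmoothField Z → SmoothField W → ∀ x,
    dThree H X Y Z W x = - (2 * (F x (X x) (Y x) * F x (Z x) (W x)
      - F x (X x) (Z x) * F x (Y x) (W x) + F x (X x) (W x) * F x (Y x) (Z x)))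

/-- The fibre at `x` of `E = TM ⊕ T*M ⊕ ℝ`. -/
abbrev Fib (n : ℕ) {M : Type*} [TopologicalSpace M]
    [ChartedSpace (EuclideanSpace ℝ (Fin n)) M] (x : M) : Type := Tan n x × Cotan n x × ℝ

/-- The scalar product `⟨X + ξ + λ, Y + η + μ⟩ = ½ (η(X) + ξ(Y)) + λ μ`. -/
noncomputable def pairing {x : M} (u v : Fib n x) : ℝ :=
  (1 / 2) * (v.2.1 u.1 + u.2.1 v.1) + u.2.2 * v.2.2

/-- Smooth sections of `E`. -/
def SmoothSection (u : ∀ x : M, Fib n x) : Prop :=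
  SmoothField (fun x => (u x).1) ∧ SmoothOneForm (fun x => (u x).2.1) ∧
    SmoothFun n (fun x => (u x).2.2)

/-- The Dorfman bracket twisted by `(H, F)` of the sections `u = X + ξ + a` and `v = Y + η + b`:
`[u, v] = 𝓛_X Y + 𝓛_X η - i_Y dξ + 2 b da + i_X i_Y H - 2 (b i_X F - a i_Y F)
  + X(b) - Y(a) + F(X, Y)`. -/
noncomputable def dorfman (T : TypeBn n M) (u v : ∀ x : M, Fib n x) (x : M) : Fib n x :=
  (lie (fun y => (u y).1) (fun y => (v y).1) x,
    lieDeriv (fun y => (u y).1) (fun y => (v y).2.1) x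
      - dOne (fun y => (u y).2.1) x (v x).1
      + (2 * (v x).2.2) • dFun (fun y => (u y).2.2) x
      + T.H x (v x).1 (u x).1
      - (2 : ℝ) • ((v x).2.2 • T.F x (u x).1 - (u x).2.2 • T.F x (v x).1),
    dFun (fun y => (v y).2.2) x (u x).1 - dFun (fun y => (u y).2.2) x (v x).1
      + T.F x (u x).1 (v x).1)

/-- Smooth sections of the complexified bundle. -/
def SmoothSectionC (u : ∀ x : M, Cx (Fib n x)) : Prop :=
  SmoothSection (fun x => (u x).re) ∧ SmoothSection (fun x => (u x).im)

/-- The complex-bilinear extension of the Dorfman bracket. -/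
noncomputable def dorfmanC (T : TypeBn n M) (u v : ∀ x : M, Cx (Fib n x)) (x : M) : Cx (Fib n x) :=
  ⟨dorfman T (fun y => (u y).re) (fun y => (v y).re) x
      - dorfman T (fun y => (u y).im) (fun y => (v y).im) x,
    dorfman T (fun y => (u y).re) (fun y => (v y).im) x
      + dorfman T (fun y => (u y).im) (fun y => (v y).re) x⟩

/-- Smooth endomorphisms of `E`: those which map smooth sections to smooth sections. -/
def SmoothEnd (A : ∀ x : M, Module.End ℝ (Fib n x)) : Prop :=
  ∀ u : ∀ x : M, Fib n x, SmoothSection u → SmoothSection (fun x => A x (u x))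

/-! ### Generalized metrics and generalized complex structures -/

variable (n M) in
/-- An admissible generalized metric: a subbundle `E₋` of rank `n`, mapped isomorphically onto `TM`
by the anchor, on which the scalar product is non-degenerate. It is encoded by the endomorphism
`Gend` equal to `-1` on `E₋` and to `1` on the orthogonal complement `E₊` of `E₋`. -/
structure GeneralizedMetric where
  /-- the endomorphism `𝒢ᵉⁿᵈ` -/
  Gend : ∀ x : M, Module.End ℝ (Fib n x)
  smooth : SmoothEnd Gend
  nondegenerate : ∀ x, ∀ u ∈ Module.End.eigenspace (Gend x) (-1),
    (∀ v ∈ Module.End.eigenspace (Gend x) (-1), pairing u v = 0) → u = 0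
  admissible : ∀ x, Function.Bijective
    (fun u : Module.End.eigenspace (Gend x) (-1) => (u : Fib n x).1)
  eq_one : ∀ x u, (∀ v ∈ Module.End.eigenspace (Gend x) (-1), pairing u v = 0) → Gend x u = u

/-- The subbundle `E₋` of a generalized metric. -/
noncomputable def GeneralizedMetric.Eminus (G : GeneralizedMetric n M) (x : M) : Submodule ℝ (Fib n x) :=
  Module.End.eigenspace (G.Gend x) (-1)

/-- The generalized metric is in standard form with induced metric `g`:
`E₋ = {X - i_X g | X ∈ TM}`. -/
def GeneralizedMetric.IsStandard (G : GeneralizedMetric n M) (g : PseudoRiemannianMetric n M) : Prop :=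
  ∀ x (u : Fib n x), u ∈ G.Eminus x ↔ ∃ v : Tan n x, u = (v, -g.val x v, 0)

/-- `A` is a `Bₙ`-generalized almost complex structure: its `i`-eigenbundle `L` is isotropic of
complex rank `n`, and `A` vanishes on the real vectors orthogonal to `L ⊕ L̄` (equivalently,
to `L`). As `A` is real, its `(-i)`-eigenbundle is `L̄`, so that `L ∩ L̄ = 0`. -/
structure IsBnGenAlmostComplex (A : ∀ x : M, Module.End ℝ (Fib n x)) : Prop where
  smooth : SmoothEnd A
  isotropic : ∀ x, ∀ z ∈ Cx.iEigen (A x), ∀ w ∈ Cx.iEigen (A x), Cx.bilin pairing z w = 0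
  rank : ∀ x, Module.finrank ℂ (Cx.iEigen (A x)) = n
  eq_zero : ∀ x (u : Fib n x), (∀ z ∈ Cx.iEigen (A x), Cx.bilin pairing ⟨u, 0⟩ z = 0) → A x u = 0

/-- `A` is a `Bₙ`-generalized complex structure: a `Bₙ`-generalized almost complex structure such
that the sections of its `i`-eigenbundle are closed under the Dorfman bracket. -/
structure IsBnGenComplex (T : TypeBn n M) (A : ∀ x : M, Module.End ℝ (Fib n x)) : Prop where
  almost : IsBnGenAlmostComplex A
  integrable : ∀ u v : ∀ x : M, Cx (Fib n x), SmoothSectionC u → SmoothSectionC v →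
    (∀ x, u x ∈ Cx.iEigen (A x)) → (∀ x, v x ∈ Cx.iEigen (A x)) →
    ∀ x, dorfmanC T u v x ∈ Cx.iEigen (A x)

variable (n M) in
/-- A `Bₙ`-generalized almost pseudo-Hermitian structure `(𝒢, 𝓕)`. -/
structure AlmostPseudoHermitian where
  /-- the generalized metric `𝒢` -/
  G : GeneralizedMetric n M
  /-- the `Bₙ`-generalized almost complex structure `𝓕` -/
  J : ∀ x : M, Module.End ℝ (Fib n x)
  almostComplex : IsBnGenAlmostComplex J
  commute : ∀ x, G.Gend x * J x = J x * G.Gend x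

/-- `(𝒢, 𝓕)` is `Bₙ`-generalized pseudo-Kähler: `𝓕` and `𝒢ᵉⁿᵈ 𝓕` are `Bₙ`-generalized complex
structures. -/
def AlmostPseudoHermitian.IsPseudoKahler (S : AlmostPseudoHermitian n M) (T : TypeBn n M) : Prop :=
  IsBnGenComplex T S.J ∧ IsBnGenComplex T (fun x => S.G.Gend x * S.J x)

/-! ### Components of an almost pseudo-Hermitian structure in standard form, odd dimension -/

/-- The isomorphism `TM → E₋`, `X ↦ X - i_X g`. -/
noncomputable def PseudoRiemannianMetric.toEminus (g : PseudoRiemannianMetric n M) (x : M) : Tan n x →ₗ[ℝ] Fib n x :=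
  LinearMap.prod LinearMap.id (LinearMap.prod (-(g.val x : Tan n x →ₗ[ℝ] Cotan n x)) 0)

/-- The map `TM → E₊`, `X ↦ X + i_X g`; together with `1 ∈ E₊` it gives the isomorphism
`TM ⊕ ℝ → E₊`. -/
noncomputable def PseudoRiemannianMetric.toEplus (g : PseudoRiemannianMetric n M) (x : M) : Tan n x →ₗ[ℝ] Fib n x :=
  LinearMap.prod LinearMap.id (LinearMap.prod (g.val x : Tan n x →ₗ[ℝ] Cotan n x) 0)

/-- `J₋`, the endomorphism of `TM` corresponding to `𝓕|E₋` under `E₋ ≅ TM`. -/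
noncomputable def AlmostPseudoHermitian.Jminus (S : AlmostPseudoHermitian n M)
    (g : PseudoRiemannianMetric n M) (x : M) : Module.End ℝ (Tan n x) :=
  LinearMap.fst ℝ (Tan n x) (Cotan n x × ℝ) ∘ₗ S.J x ∘ₗ g.toEminus x

/-- `J₊`, the `TM`-`TM` block of the endomorphism of `TM ⊕ ℝ` corresponding to `𝓕|E₊` under
`E₊ ≅ TM ⊕ ℝ`. -/
noncomputable def AlmostPseudoHermitian.Jplus (S : AlmostPseudoHermitian n M)
    (g : PseudoRiemannianMetric n M) (x : M) : Module.End ℝ (Tan n x) :=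
  LinearMap.fst ℝ (Tan n x) (Cotan n x × ℝ) ∘ₗ S.J x ∘ₗ g.toEplus x

/-- `X₊`, the `TM`-component of `𝓕(1)`. -/
noncomputable def AlmostPseudoHermitian.Xplus (S : AlmostPseudoHermitian n M) (x : M) : Tan n x :=
  (S.J x (0, 0, 1)).1

/-- `u₀` is a smooth generator of `Ker 𝓕` with `⟨u₀, u₀⟩ = (-1)ⁿ`. -/
structure AlmostPseudoHermitian.IsNormalizedKernelSection (S : AlmostPseudoHermitian n M)
    (u₀ : ∀ x : M, Fib n x) : Prop where
  smooth : SmoothSection u₀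
  mem_ker : ∀ x, S.J x (u₀ x) = 0
  norm : ∀ x, pairing (u₀ x) (u₀ x) = (-1) ^ n

/-! ### The connections `∇^±` -/

/-- `∇⁻_v Y = ∇_v Y + ½ H(v, Y)`. -/
noncomputable def nablaMinus (T : TypeBn n M) (g : PseudoRiemannianMetric n M) (Y : ∀ x : M, Tan n x)
    (x : M) (v : Tan n x) : Tan n x :=
  g.leviCivita Y x v + (1 / 2 : ℝ) • g.sharp x (T.H x v (Y x))

/-- `∇⁺_v Y = ∇_v Y - ½ H(v, Y) - g(J₊ F(v), Y) X₊`. -/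
noncomputable def nablaPlus (T : TypeBn n M) (g : PseudoRiemannianMetric n M)
    (Jp : ∀ x : M, Module.End ℝ (Tan n x)) (Xp : ∀ x : M, Tan n x) (Y : ∀ x : M, Tan n x)
    (x : M) (v : Tan n x) : Tan n x :=
  g.leviCivita Y x v - (1 / 2 : ℝ) • g.sharp x (T.H x v (Y x))
    - g.val x (Jp x (g.sharp x (T.F x v))) (Y x) • Xp x

/-- The connection `D` (with `D Y x v` standing for `D_v Y`), extended complex-linearly, preserves
the distribution `T^{(1,0)}_J M`, the `i`-eigenbundle of `J` in `(TM)_ℂ`. -/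
def Preserves (D : (∀ x : M, Tan n x) → ∀ x : M, Tan n x → Tan n x)
    (J : ∀ x : M, Module.End ℝ (Tan n x)) : Prop :=
  ∀ Z : ∀ x : M, Cx (Tan n x), SmoothField (fun x => (Z x).re) → SmoothField (fun x => (Z x).im) →
    (∀ x, Z x ∈ Cx.iEigen (J x)) → ∀ (x : M) (v : Tan n x),
      (⟨D (fun y => (Z y).re) x v, D (fun y => (Z y).im) x v⟩ : Cx (Tan n x)) ∈ Cx.iEigen (J x)

end

end BnGeom

open BnGeom

namespace BnGeom

open Bundle VectorField FiberBundle

set_option linter.unusedSectionVars false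
set_option linter.unusedVariables false
set_option linter.unnecessarySeqFocus false

section
variable {n : ℕ} {M : Type*} [TopologicalSpace M] [ChartedSpace (EuclideanSpace ℝ (Fin n)) M]
  [IsManifold (𝓡 n) ∞ M]

/-! ### Smooth vector fields -/

/-! Every element of `E` is written as `(p + i_p g) + (q - i_q g) + c` (`mkFib`), so that `E ≅ TM ⊕
TM ⊕ ℝ` with scalar product `g(p,p') - g(q,q') + c c'`. Let `∇` act componentwise. Since the
Levi-Civita connection is metric and torsion-free, `pairing_dorfman` gives `⟨[u,v],w⟩ = ⟨∇_{πu} v,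
w⟩ - ⟨∇_{πv} u, w⟩ + ⟨∇_{πw} u, v⟩` plus terms algebraic in `H` and `F`. Integrability of `L`
thereby becomes a system of equations for first derivatives of sections of `L`.

Pointwise, `n` odd forces `Ker 𝓕` to be a line inside `E₋`, so `(J₊, X₊)` and `(J₋, X₋)` are almost
contact structures compatible with `g`. Hence `L = L₊ ⊕ L₋` with `L₋ ≅ T^{1,0}₋` and `L₊ = T^{1,0}₊
⊕ ℂ(X₊ + i)`. The eigenbundle of `𝒢ᵉⁿᵈ 𝓕` is `L₊` plus the conjugate of `L₋`; that is, `J₋` is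
replaced by `-J₋`. By `preserves_iff`, condition (i) amounts to formulas for `g(∇_z P, p)` and
`g(∇_z X_±, p)` with `P, p` of type (1,0): `PlusCond` and `MinusCond`.

Sufficiency: `L` is the orthogonal complement of `L ⊕ ℂu₋`, so a bracket is tested against `L` and
`u₋`. The formulas for `∇` remove all derivatives, and (ii) (`TensorCond`) kills what remains. The
conditions are real, hence invariant under `J₋ ↦ -J₋`, which settles `𝒢ᵉⁿᵈ 𝓕` as well.

Necessity: sections of `L₊` belong to both eigenbundles, so the `E₋`-part of their bracket lies in
`L₋` and in its conjugate, hence vanishes; pairing with all of `E₋` gives `PlusCond`. For sections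
of `L₋`, the two integrability conditions control the pairings with `L₊` and with its conjugate,
which together span `E₊` over `ℂ`; this yields `MinusCond` and the conditions on `F`. The remaining
pairings, inside `E₊` or inside `E₋`, give the conditions on `H`. -/

theorem SmoothField.diffFieldAt {X : ∀ x : M, Tan n x} (hX : SmoothField X) (x : M) :
    DiffFieldAt X x :=
  ContMDiff.mdifferentiable hX (by simp) x

theorem SmoothFun.mdifferentiableAt {f : M → ℝ} (hf : SmoothFun n f) (x : M) :
    MDifferentiableAt (𝓡 n) 𝓘(ℝ, ℝ) f x :=
  ContMDiff.mdifferentiable hf (by simp) x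

theorem SmoothOneForm.diffOneFormAt {ξ : ∀ x : M, Cotan n x} (hξ : SmoothOneForm ξ) (x : M) :
    DiffOneFormAt ξ x :=
  ContMDiff.mdifferentiable hξ (by simp) x

theorem SmoothField.add {X Y : ∀ x : M, Tan n x} (hX : SmoothField X) (hY : SmoothField Y) :
    SmoothField (fun x => X x + Y x) :=
  ContMDiff.add_section hX hY

theorem SmoothField.sub {X Y : ∀ x : M, Tan n x} (hX : SmoothField X) (hY : SmoothField Y) :
    SmoothField (fun x => X x - Y x) :=
  ContMDiff.sub_section hX hY

theorem SmoothField.smul {f : M → ℝ} {X : ∀ x : M, Tan n x} (hf : SmoothFun n f)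
    (hX : SmoothField X) : SmoothField (fun x => f x • X x) :=
  ContMDiff.smul_section hf hX

theorem SmoothField.const_smul (c : ℝ) {X : ∀ x : M, Tan n x} (hX : SmoothField X) :
    SmoothField (fun x => c • X x) :=
  ContMDiff.const_smul_section hX

theorem SmoothField.neg {X : ∀ x : M, Tan n x} (hX : SmoothField X) :
    SmoothField (fun x => -X x) :=
  ContMDiff.neg_section hX

theorem smoothField_zero : SmoothField (fun x : M => (0 : Tan n x)) :=
  contMDiff_zeroSection ℝ _

theorem smoothFun_const (c : ℝ) : SmoothFun n (fun _ : M => c) :=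
  contMDiff_const

theorem SmoothOneForm.add {X Y : ∀ x : M, Cotan n x} (hX : SmoothOneForm X)
    (hY : SmoothOneForm Y) : SmoothOneForm (fun x => X x + Y x) :=
  ContMDiff.add_section hX hY

theorem SmoothOneForm.const_smul (c : ℝ) {X : ∀ x : M, Cotan n x} (hX : SmoothOneForm X) :
    SmoothOneForm (fun x => c • X x) :=
  ContMDiff.const_smul_section hX

theorem SmoothOneForm.sub {X Y : ∀ x : M, Cotan n x} (hX : SmoothOneForm X)
    (hY : SmoothOneForm Y) : SmoothOneForm (fun x => X x - Y x) :=
  ContMDiff.sub_section hX hY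

theorem smoothOneForm_zero : SmoothOneForm (fun x : M => (0 : Cotan n x)) :=
  contMDiff_zeroSection ℝ _

theorem SmoothSection.add {u v : ∀ x : M, Fib n x} (hu : SmoothSection u)
    (hv : SmoothSection v) : SmoothSection (fun x => u x + v x) :=
  ⟨hu.1.add hv.1, hu.2.1.add hv.2.1, ContMDiff.add hu.2.2 hv.2.2⟩

theorem SmoothSection.const_smul (c : ℝ) {u : ∀ x : M, Fib n x} (hu : SmoothSection u) :
    SmoothSection (fun x => c • u x) :=
  ⟨hu.1.const_smul c, hu.2.1.const_smul c, ContMDiff.mul contMDiff_const hu.2.2⟩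

theorem SmoothSection.sub {u v : ∀ x : M, Fib n x} (hu : SmoothSection u)
    (hv : SmoothSection v) : SmoothSection (fun x => u x - v x) := by
  exact ⟨hu.1.sub hv.1, hu.2.1.sub hv.2.1, ContMDiff.sub hu.2.2 hv.2.2⟩

theorem SmoothField.section {X : ∀ x : M, Tan n x} (hX : SmoothField X) :
    SmoothSection (fun x => ((X x, 0, 0) : Fib n x)) :=
  ⟨hX, smoothOneForm_zero, smoothFun_const 0⟩

/-- Every tangent vector is the value of a globally defined smooth vector field. -/
theorem exists_smoothField_eq [T2Space M] {x : M} (v : Tan n x) :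
    ∃ X : ∀ x : M, Tan n x, SmoothField X ∧ X x = v := by
  obtain ⟨s, hs, h⟩ := exists_contMDiffOn_extend (k := ∞) (I := 𝓡 n) (Model n) v
  obtain ⟨t, hts, ht, hxt⟩ := mem_nhds_iff.1 hs
  obtain ⟨f, hf, -⟩ := (SmoothBumpFunction.nhds_basis_support (I := 𝓡 n) (ht.mem_nhds hxt)).mem_iff.1
    Filter.univ_mem
  refine ⟨fun y => f y • FiberBundle.extend (Model n) v y,
    ContMDiffOn.smul_section_of_tsupport f.contMDiff.contMDiffOn ht hf (h.mono hts), ?_⟩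
  simp

/-! ### The Levi-Civita connection on smooth fields -/

theorem PseudoRiemannianMetric.leviCivita_add (g : PseudoRiemannianMetric n M)
    {X Y : ∀ x : M, Tan n x} {x : M} (hX : DiffFieldAt X x) (hY : DiffFieldAt Y x) (v : Tan n x) :
    g.leviCivita (fun y => X y + Y y) x v = g.leviCivita X x v + g.leviCivita Y x v := by
  have := g.leviCivita.isCovariantDerivativeOnUniv.add hX hY (Set.mem_univ x)
  exact DFunLike.congr_fun (F := Tan n x →L[ℝ] Tan n x) this v

theorem PseudoRiemannianMetric.leviCivita_smul (g : PseudoRiemannianMetric n M)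
    {f : M → ℝ} {X : ∀ x : M, Tan n x} {x : M} (hf : MDifferentiableAt (𝓡 n) 𝓘(ℝ, ℝ) f x)
    (hX : DiffFieldAt X x) (v : Tan n x) :
    g.leviCivita (fun y => f y • X y) x v = f x • g.leviCivita X x v + dFun f x v • X x := by
  have := g.leviCivita.isCovariantDerivativeOnUniv.leibniz hX hf (Set.mem_univ x)
  exact DFunLike.congr_fun (F := Tan n x →L[ℝ] Tan n x) this v

theorem PseudoRiemannianMetric.leviCivita_const_smul (g : PseudoRiemannianMetric n M)
    (c : ℝ) {X : ∀ x : M, Tan n x} {x : M} (hX : DiffFieldAt X x) (v : Tan n x) :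
    g.leviCivita (fun y => c • X y) x v = c • g.leviCivita X x v := by
  have := g.leviCivita.isCovariantDerivativeOnUniv.smul_const c hX (Set.mem_univ x)
  exact DFunLike.congr_fun (F := Tan n x →L[ℝ] Tan n x) this v

theorem PseudoRiemannianMetric.dFun_val (g : PseudoRiemannianMetric n M)
    {Y Z : ∀ x : M, Tan n x} {x : M} (hY : DiffFieldAt Y x) (hZ : DiffFieldAt Z x) (v : Tan n x) :
    dFun (fun y => g.val y (Y y) (Z y)) x v =
      g.val x (g.leviCivita Y x v) (Z x) + g.val x (Y x) (g.leviCivita Z x v) := by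
  have := g.leviCivita_metric (diffFieldAt_extend v) hY hZ
  simpa using this

/-! ### The Dorfman bracket in terms of the Levi-Civita connection -/

/-- The element of `E` with components `p + i_p g ∈ E₊`, `q - i_q g ∈ E₋` and `c ∈ E₊`. -/
noncomputable def PseudoRiemannianMetric.mkFib (g : PseudoRiemannianMetric n M) {x : M} (p q : Tan n x) (c : ℝ) :
    Fib n x := (p + q, g.val x p - g.val x q, c)

/-- The two-form `F` as a bilinear map. -/
noncomputable def TypeBn.Fₗ (T : TypeBn n M) (x : M) : Tan n x →ₗ[ℝ] Tan n x →ₗ[ℝ] ℝ :=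
  LinearMap.mk₂ ℝ (fun v w => T.F x v w)
    (fun v v' w => by rw [(T.F x).map_add]; rfl) (fun c v w => by rw [(T.F x).map_smul]; rfl)
    (fun v w w' => (T.F x v).map_add w w') (fun c v w => (T.F x v).map_smul c w)

/-- The metric as a bilinear map. -/
noncomputable def PseudoRiemannianMetric.valₗ (g : PseudoRiemannianMetric n M) (x : M) :
    Tan n x →ₗ[ℝ] Tan n x →ₗ[ℝ] ℝ :=
  LinearMap.mk₂ ℝ (fun v w => g.val x v w)
    (fun v v' w => by rw [(g.val x).map_add]; rfl) (fun c v w => by rw [(g.val x).map_smul]; rfl)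
    (fun v w w' => (g.val x v).map_add w w') (fun c v w => (g.val x v).map_smul c w)

/-- The three-form `H` as a trilinear map. -/
noncomputable def TypeBn.Hₗ (T : TypeBn n M) (x : M) :
    Tan n x →ₗ[ℝ] Tan n x →ₗ[ℝ] Tan n x →ₗ[ℝ] ℝ where
  toFun u := LinearMap.mk₂ ℝ (fun v w => T.H x u v w)
    (fun v v' w => by rw [(T.H x u).map_add]; rfl) (fun c v w => by rw [(T.H x u).map_smul]; rfl)
    (fun v w w' => (T.H x u v).map_add w w') (fun c v w => (T.H x u v).map_smul c w)
  map_add' u u' := by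
    ext v w
    simp only [LinearMap.mk₂_apply, LinearMap.add_apply, (T.H x).map_add]
    rfl
  map_smul' c u := by
    ext v w
    simp only [LinearMap.mk₂_apply, LinearMap.smul_apply, (T.H x).map_smul]
    rfl

theorem TypeBn.Fₗ_apply (T : TypeBn n M) {x : M} (v w : Tan n x) : T.Fₗ x v w = T.F x v w := rfl

theorem TypeBn.Hₗ_apply (T : TypeBn n M) {x : M} (u v w : Tan n x) :
    T.Hₗ x u v w = T.H x u v w := rfl

theorem PseudoRiemannianMetric.valₗ_apply (g : PseudoRiemannianMetric n M) {x : M}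
    (v w : Tan n x) : g.valₗ x v w = g.val x v w := rfl

theorem TypeBn.Fₗ_isAlt (T : TypeBn n M) (x : M) : (T.Fₗ x).IsAlt := T.F_alt x

theorem TypeBn.F_swap (T : TypeBn n M) {x : M} (v w : Tan n x) : T.F x v w = -T.F x w v :=
  ((T.Fₗ_isAlt x).neg w v).symm

theorem TypeBn.H_swap_right (T : TypeBn n M) {x : M} (u v w : Tan n x) :
    T.H x u v w = -T.H x u w v :=
  (LinearMap.IsAlt.neg (B := T.Hₗ x u) (T.H_alt_right x u) w v).symm

theorem TypeBn.H_swap_left (T : TypeBn n M) {x : M} (u v w : Tan n x) :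
    T.H x u v w = -T.H x v u w :=
  (LinearMap.IsAlt.neg (B := (T.Hₗ x).compr₂ (LinearMap.applyₗ w))
    (fun u => T.H_alt_left x u w) v u).symm

/-- The scalar product of the Dorfman bracket of two sections with a vector, in terms of the
Levi-Civita connection. -/
theorem pairing_dorfman (T : TypeBn n M) (g : PseudoRiemannianMetric n M)
    {u v : ∀ x : M, Fib n x} (hu : SmoothSection u) (hv : SmoothSection v)
    {P Q P' Q' : ∀ x : M, Tan n x} {a b : M → ℝ}
    (hP : SmoothField P) (hQ : SmoothField Q) (hP' : SmoothField P') (hQ' : SmoothField Q')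
    (eu : ∀ x, u x = g.mkFib (P x) (Q x) (a x)) (ev : ∀ x, v x = g.mkFib (P' x) (Q' x) (b x))
    (x : M) (p q : Tan n x) (c : ℝ) :
    pairing (dorfman T u v x) (g.mkFib p q c) =
      (g.val x (g.leviCivita P' x (P x + Q x)) p - g.val x (g.leviCivita Q' x (P x + Q x)) q
          + c * dFun b x (P x + Q x))
      - (g.val x (g.leviCivita P x (P' x + Q' x)) p - g.val x (g.leviCivita Q x (P' x + Q' x)) q
          + c * dFun a x (P' x + Q' x))
      + (g.val x (g.leviCivita P x (p + q)) (P' x) - g.val x (g.leviCivita Q x (p + q)) (Q' x)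
          + b x * dFun a x (p + q))
      + (-(1 / 2) * T.H x (P x + Q x) (P' x + Q' x) (p + q) - b x * T.F x (P x + Q x) (p + q)
          + a x * T.F x (P' x + Q' x) (p + q) + c * T.F x (P x + Q x) (P' x + Q' x)) := by
  -- The Lie and exterior derivatives are evaluated on vector fields, so the test vector `p + q` is
  -- extended to a field; the derivatives of `Z` cancel below.
  obtain ⟨Z, hZ, hZx⟩ : ∃ Z : ∀ x : M, Tan n x, DiffFieldAt Z x ∧ Z x = p + q :=
    ⟨_, diffFieldAt_extend (p + q), by simp⟩
  have eu' : u = fun y => g.mkFib (P y) (Q y) (a y) := funext eu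
  have ev' : v = fun y => g.mkFib (P' y) (Q' y) (b y) := funext ev
  have hX : DiffFieldAt (fun y => P y + Q y) x := (hP.add hQ).diffFieldAt x
  have hY : DiffFieldAt (fun y => P' y + Q' y) x := (hP'.add hQ').diffFieldAt x
  have hξ : DiffOneFormAt (fun y => g.val y (P y) - g.val y (Q y)) x := by
    have := hu.2.1.diffOneFormAt x
    rwa [eu'] at this
  have hη : DiffOneFormAt (fun y => g.val y (P' y) - g.val y (Q' y)) x := by
    have := hv.2.1.diffOneFormAt x
    rwa [ev'] at this
  have dP := hP.diffFieldAt x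
  have dQ := hQ.diffFieldAt x
  have dP' := hP'.diffFieldAt x
  have dQ' := hQ'.diffFieldAt x
  have D {A B C : ∀ x : M, Tan n x} (hA : DiffFieldAt A x) (hB : DiffFieldAt B x)
      (hC : DiffFieldAt C x) (v : Tan n x) :
      dFun (fun y => (g.val y (A y) - g.val y (B y)) (C y)) x v =
        g.val x (g.leviCivita A x v) (C x) + g.val x (A x) (g.leviCivita C x v)
        - g.val x (g.leviCivita B x v) (C x) - g.val x (B x) (g.leviCivita C x v) := by
    have e : (fun y => (g.val y (A y) - g.val y (B y)) (C y)) =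
        fun y => g.val y (A y) (C y) + (-1) * g.val y (B y) (C y) := by
      funext y; simp; ring
    have hm : MDifferentiableAt (𝓡 n) 𝓘(ℝ, ℝ) (fun y => (-1 : ℝ) * g.val y (B y) (C y)) x :=
      mdifferentiableAt_const.mul (g.smooth.apply hB hC)
    rw [e, dFun_add (g.smooth.apply hA hC) hm, dFun_mul mdifferentiableAt_const (g.smooth.apply hB hC)]
    have : (dFun (fun _ : M => (-1 : ℝ)) x : Cotan n x) = 0 := by
      simp [dFun, mvfderiv]
    rw [this]
    simp [g.dFun_val hA hC, g.dFun_val hB hC]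
    ring
  have t1 := g.leviCivita_torsion hX hY
  have t2 := g.leviCivita_torsion hX hZ
  have t3 := g.leviCivita_torsion hY hZ
  have l := lieDeriv_apply (X := fun y => P y + Q y) hη hZ
  have o := dOne_apply hξ hY hZ
  -- Torsion-freeness turns `[X,Z]` and `[Y,Z]` into covariant derivatives; the terms with `∇Z`
  -- cancel against those from the product rule.
  rw [D dP' dQ' hZ, ← t2, hZx] at l
  rw [D dP dQ hZ, D dP dQ hY, ← t3, hZx] at o
  simp only [g.leviCivita_add dP dQ, g.leviCivita_add dP' dQ'] at t1 l o
  have hH := T.H_swap_left (P' x + Q' x) (P x + Q x) (p + q)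
  simp only [pairing, dorfman, eu', ev', PseudoRiemannianMetric.mkFib]
  rw [← t1]
  simp only [_root_.add_apply, _root_.sub_apply, _root_.smul_apply, smul_eq_mul, l, o, hH]
  generalize T.H x (P x + Q x) (P' x + Q' x) (p + q) = A
  generalize T.F x (P x + Q x) (P' x + Q' x) = A
  generalize T.F x (P x + Q x) (p + q) = A
  generalize T.F x (P' x + Q' x) (p + q) = A
  simp only [← g.valₗ_apply]
  have sy (v w : Tan n x) : g.valₗ x v w = g.valₗ x w v := g.symm x v w
  simp only [sy p, sy q, sy (P' x), sy (Q' x)]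
  simp only [map_add, map_sub, LinearMap.add_apply, LinearMap.sub_apply]
  ring

end

/-! ### Complex-linear extensions -/

namespace Cx

variable {V W : Type*} [AddCommGroup V] [Module ℝ V] [AddCommGroup W] [Module ℝ W]

@[simp] theorem sub_re (z w : Cx V) : (z - w).re = z.re - w.re := by
  rw [sub_eq_add_neg, sub_eq_add_neg]; rfl

@[simp] theorem sub_im (z w : Cx V) : (z - w).im = z.im - w.im := by
  rw [sub_eq_add_neg, sub_eq_add_neg]; rfl

/-- A real vector as an element of the complexification. -/
def ofReal (v : V) : Cx V := ⟨v, 0⟩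

@[simp] theorem ofReal_re (v : V) : (ofReal v).re = v := rfl
@[simp] theorem ofReal_im (v : V) : (ofReal v).im = 0 := rfl

/-- Complex conjugation. -/
def conj (z : Cx V) : Cx V := ⟨z.re, -z.im⟩

@[simp] theorem conj_re (z : Cx V) : (conj z).re = z.re := rfl
@[simp] theorem conj_im (z : Cx V) : (conj z).im = -z.im := rfl

theorem conj_conj (z : Cx V) : conj (conj z) = z := by ext <;> simp

theorem eq_re_add_im (z : Cx V) : z = ofReal z.re + Complex.I • ofReal z.im := by
  ext <;> simp

@[simp] theorem map_re (A : V →ₗ[ℝ] W) (z : Cx V) : (map A z).re = A z.re := rfl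
@[simp] theorem map_im (A : V →ₗ[ℝ] W) (z : Cx V) : (map A z).im = A z.im := rfl

theorem mem_iEigen {A : Module.End ℝ V} {z : Cx V} :
    z ∈ iEigen A ↔ A z.re = -z.im ∧ A z.im = z.re := by
  rw [iEigen, Module.End.mem_eigenspace_iff, Cx.ext_iff]
  simp

/-- The complex-bilinear extension of a real bilinear form, as a bilinear map. -/
def bil (B : V →ₗ[ℝ] W →ₗ[ℝ] ℝ) : Cx V →ₗ[ℂ] Cx W →ₗ[ℂ] ℂ :=
  LinearMap.mk₂ ℂ
    (fun z w => ⟨B z.re w.re - B z.im w.im, B z.re w.im + B z.im w.re⟩)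
    (fun z z' w => by apply Complex.ext <;> simp <;> ring)
    (fun c z w => by apply Complex.ext <;> simp <;> ring)
    (fun z w w' => by apply Complex.ext <;> simp <;> ring)
    (fun c z w => by apply Complex.ext <;> simp <;> ring)

theorem bil_apply (B : V →ₗ[ℝ] W →ₗ[ℝ] ℝ) (z : Cx V) (w : Cx W) :
    bil B z w = ⟨B z.re w.re - B z.im w.im, B z.re w.im + B z.im w.re⟩ := rfl

theorem bil_symm {B : V →ₗ[ℝ] V →ₗ[ℝ] ℝ} (hB : ∀ v w, B v w = B w v) (z w : Cx V) :
    bil B z w = bil B w z := by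
  simp only [bil_apply, hB w.re, hB w.im]
  apply Complex.ext <;> simp <;> ring

theorem bil_swap {B : V →ₗ[ℝ] V →ₗ[ℝ] ℝ} (hB : ∀ v w, B v w = -B w v) (z w : Cx V) :
    bil B z w = -bil B w z := by
  simp only [bil_apply, hB w.re, hB w.im]
  apply Complex.ext <;> simp <;> ring

theorem bil_conj (B : V →ₗ[ℝ] W →ₗ[ℝ] ℝ) (z : Cx V) (w : Cx W) :
    bil B (conj z) (conj w) = (starRingEnd ℂ) (bil B z w) := by
  simp only [bil_apply]
  apply Complex.ext <;> simp <;> ring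

/-- The complex-trilinear extension of a real trilinear form, as a trilinear map. -/
noncomputable def tri (T : V →ₗ[ℝ] V →ₗ[ℝ] V →ₗ[ℝ] ℝ) :
    Cx V →ₗ[ℂ] Cx V →ₗ[ℂ] Cx V →ₗ[ℂ] ℂ where
  toFun a := bil (T a.re) + Complex.I • bil (T a.im)
  map_add' a b := by
    ext z w
    apply Complex.ext <;> simp [bil_apply] <;> ring
  map_smul' c a := by
    ext z w
    apply Complex.ext <;> simp [bil_apply] <;> ring

theorem tri_apply (T : V →ₗ[ℝ] V →ₗ[ℝ] V →ₗ[ℝ] ℝ) (a b c : Cx V) :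
    tri T a b c = bil (T a.re) b c + Complex.I * bil (T a.im) b c := rfl

theorem tri_ofReal (T : V →ₗ[ℝ] V →ₗ[ℝ] V →ₗ[ℝ] ℝ) (a : V) (b c : Cx V) :
    tri T (ofReal a) b c = bil (T a) b c := by
  simp [tri_apply, bil_apply]
  rfl

theorem tri_swap_left {T : V →ₗ[ℝ] V →ₗ[ℝ] V →ₗ[ℝ] ℝ} (hT : ∀ u v w, T u v w = -T v u w)
    (a b c : Cx V) : tri T a b c = -tri T b a c := by
  simp only [tri_apply, bil_apply, hT b.re, hT b.im]
  apply Complex.ext <;> simp <;> ring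

theorem tri_swap_right {T : V →ₗ[ℝ] V →ₗ[ℝ] V →ₗ[ℝ] ℝ} (hT : ∀ u v w, T u v w = -T u w v)
    (a b c : Cx V) : tri T a b c = -tri T a c b := by
  rw [tri_apply, tri_apply, bil_swap (hT a.re), bil_swap (hT a.im)]
  ring

theorem tri_conj (T : V →ₗ[ℝ] V →ₗ[ℝ] V →ₗ[ℝ] ℝ) (a b c : Cx V) :
    tri T (conj a) (conj b) (conj c) = (starRingEnd ℂ) (tri T a b c) := by
  simp only [tri_apply, bil_apply]
  apply Complex.ext <;> simp <;> ring

/-- The complex-linear extension of `A + iB` for real-linear maps `A`, `B`. -/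
def lin (A B : V →ₗ[ℝ] W) : Cx V →ₗ[ℂ] Cx W where
  toFun z := ⟨A z.re - B z.im, A z.im + B z.re⟩
  map_add' z w := by ext <;> simp <;> abel
  map_smul' c z := by ext <;> simp <;> module

theorem lin_apply (A B : V →ₗ[ℝ] W) (z : Cx V) :
    lin A B z = ⟨A z.re - B z.im, A z.im + B z.re⟩ := rfl

/-- The complex-linear extension of `a + ib` for real linear forms `a`, `b`. -/
def form (a b : V →ₗ[ℝ] ℝ) : Cx V →ₗ[ℂ] ℂ where
  toFun z := ⟨a z.re - b z.im, a z.im + b z.re⟩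
  map_add' z w := by apply Complex.ext <;> simp <;> ring
  map_smul' c z := by apply Complex.ext <;> simp <;> ring

theorem form_apply (a b : V →ₗ[ℝ] ℝ) (z : Cx V) :
    form a b z = ⟨a z.re - b z.im, a z.im + b z.re⟩ := rfl

end Cx

section
variable {n : ℕ} {M : Type*} [TopologicalSpace M] [ChartedSpace (EuclideanSpace ℝ (Fin n)) M]
  [IsManifold (𝓡 n) ∞ M]

/-! ### Complex vector fields -/

/-- Smoothness of a complex vector field. -/
def SmoothFieldC (Z : ∀ x : M, Cx (Tan n x)) : Prop :=
  SmoothField (fun x => (Z x).re) ∧ SmoothField (fun x => (Z x).im)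

/-- Smoothness of a complex function. -/
def SmoothFunC (n : ℕ) {M : Type*} [TopologicalSpace M]
    [ChartedSpace (EuclideanSpace ℝ (Fin n)) M] (f : M → ℂ) : Prop :=
  SmoothFun n (fun x => (f x).re) ∧ SmoothFun n (fun x => (f x).im)

/-- The complex-linear extension of `v ↦ ∇_v Z`. -/
noncomputable def PseudoRiemannianMetric.nablaC (g : PseudoRiemannianMetric n M)
    (Z : ∀ x : M, Cx (Tan n x)) (x : M) : Cx (Tan n x) →ₗ[ℂ] Cx (Tan n x) :=
  Cx.lin (g.leviCivita (fun y => (Z y).re) x : Tan n x →ₗ[ℝ] Tan n x)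
    (g.leviCivita (fun y => (Z y).im) x : Tan n x →ₗ[ℝ] Tan n x)

/-- The complex-linear extension of the differential of a complex function. -/
noncomputable def dC (f : M → ℂ) (x : M) : Cx (Tan n x) →ₗ[ℂ] ℂ :=
  Cx.form (dFun (fun y => (f y).re) x : Cotan n x).toLinearMap
    (dFun (fun y => (f y).im) x : Cotan n x).toLinearMap

/-- The complex-bilinear extension of the metric. -/
noncomputable def PseudoRiemannianMetric.valC (g : PseudoRiemannianMetric n M) (x : M) :
    Cx (Tan n x) →ₗ[ℂ] Cx (Tan n x) →ₗ[ℂ] ℂ := Cx.bil (g.valₗ x)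

/-- The complex-bilinear extension of `F`. -/
noncomputable def TypeBn.FC (T : TypeBn n M) (x : M) :
    Cx (Tan n x) →ₗ[ℂ] Cx (Tan n x) →ₗ[ℂ] ℂ := Cx.bil (T.Fₗ x)

/-- The complex-trilinear extension of `H`. -/
noncomputable def TypeBn.HC (T : TypeBn n M) (x : M) :
    Cx (Tan n x) →ₗ[ℂ] Cx (Tan n x) →ₗ[ℂ] Cx (Tan n x) →ₗ[ℂ] ℂ := Cx.tri (T.Hₗ x)

theorem PseudoRiemannianMetric.valC_symm (g : PseudoRiemannianMetric n M) {x : M}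
    (z w : Cx (Tan n x)) : g.valC x z w = g.valC x w z :=
  Cx.bil_symm (g.symm x) z w

theorem TypeBn.FC_swap (T : TypeBn n M) {x : M} (z w : Cx (Tan n x)) :
    T.FC x z w = -T.FC x w z :=
  Cx.bil_swap T.F_swap z w

theorem TypeBn.HC_swap_left (T : TypeBn n M) {x : M} (a b c : Cx (Tan n x)) :
    T.HC x a b c = -T.HC x b a c :=
  Cx.tri_swap_left T.H_swap_left a b c

theorem TypeBn.HC_swap_right (T : TypeBn n M) {x : M} (a b c : Cx (Tan n x)) :
    T.HC x a b c = -T.HC x a c b :=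
  Cx.tri_swap_right T.H_swap_right a b c

/-- The scalar product as a bilinear map. -/
noncomputable def pairingₗ (n : ℕ) {M : Type*} [TopologicalSpace M]
    [ChartedSpace (EuclideanSpace ℝ (Fin n)) M] (x : M) : Fib n x →ₗ[ℝ] Fib n x →ₗ[ℝ] ℝ :=
  LinearMap.mk₂ ℝ (fun u v => pairing u v)
    (fun u u' v => by simp [pairing]; ring) (fun c u v => by simp [pairing]; ring)
    (fun u v v' => by simp [pairing]; ring) (fun c u v => by simp [pairing]; ring)

theorem pairingₗ_apply {x : M} (u v : Fib n x) : pairingₗ n x u v = pairing u v := rfl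

/-- The complex-bilinear extension of the scalar product. -/
noncomputable def pairingC (n : ℕ) {M : Type*} [TopologicalSpace M]
    [ChartedSpace (EuclideanSpace ℝ (Fin n)) M] (x : M) :
    Cx (Fib n x) →ₗ[ℂ] Cx (Fib n x) →ₗ[ℂ] ℂ := Cx.bil (pairingₗ n x)

/-- The element of `E_ℂ` with components `p + i_p g + c ∈ E₊` and `q - i_q g ∈ E₋`. -/
noncomputable def PseudoRiemannianMetric.mkFibC (g : PseudoRiemannianMetric n M) {x : M}
    (p q : Cx (Tan n x)) (c : ℂ) : Cx (Fib n x) :=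
  ⟨g.mkFib p.re q.re c.re, g.mkFib p.im q.im c.im⟩

/-- The scalar product of the Dorfman bracket of two complex sections with a complex vector, in
terms of the Levi-Civita connection. -/
theorem pairingC_dorfmanC (T : TypeBn n M) (g : PseudoRiemannianMetric n M)
    {u v : ∀ x : M, Cx (Fib n x)} (hu : SmoothSectionC u) (hv : SmoothSectionC v)
    {P Q P' Q' : ∀ x : M, Cx (Tan n x)} {a b : M → ℂ}
    (hP : SmoothFieldC P) (hQ : SmoothFieldC Q) (hP' : SmoothFieldC P') (hQ' : SmoothFieldC Q')
    (eu : ∀ x, u x = g.mkFibC (P x) (Q x) (a x)) (ev : ∀ x, v x = g.mkFibC (P' x) (Q' x) (b x))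
    (x : M) (p q : Cx (Tan n x)) (c : ℂ) :
    pairingC n x (dorfmanC T u v x) (g.mkFibC p q c) =
      (g.valC x (g.nablaC P' x (P x + Q x)) p - g.valC x (g.nablaC Q' x (P x + Q x)) q
          + c * dC b x (P x + Q x))
      - (g.valC x (g.nablaC P x (P' x + Q' x)) p - g.valC x (g.nablaC Q x (P' x + Q' x)) q
          + c * dC a x (P' x + Q' x))
      + (g.valC x (g.nablaC P x (p + q)) (P' x) - g.valC x (g.nablaC Q x (p + q)) (Q' x)
          + b x * dC a x (p + q))
      + (-(1 / 2) * T.HC x (P x + Q x) (P' x + Q' x) (p + q) - b x * T.FC x (P x + Q x) (p + q)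
          + a x * T.FC x (P' x + Q' x) (p + q) + c * T.FC x (P x + Q x) (P' x + Q' x)) := by
  have eur (y : M) : (u y).re = g.mkFib (P y).re (Q y).re (a y).re := by rw [eu]; rfl
  have eui (y : M) : (u y).im = g.mkFib (P y).im (Q y).im (a y).im := by rw [eu]; rfl
  have evr (y : M) : (v y).re = g.mkFib (P' y).re (Q' y).re (b y).re := by rw [ev]; rfl
  have evi (y : M) : (v y).im = g.mkFib (P' y).im (Q' y).im (b y).im := by rw [ev]; rfl
  -- The complex bracket is the bilinear extension of the real one, so the four combinations of real
  -- and imaginary parts suffice.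
  have rr := pairing_dorfman T g hu.1 hv.1 hP.1 hQ.1 hP'.1 hQ'.1 eur evr x
  have ri := pairing_dorfman T g hu.1 hv.2 hP.1 hQ.1 hP'.2 hQ'.2 eur evi x
  have ir := pairing_dorfman T g hu.2 hv.1 hP.2 hQ.2 hP'.1 hQ'.1 eui evr x
  have ii := pairing_dorfman T g hu.2 hv.2 hP.2 hQ.2 hP'.2 hQ'.2 eui evi x
  simp only [pairingC, dorfmanC, Cx.bil_apply, PseudoRiemannianMetric.mkFibC, map_add, map_sub,
    LinearMap.add_apply, LinearMap.sub_apply, pairingₗ_apply]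
  simp only [rr, ri, ir, ii]
  simp only [← T.Fₗ_apply, ← T.Hₗ_apply, ← g.valₗ_apply]
  simp only [PseudoRiemannianMetric.valC, TypeBn.FC, TypeBn.HC, PseudoRiemannianMetric.nablaC, dC,
    Cx.bil_apply, Cx.tri_apply, Cx.lin_apply, Cx.form_apply, map_add, map_sub, LinearMap.add_apply,
    LinearMap.sub_apply, ContinuousLinearMap.coe_coe]
  apply Complex.ext <;> simp <;> ring

end

/-! ### Real endomorphisms with isotropic `i`-eigenspace -/

namespace Cx

variable {E : Type*} [AddCommGroup E] [Module ℝ E] {A : Module.End ℝ E}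

theorem mk_mem_iEigen {u : E} (hu : A (A u) = -u) : (⟨u, -A u⟩ : Cx E) ∈ iEigen A := by
  rw [mem_iEigen]
  simp [hu]

theorem sq_re_of_mem {z : Cx E} (hz : z ∈ iEigen A) : A (A z.re) = -z.re := by
  rw [mem_iEigen] at hz
  simp [hz.1, hz.2]

theorem sq_im_of_mem {z : Cx E} (hz : z ∈ iEigen A) : A (A z.im) = -z.im := by
  rw [mem_iEigen] at hz
  simp [hz.1, hz.2]

/-- The real-linear isomorphism from the `i`-eigenspace of `A` to the kernel of `A² + 1`, given by
the real part. -/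
def iEigenEquiv (A : Module.End ℝ E) : iEigen A ≃ₗ[ℝ] LinearMap.ker (A * A + 1) where
  toFun z := ⟨(z : Cx E).re, by simp [sq_re_of_mem z.2]⟩
  map_add' z w := by ext; simp
  map_smul' c z := by
    ext
    change ((c : ℂ) • (z : Cx E)).re = c • (z : Cx E).re
    rw [smul_re]
    simp
  invFun u := ⟨⟨u, -A u⟩, mk_mem_iEigen (by
    have := u.2
    rw [LinearMap.mem_ker] at this
    exact eq_neg_of_add_eq_zero_left this)⟩
  left_inv z := by
    have := mem_iEigen.1 z.2
    ext <;> simp [this.1]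
  right_inv u := by ext; simp

/-- Expresses the rank of the eigenspace through `A * A` alone. This is what carries the rank from
`𝓕` over to `𝒢ᵉⁿᵈ 𝓕`, which has the same square. -/
theorem finrank_ker_sq_add_one (A : Module.End ℝ E) :
    Module.finrank ℝ (LinearMap.ker (A * A + 1)) = 2 * Module.finrank ℂ (iEigen A) := by
  rw [← finrank_real_of_complex, (iEigenEquiv A).finrank_eq]

theorem mem_ker_sq_add_one {u : E} : u ∈ LinearMap.ker (A * A + 1) ↔ A (A u) = -u := by
  rw [LinearMap.mem_ker, LinearMap.add_apply, ← eq_neg_iff_add_eq_zero]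
  rfl

variable {B : E →ₗ[ℝ] E →ₗ[ℝ] ℝ}

/-- Real and imaginary parts of `i`-eigenvectors lie in `ker (A² + 1)`, so orthogonality to this
real space implies orthogonality to the eigenspace. -/
theorem apply_eq_zero_of_forall_ker
    (hz : ∀ u, (∀ z ∈ iEigen A, bil B (ofReal u) z = 0) → A u = 0) {u : E}
    (hu : ∀ w ∈ LinearMap.ker (A * A + 1), B w u = 0) (hs : ∀ v w, B v w = B w v) : A u = 0 := by
  refine hz u fun z hz => ?_
  have h1 := hu z.re (mem_ker_sq_add_one.2 (sq_re_of_mem hz))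
  have h2 := hu z.im (mem_ker_sq_add_one.2 (sq_im_of_mem hz))
  rw [hs] at h1 h2
  simp only [bil_apply, ofReal_re, ofReal_im, h1, h2]
  simp
  rfl

variable [FiniteDimensional ℝ E]

/-- A vector of `ker (A² + 1)` orthogonal to that whole space is killed by `A`, and also satisfies
`A² = -1`, so it is zero. Thus `B` is non-degenerate on `ker (A² + 1)`, and the orthogonal
complement of this space splits off and is annihilated by `A`. -/
theorem exists_add_of_isotropic (hs : ∀ v w, B v w = B w v)
    (hz : ∀ u, (∀ z ∈ iEigen A, bil B (ofReal u) z = 0) → A u = 0) (u : E) :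
    ∃ w k, u = w + k ∧ A (A w) = -w ∧ A k = 0 ∧ ∀ w', A (A w') = -w' → B w' k = 0 := by
  have hr : LinearMap.IsRefl B := fun v w h => by rw [hs, h]
  have hn : (LinearMap.BilinForm.restrict B (LinearMap.ker (A * A + 1))).Nondegenerate := by
    have hk : ∀ m : LinearMap.ker (A * A + 1),
        (∀ m' : LinearMap.ker (A * A + 1), B m m' = 0) → m = 0 := by
      intro m hm
      have h0 := apply_eq_zero_of_forall_ker hz (u := (m : E))
        (fun w hw => by rw [hs]; exact hm ⟨w, hw⟩) hs
      have h1 := mem_ker_sq_add_one.1 m.2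
      rw [h0, map_zero] at h1
      ext
      simpa using h1.symm
    refine ⟨fun m hm => hk m hm, fun m hm => hk m fun m' => ?_⟩
    rw [hs]
    exact hm m'
  have hc := LinearMap.BilinForm.isCompl_orthogonal_of_restrict_nondegenerate hr hn
  obtain ⟨w, hw, k, hk, e⟩ := Submodule.mem_sup.1 (hc.sup_eq_top ▸ Submodule.mem_top (x := u))
  have hk' : ∀ w ∈ LinearMap.ker (A * A + 1), B w k = 0 := fun w hw => hk w hw
  exact ⟨w, k, e.symm, mem_ker_sq_add_one.1 hw, apply_eq_zero_of_forall_ker hz hk' hs,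
    fun w' hw' => hk' w' (mem_ker_sq_add_one.2 hw')⟩

/-- On `ker (A² + 1)`, skewness is the imaginary part of the isotropy relation between `w - iAw` and
`w' - iAw'`. The complement contributes nothing: it is killed by `A` and orthogonal to `ker (A² +
1)`. -/
theorem skew_of_isotropic (hs : ∀ v w, B v w = B w v)
    (hi : ∀ z ∈ iEigen A, ∀ w ∈ iEigen A, bil B z w = 0)
    (hz : ∀ u, (∀ z ∈ iEigen A, bil B (ofReal u) z = 0) → A u = 0) (u v : E) :
    B (A u) v = -B u (A v) := by
  obtain ⟨w, k, rfl, hw, hk, hwk⟩ := exists_add_of_isotropic hs hz u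
  obtain ⟨w', k', rfl, hw', hk', hwk'⟩ := exists_add_of_isotropic hs hz v
  have h := congrArg Complex.im (hi _ (mk_mem_iEigen hw) _ (mk_mem_iEigen hw'))
  simp [bil_apply] at h
  have h1 := hwk' (A w) (by rw [hw, map_neg])
  have h2 := hwk (A w') (by rw [hw', map_neg])
  rw [hs] at h2
  simp [hk, hk', h1, h2]
  linarith

theorem cube_of_isotropic (hs : ∀ v w, B v w = B w v)
    (hz : ∀ u, (∀ z ∈ iEigen A, bil B (ofReal u) z = 0) → A u = 0) (u : E) :
    A (A (A u)) = -A u := by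
  obtain ⟨w, k, rfl, hw, hk, -⟩ := exists_add_of_isotropic hs hz u
  simp [hk, hw]

/-- `ker A` and `ker (A² + 1)` meet only in zero. With eigenspace rank `n` in dimension `2n + 1`,
the kernel is at most a line. -/
theorem finrank_ker_le (A : Module.End ℝ E) :
    2 * Module.finrank ℂ (iEigen A) + Module.finrank ℝ (LinearMap.ker A) ≤ Module.finrank ℝ E := by
  rw [← finrank_ker_sq_add_one]
  refine Submodule.finrank_add_finrank_le_of_disjoint ?_
  rw [Submodule.disjoint_def]
  intro u hu hu'
  have := mem_ker_sq_add_one.1 hu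
  rw [LinearMap.mem_ker.1 hu', map_zero] at this
  simpa using this.symm

theorem exists_smul_eq_of_finrank_ker_le (h : Module.finrank ℝ (LinearMap.ker A) ≤ 1) {u v : E}
    (hu : A u = 0) (hu0 : u ≠ 0) (hv : A v = 0) : ∃ c : ℝ, v = c • u := by
  obtain ⟨w, hw⟩ := finrank_le_one_iff.1 h
  obtain ⟨a, ha⟩ := hw ⟨u, hu⟩
  obtain ⟨b, hb⟩ := hw ⟨v, hv⟩
  have ha' : a • (w : E) = u := congrArg Subtype.val ha
  have hb' : b • (w : E) = v := congrArg Subtype.val hb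
  have ha0 : a ≠ 0 := by
    rintro rfl
    exact hu0 (by rw [← ha', zero_smul])
  refine ⟨b * a⁻¹, ?_⟩
  rw [← ha', ← hb', smul_smul, mul_assoc, inv_mul_cancel₀ ha0, mul_one]

end Cx

/-- An endomorphism of an odd-dimensional real vector space with `J³ = -J` has a kernel. -/
theorem exists_ker_of_cube {V : Type*} [AddCommGroup V] [Module ℝ V]
    (hn : Odd (Module.finrank ℝ V)) (J : Module.End ℝ V) (hJ : ∀ v, J (J (J v)) = -J v) :
    ∃ v, v ≠ 0 ∧ J v = 0 := by
  by_contra! h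
  -- `J² v + v` lies in the kernel because `J³ = -J`. An injective `J` would thus satisfy `J² = -1`,
  -- and `det(J)²` would be `-1` in odd dimension.
  have hsq : J * J = -1 := by
    ext v
    by_contra hv
    refine h (J (J v) + v) (fun e => hv ?_) (by simp [hJ])
    simpa using eq_neg_of_add_eq_zero_left e
  have hd := congrArg LinearMap.det hsq
  rw [map_mul, show (-1 : Module.End ℝ V) = (-1 : ℝ) • LinearMap.id by ext; simp,
    LinearMap.det_smul, LinearMap.det_id, hn.neg_one_pow] at hd
  nlinarith [mul_self_nonneg (LinearMap.det J)]

/-- `(J, ξ)` is an almost contact structure compatible with the bilinear form `B`. -/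
structure IsAlmostContact {V : Type*} [AddCommGroup V] [Module ℝ V] (B : V →ₗ[ℝ] V →ₗ[ℝ] ℝ)
    (J : Module.End ℝ V) (ξ : V) : Prop where
  skew : ∀ v w, B (J v) w = -B v (J w)
  map_vec : J ξ = 0
  norm : B ξ ξ = 1
  sq : ∀ v, J (J v) = -v + B v ξ • ξ

section
variable {n : ℕ} {M : Type*} [TopologicalSpace M] [ChartedSpace (EuclideanSpace ℝ (Fin n)) M]
  [IsManifold (𝓡 n) ∞ M] (g : PseudoRiemannianMetric n M) {x : M}

/-! ### The components of an almost pseudo-Hermitian structure at a point -/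

theorem PseudoRiemannianMetric.mkFib_add (p q p' q' : Tan n x) (c c' : ℝ) :
    g.mkFib p q c + g.mkFib p' q' c' = g.mkFib (p + p') (q + q') (c + c') := by
  simp only [PseudoRiemannianMetric.mkFib, Prod.mk_add_mk, (g.val x).map_add]
  congr 1
  · abel
  · congr 1; abel

theorem PseudoRiemannianMetric.mkFib_smul (r : ℝ) (p q : Tan n x) (c : ℝ) :
    r • g.mkFib p q c = g.mkFib (r • p) (r • q) (r * c) := by
  simp only [PseudoRiemannianMetric.mkFib, Prod.smul_mk, (g.val x).map_smul, smul_add, smul_sub,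
    smul_eq_mul]

theorem PseudoRiemannianMetric.pairing_mkFib (p q p' q' : Tan n x) (c c' : ℝ) :
    pairing (g.mkFib p q c) (g.mkFib p' q' c') = g.valₗ x p p' - g.valₗ x q q' + c * c' := by
  have hs (v w : Tan n x) : g.valₗ x v w = g.valₗ x w v := g.symm x v w
  simp only [PseudoRiemannianMetric.mkFib, pairing, _root_.sub_apply, ← g.valₗ_apply, map_add,
    hs p', hs q']
  ring

/-- `v + ξ` splits with `p` and `q` half the sum and half the difference of `v` and the `g`-dual of
`ξ`. -/
theorem PseudoRiemannianMetric.mkFib_surj (u : Fib n x) : ∃ p q c, u = g.mkFib p q c := by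
  obtain ⟨v, ξ, c⟩ := u
  have hξ : g.val x (g.sharp x ξ) = ξ := (g.flat x).apply_symm_apply ξ
  refine ⟨(1 / 2 : ℝ) • (v + g.sharp x ξ), (1 / 2 : ℝ) • (v - g.sharp x ξ), c, ?_⟩
  simp only [PseudoRiemannianMetric.mkFib, ← map_sub, ← smul_add, ← smul_sub]
  have e1 : (1 / 2 : ℝ) • (v + g.sharp x ξ + (v - g.sharp x ξ)) = v := by module
  have e2 : (1 / 2 : ℝ) • (v + g.sharp x ξ - (v - g.sharp x ξ)) = g.sharp x ξ := by module
  rw [e1, e2, hξ]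

theorem PseudoRiemannianMetric.mkFib_inj {p q p' q' : Tan n x} {c c' : ℝ}
    (h : g.mkFib p q c = g.mkFib p' q' c') : p = p' ∧ q = q' ∧ c = c' := by
  have h1 : p + q = p' + q' := congrArg (fun u : Fib n x => u.1) h
  have h2 : g.val x p - g.val x q = g.val x p' - g.val x q' := congrArg (fun u : Fib n x => u.2.1) h
  have h3 : p - q = p' - q' := g.injective x (by simpa using h2)
  have hp : (2 : ℝ) • p = (2 : ℝ) • p' := by
    have := congrArg₂ (· + ·) h1 h3
    rw [two_smul, two_smul]
    convert this using 1 <;> abel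
  have hp' := smul_right_injective (Tan n x) (two_ne_zero (α := ℝ)) hp
  refine ⟨hp', ?_, congrArg (fun u : Fib n x => u.2.2) h⟩
  rw [hp'] at h1
  exact add_left_cancel h1

theorem finrank_fib (x : M) : Module.finrank ℝ (Fib n x) = 2 * n + 1 := by
  have h1 : Module.finrank ℝ (Tan n x) = n := finrank_euclideanSpace_fin
  have : FiniteDimensional ℝ (Cotan n x) :=
    (LinearMap.toContinuousLinearMap (𝕜 := ℝ) (E := Tan n x) (F' := ℝ)).finiteDimensional
  rw [Module.finrank_prod, Module.finrank_prod, ← finrank_cotan, h1, Module.finrank_self]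
  ring

end

section
variable {n : ℕ} {M : Type*} [TopologicalSpace M] [ChartedSpace (EuclideanSpace ℝ (Fin n)) M]
  [IsManifold (𝓡 n) ∞ M] {g : PseudoRiemannianMetric n M} {x : M}

instance instFiniteDimensionalFib (x : M) : FiniteDimensional ℝ (Fib n x) :=
  haveI : FiniteDimensional ℝ (Cotan n x) :=
    (LinearMap.toContinuousLinearMap (𝕜 := ℝ) (E := Tan n x) (F' := ℝ)).finiteDimensional
  inferInstance

theorem pairingₗ_symm (u v : Fib n x) : pairingₗ n x u v = pairingₗ n x v u := by
  simp only [pairingₗ_apply, pairing]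
  ring

theorem IsBnGenAlmostComplex.forall_pairingC {A : ∀ x : M, Module.End ℝ (Fib n x)}
    (hA : IsBnGenAlmostComplex A) (x : M) (u : Fib n x)
    (hu : ∀ z ∈ Cx.iEigen (A x), Cx.bil (pairingₗ n x) (Cx.ofReal u) z = 0) : A x u = 0 :=
  hA.eq_zero x u hu

theorem IsBnGenAlmostComplex.skew {A : ∀ x : M, Module.End ℝ (Fib n x)}
    (hA : IsBnGenAlmostComplex A) (u v : Fib n x) : pairing (A x u) v = -pairing u (A x v) :=
  Cx.skew_of_isotropic (B := pairingₗ n x) pairingₗ_symm (hA.isotropic x)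
    (hA.forall_pairingC x) u v

theorem IsBnGenAlmostComplex.cube {A : ∀ x : M, Module.End ℝ (Fib n x)}
    (hA : IsBnGenAlmostComplex A) (u : Fib n x) : A x (A x (A x u)) = -A x u :=
  Cx.cube_of_isotropic (B := pairingₗ n x) pairingₗ_symm (hA.forall_pairingC x) u

theorem IsBnGenAlmostComplex.exists_smul_eq {A : ∀ x : M, Module.End ℝ (Fib n x)}
    (hA : IsBnGenAlmostComplex A) {u v : Fib n x} (hu : A x u = 0) (hu0 : u ≠ 0)
    (hv : A x v = 0) : ∃ c : ℝ, v = c • u := by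
  have h := Cx.finrank_ker_le (A x)
  rw [hA.rank, finrank_fib] at h
  exact Cx.exists_smul_eq_of_finrank_ker_le (by omega) hu hu0 hv

theorem GeneralizedMetric.IsStandard.Gend_minus {G : GeneralizedMetric n M} (hg : G.IsStandard g)
    (q : Tan n x) : G.Gend x (g.mkFib 0 q 0) = -g.mkFib 0 q 0 := by
  have h : g.mkFib 0 q 0 ∈ G.Eminus x := by
    rw [hg]
    exact ⟨q, by simp [PseudoRiemannianMetric.mkFib]⟩
  rw [GeneralizedMetric.Eminus, Module.End.mem_eigenspace_iff] at h
  rw [h, neg_one_smul]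

theorem GeneralizedMetric.IsStandard.exists_of_Gend {G : GeneralizedMetric n M}
    (hg : G.IsStandard g) {u : Fib n x} (hu : G.Gend x u = -u) : ∃ q, u = g.mkFib 0 q 0 := by
  have h : u ∈ G.Eminus x := by
    rw [GeneralizedMetric.Eminus, Module.End.mem_eigenspace_iff, neg_one_smul, hu]
  rw [hg] at h
  obtain ⟨v, rfl⟩ := h
  exact ⟨v, by simp [PseudoRiemannianMetric.mkFib]⟩

theorem GeneralizedMetric.IsStandard.Gend_plus {G : GeneralizedMetric n M} (hg : G.IsStandard g)
    (p : Tan n x) (c : ℝ) : G.Gend x (g.mkFib p 0 c) = g.mkFib p 0 c := by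
  refine G.eq_one x _ fun v hv => ?_
  have hv' : v ∈ G.Eminus x := hv
  rw [hg] at hv'
  obtain ⟨q, rfl⟩ := hv'
  have : ((q, -g.val x q, 0) : Fib n x) = g.mkFib 0 q 0 := by
    simp [PseudoRiemannianMetric.mkFib]
  rw [this, g.pairing_mkFib]
  simp

theorem GeneralizedMetric.IsStandard.Gend_mkFib {G : GeneralizedMetric n M} (hg : G.IsStandard g)
    (p q : Tan n x) (c : ℝ) : G.Gend x (g.mkFib p q c) = g.mkFib p (-q) c := by
  have e : g.mkFib p q c = g.mkFib p 0 c + g.mkFib 0 q 0 := by simp [g.mkFib_add]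
  have e' : -g.mkFib 0 q 0 = g.mkFib 0 (-q) 0 := by
    rw [← neg_one_smul ℝ, g.mkFib_smul]; simp
  rw [e, map_add, hg.Gend_plus, hg.Gend_minus, e', g.mkFib_add]
  simp

variable {S : AlmostPseudoHermitian n M}

theorem AlmostPseudoHermitian.Gend_J (S : AlmostPseudoHermitian n M) (u : Fib n x) :
    S.G.Gend x (S.J x u) = S.J x (S.G.Gend x u) :=
  LinearMap.congr_fun (S.commute x) u

theorem AlmostPseudoHermitian.J_minus (hg : S.G.IsStandard g) (q : Tan n x) :
    S.J x (g.mkFib 0 q 0) = g.mkFib 0 (S.Jminus g x q) 0 := by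
  obtain ⟨q', h⟩ := hg.exists_of_Gend (u := S.J x (g.mkFib 0 q 0))
    (by rw [S.Gend_J, hg.Gend_minus, map_neg])
  have e : g.mkFib 0 q 0 = g.toEminus x q := by
    simp [PseudoRiemannianMetric.mkFib, PseudoRiemannianMetric.toEminus]
  have e' : S.Jminus g x q = (S.J x (g.mkFib 0 q 0)).1 := by rw [e]; rfl
  rw [e', h]
  simp [PseudoRiemannianMetric.mkFib]

/-- `𝓕` commutes with `𝒢ᵉⁿᵈ`, so it preserves the `1`-eigenbundle `E₊`. -/
theorem AlmostPseudoHermitian.exists_J_plus (hg : S.G.IsStandard g) (p : Tan n x) (c : ℝ) :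
    ∃ p' c', S.J x (g.mkFib p 0 c) = g.mkFib p' 0 c' := by
  obtain ⟨p', q', c', h⟩ := g.mkFib_surj (S.J x (g.mkFib p 0 c))
  have h1 := S.Gend_J (g.mkFib p 0 c)
  rw [hg.Gend_plus, h, hg.Gend_mkFib] at h1
  have h2 : q' = 0 := by
    have := (g.mkFib_inj h1).2.1
    have h2 : (2 : ℝ) • q' = 0 := by
      rw [two_smul]
      nth_rewrite 1 [← this]
      simp
    simpa using h2
  exact ⟨p', c', by rw [h, h2]⟩

/-- The scalar part of `𝓕(1)` is `⟨𝓕 1, 1⟩`, which vanishes because `𝓕` is skew. -/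
theorem AlmostPseudoHermitian.J_one (hg : S.G.IsStandard g) :
    S.J x (g.mkFib 0 0 1) = g.mkFib (S.Xplus x) 0 0 := by
  obtain ⟨p', c', h⟩ := S.exists_J_plus hg (0 : Tan n x) 1
  have h1 := S.almostComplex.skew (g.mkFib (x := x) 0 0 1) (g.mkFib 0 0 1)
  rw [h, g.pairing_mkFib, g.pairing_mkFib] at h1
  simp at h1
  have hc : c' = 0 := by linarith
  have e : g.mkFib (x := x) 0 0 1 = (0, 0, 1) := by simp [PseudoRiemannianMetric.mkFib]
  have e' : S.Xplus x = (S.J x (g.mkFib 0 0 1)).1 := by rw [e]; rfl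
  rw [e', h, hc]
  simp [PseudoRiemannianMetric.mkFib]

/-- By skewness the scalar part of `𝓕(p + i_p g)` is `-⟨p + i_p g, 𝓕 1⟩`, so it is dictated by `X₊`.
-/
theorem AlmostPseudoHermitian.J_plus (hg : S.G.IsStandard g) (p : Tan n x) :
    S.J x (g.mkFib p 0 0) = g.mkFib (S.Jplus g x p) 0 (-g.valₗ x p (S.Xplus x)) := by
  obtain ⟨p', c', h⟩ := S.exists_J_plus hg p 0
  have h1 := S.almostComplex.skew (g.mkFib p 0 0) (g.mkFib 0 0 1)
  rw [h, S.J_one hg, g.pairing_mkFib, g.pairing_mkFib] at h1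
  simp at h1
  have e : g.mkFib p 0 0 = g.toEplus x p := by
    simp [PseudoRiemannianMetric.mkFib, PseudoRiemannianMetric.toEplus]
  have e' : S.Jplus g x p = (S.J x (g.mkFib p 0 0)).1 := by rw [e]; rfl
  rw [e', h, ← h1]
  simp [PseudoRiemannianMetric.mkFib]

theorem AlmostPseudoHermitian.J_mkFib (hg : S.G.IsStandard g) (p q : Tan n x) (c : ℝ) :
    S.J x (g.mkFib p q c) = g.mkFib (S.Jplus g x p + c • S.Xplus x) (S.Jminus g x q)
      (-g.valₗ x p (S.Xplus x)) := by
  have e : g.mkFib p q c = g.mkFib p 0 0 + g.mkFib 0 q 0 + c • g.mkFib 0 0 1 := by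
    simp [g.mkFib_add, g.mkFib_smul]
  rw [e, map_add, map_add, map_smul, S.J_plus hg, S.J_minus hg, S.J_one hg, g.mkFib_smul,
    g.mkFib_add, g.mkFib_add]
  simp

theorem AlmostPseudoHermitian.Jminus_skew (hg : S.G.IsStandard g) (v w : Tan n x) :
    g.valₗ x (S.Jminus g x v) w = -g.valₗ x v (S.Jminus g x w) := by
  have h := S.almostComplex.skew (g.mkFib 0 v 0) (g.mkFib 0 w 0)
  rw [S.J_minus hg, S.J_minus hg, g.pairing_mkFib, g.pairing_mkFib] at h
  simp at h
  linarith

theorem AlmostPseudoHermitian.Jminus_cube (hg : S.G.IsStandard g) (v : Tan n x) :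
    S.Jminus g x (S.Jminus g x (S.Jminus g x v)) = -S.Jminus g x v := by
  have h := S.almostComplex.cube (g.mkFib 0 v 0)
  rw [S.J_minus hg, S.J_minus hg, S.J_minus hg, ← neg_one_smul ℝ, g.mkFib_smul] at h
  simpa using (g.mkFib_inj h).2.1

/-- In odd dimension the kernel of `𝓕` is contained in `E₋`. -/
theorem AlmostPseudoHermitian.exists_ker_minus (hn : Odd n) (hg : S.G.IsStandard g) :
    ∃ q : Tan n x, q ≠ 0 ∧ S.Jminus g x q = 0 ∧
      ∀ u : Fib n x, S.J x u = 0 → ∃ c : ℝ, u = g.mkFib 0 (c • q) 0 := by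
  have hf : Odd (Module.finrank ℝ (Tan n x)) := by
    rwa [show Module.finrank ℝ (Tan n x) = n from finrank_euclideanSpace_fin]
  -- `E₋` has odd rank, so `𝓕` already has a kernel there; as `Ker 𝓕` is at most a line, this is all
  -- of it.
  obtain ⟨q, hq, h⟩ := exists_ker_of_cube hf (S.Jminus g x) (S.Jminus_cube hg)
  refine ⟨q, hq, h, fun u hu => ?_⟩
  have h0 : S.J x (g.mkFib 0 q 0) = 0 := by
    rw [S.J_minus hg, h]; simp [PseudoRiemannianMetric.mkFib]
  have hq0 : g.mkFib 0 q 0 ≠ 0 := fun e => hq (by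
    simpa [PseudoRiemannianMetric.mkFib] using congrArg (fun u : Fib n x => u.1) e)
  obtain ⟨c, hc⟩ := S.almostComplex.exists_smul_eq h0 hq0 hu
  exact ⟨c, by rw [hc, g.mkFib_smul]; simp⟩

variable {u₀ : ∀ x : M, Fib n x}

theorem AlmostPseudoHermitian.IsNormalizedKernelSection.eq_mkFib (hn : Odd n)
    (hg : S.G.IsStandard g) (hu₀ : S.IsNormalizedKernelSection u₀) (x : M) :
    u₀ x = g.mkFib 0 (u₀ x).1 0 := by
  obtain ⟨q, -, -, h⟩ := S.exists_ker_minus (x := x) hn hg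
  obtain ⟨c, hc⟩ := h _ (hu₀.mem_ker x)
  rw [hc]
  simp [PseudoRiemannianMetric.mkFib]

/-- `J₋² + 1` takes values in the kernel of `J₋` by `J₋³ = -J₋`, and that kernel is spanned by `X₋`.
-/
theorem AlmostPseudoHermitian.isAlmostContact_minus (hn : Odd n)
    (hg : S.G.IsStandard g) (hu₀ : S.IsNormalizedKernelSection u₀) (x : M) :
    IsAlmostContact (g.valₗ x) (S.Jminus g x) (u₀ x).1 := by
  have he := hu₀.eq_mkFib hn hg x
  have hJ : S.Jminus g x (u₀ x).1 = 0 := by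
    have h := hu₀.mem_ker x
    rw [he, S.J_minus hg] at h
    simpa [PseudoRiemannianMetric.mkFib] using congrArg (fun u : Fib n x => u.1) h
  -- The scalar product restricts to `-g` on `E₋`, so `⟨u₀, u₀⟩ = (-1)ⁿ = -1` means that `X₋` has
  -- `g`-square `1`.
  have hN : g.valₗ x (u₀ x).1 (u₀ x).1 = 1 := by
    have h := hu₀.norm x
    rw [he, g.pairing_mkFib, hn.neg_one_pow] at h
    simpa using h
  refine ⟨S.Jminus_skew hg, hJ, hN, fun v => ?_⟩
  obtain ⟨q, hq, hJq, h⟩ := S.exists_ker_minus (x := x) hn hg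
  have hk : S.J x (g.mkFib 0 (S.Jminus g x (S.Jminus g x v) + v) 0) = 0 := by
    rw [S.J_minus hg, map_add, S.Jminus_cube hg]
    simp [PseudoRiemannianMetric.mkFib]
  have hu0 : u₀ x ≠ 0 := by
    intro e
    have e' : (u₀ x).1 = 0 := by rw [e]; rfl
    rw [e'] at hN
    simp at hN
  obtain ⟨c, hc⟩ := S.almostComplex.exists_smul_eq (hu₀.mem_ker x) hu0 hk
  rw [he, g.mkFib_smul] at hc
  have hc' := (g.mkFib_inj hc).2.1
  -- The coefficient is read off by pairing with `X₋`; the term `J₋² v` drops out since `J₋` is skew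
  -- and kills `X₋`.
  have hcv := congrArg (fun w => g.valₗ x w (u₀ x).1) hc'
  simp only [map_add, map_smul, LinearMap.add_apply, LinearMap.smul_apply, hN,
    S.Jminus_skew hg (S.Jminus g x v), hJ] at hcv
  simp at hcv
  rw [eq_neg_add_iff_add_eq, add_comm, hc', hcv]

/-- `𝓕² + 1` maps `E₊` into `E₊ ∩ Ker 𝓕`, which is zero because the kernel lies in `E₋`. So `𝓕² =
-1` on `E₊ ≅ TM ⊕ ℝ`, and the almost contact identities are the components of this equation. -/
theorem AlmostPseudoHermitian.isAlmostContact_plus (hn : Odd n)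
    (hg : S.G.IsStandard g) (x : M) :
    IsAlmostContact (g.valₗ x) (S.Jplus g x) (S.Xplus x) := by
  have hsq (p : Tan n x) (c : ℝ) :
      S.J x (S.J x (g.mkFib p 0 c)) = g.mkFib (-p) 0 (-c) := by
    have hk : S.J x (S.J x (S.J x (g.mkFib p 0 c)) + g.mkFib p 0 c) = 0 := by
      rw [map_add, S.almostComplex.cube, neg_add_cancel]
    obtain ⟨q, -, -, h⟩ := S.exists_ker_minus (x := x) hn hg
    obtain ⟨r, hr⟩ := h _ hk
    obtain ⟨p', c', h1⟩ := S.exists_J_plus hg p c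
    obtain ⟨p'', c'', h2⟩ := S.exists_J_plus hg p' c'
    rw [h1, h2, g.mkFib_add] at hr
    obtain ⟨e1, -, e2⟩ := g.mkFib_inj hr
    rw [h1, h2, eq_neg_of_add_eq_zero_left e1, eq_neg_of_add_eq_zero_left e2]
  -- Evaluating `𝓕² = -1` on the scalar `1` yields `J₊ X₊ = 0` and `g(X₊, X₊) = 1`.
  have h1 := hsq 0 1
  rw [S.J_one hg, S.J_plus hg] at h1
  obtain ⟨a1, -, a2⟩ := g.mkFib_inj h1
  refine ⟨fun v w => ?_, by simpa using a1, by linarith, fun v => ?_⟩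
  · have h := S.almostComplex.skew (g.mkFib v 0 0) (g.mkFib w 0 0)
    rw [S.J_plus hg, S.J_plus hg, g.pairing_mkFib, g.pairing_mkFib] at h
    simp at h
    linarith
  · have h := hsq v 0
    rw [S.J_plus hg, S.J_mkFib hg] at h
    have := (g.mkFib_inj h).1
    rw [neg_smul, ← sub_eq_add_neg, sub_eq_iff_eq_add] at this
    exact this

end

/-! ### Almost contact linear algebra on the complexified tangent space -/

namespace Cx

variable {V : Type*} [AddCommGroup V] [Module ℝ V] {J : Module.End ℝ V}

theorem mem_iEigen_iff_map {z : Cx V} : z ∈ iEigen J ↔ map J z = Complex.I • z :=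
  Module.End.mem_eigenspace_iff

theorem conj_mem_iEigen_neg {z : Cx V} (hz : z ∈ iEigen J) : conj z ∈ iEigen (-J) := by
  rw [mem_iEigen] at *
  simp [hz.1, hz.2]

theorem conj_mem_iEigen {z : Cx V} (hz : z ∈ iEigen (-J)) : conj z ∈ iEigen J := by
  rw [mem_iEigen] at *
  simpa [neg_eq_iff_eq_neg] using hz

end Cx

namespace IsAlmostContact

variable {V : Type*} [AddCommGroup V] [Module ℝ V] {B : V →ₗ[ℝ] V →ₗ[ℝ] ℝ}
  {J : Module.End ℝ V} {ξ : V} (h : IsAlmostContact B J ξ)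

include h

protected theorem neg : IsAlmostContact B (-J) ξ :=
  ⟨fun v w => by simp [h.skew], by simp [h.map_vec], h.norm, fun v => by simp [h.sq]⟩

theorem bil_map (z w : Cx V) : Cx.bil B (Cx.map J z) w = -Cx.bil B z (Cx.map J w) := by
  simp only [Cx.bil_apply, Cx.map_re, Cx.map_im, h.skew]
  apply Complex.ext <;> simp <;> ring

theorem bil_norm : Cx.bil B (Cx.ofReal ξ) (Cx.ofReal ξ) = 1 := by
  apply Complex.ext <;> simp [Cx.bil_apply, h.norm]

theorem map_ofReal : Cx.map J (Cx.ofReal ξ) = 0 := by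
  ext <;> simp [h.map_vec]

theorem map_map (z : Cx V) :
    Cx.map J (Cx.map J z) = -z + Cx.bil B z (Cx.ofReal ξ) • Cx.ofReal ξ := by
  ext <;> simp [h.sq, Cx.bil_apply]

theorem bil_vec_eq_zero {z : Cx V} (hz : z ∈ Cx.iEigen J) : Cx.bil B z (Cx.ofReal ξ) = 0 := by
  have := h.bil_map z (Cx.ofReal ξ)
  rw [h.map_ofReal, Cx.mem_iEigen_iff_map.1 hz] at this
  simpa using this

theorem bil_eq_zero {z w : Cx V} (hz : z ∈ Cx.iEigen J) (hw : w ∈ Cx.iEigen J) :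
    Cx.bil B z w = 0 := by
  have := h.bil_map z w
  rw [Cx.mem_iEigen_iff_map.1 hw, Cx.mem_iEigen_iff_map.1 hz, map_smul, map_smul,
    LinearMap.smul_apply, smul_eq_mul, eq_neg_iff_add_eq_zero, ← two_mul] at this
  simpa using this

/-- Twice the projection to the `i`-eigenspace. -/
theorem proj_mem (z : Cx V) :
    z - Complex.I • Cx.map J z - Cx.bil B z (Cx.ofReal ξ) • Cx.ofReal ξ ∈ Cx.iEigen J := by
  rw [Cx.mem_iEigen_iff_map, map_sub, map_sub, map_smul, map_smul, h.map_map, h.map_ofReal]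
  rw [smul_sub, smul_sub, smul_smul, Complex.I_mul_I]
  module

/-- A linear map which vanishes on both eigenspaces and on `ξ` is zero. -/
theorem eq_zero_of_forall {X : Type*} [AddCommGroup X] [Module ℂ X] {φ : Cx V →ₗ[ℂ] X}
    (h1 : ∀ z ∈ Cx.iEigen J, φ z = 0) (h2 : ∀ z ∈ Cx.iEigen (-J), φ z = 0)
    (h3 : φ (Cx.ofReal ξ) = 0) : φ = 0 := by
  ext z
  have a1 := h1 _ (h.proj_mem z)
  have a2 := h2 _ (h.neg.proj_mem z)
  have e : Cx.map (-J) z = -Cx.map J z := by ext <;> simp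
  rw [e] at a2
  simp only [map_add, map_sub, map_smul, h3, smul_zero, sub_zero, smul_neg, sub_neg_eq_add] at a1 a2
  -- The doubled projections to the two eigenspaces add up to `2z` minus a multiple of `ξ`.
  have a3 : (2 : ℂ) • φ z = 0 := by
    calc (2 : ℂ) • φ z = (φ z - Complex.I • φ (Cx.map J z)) + (φ z + Complex.I • φ (Cx.map J z)) := by
          module
      _ = 0 := by rw [a1, a2, add_zero]
  simpa using a3

/-- The orthogonal complement of `T^{1,0} ⊕ ℂξ` is `T^{1,0}`: this is how membership in an
eigenbundle gets verified by pairings. -/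
theorem mem_iEigen_of_forall (hs : ∀ v w, B v w = B w v) (hB : ∀ v, (∀ w, B v w = 0) → v = 0)
    {z : Cx V} (h1 : ∀ w ∈ Cx.iEigen J, Cx.bil B z w = 0)
    (h2 : Cx.bil B z (Cx.ofReal ξ) = 0) : z ∈ Cx.iEigen J := by
  -- `B(Jz - iz, w) = -i B(z, w - iJw)`, and `w - iJw` lies in `T^{1,0} ⊕ ℂξ` by `proj_mem`.
  have key : Cx.bil B (Cx.map J z - Complex.I • z) = 0 := by
    ext w
    have a1 := h1 _ (h.proj_mem w)
    simp only [map_sub, map_smul, h2] at a1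
    simp only [map_sub, map_smul, LinearMap.sub_apply, LinearMap.smul_apply, h.bil_map]
    simp only [smul_eq_mul, LinearMap.zero_apply, mul_zero, sub_zero] at *
    linear_combination (-Complex.I) * a1 - Cx.bil B z (Cx.map J w) * Complex.I_mul_I
  have hre : (Cx.map J z - Complex.I • z).re = 0 := hB _ fun w => by
    simpa [Cx.bil_apply] using congrArg Complex.re (LinearMap.congr_fun key (Cx.ofReal w))
  have him : (Cx.map J z - Complex.I • z).im = 0 := hB _ fun w => by
    simpa [Cx.bil_apply] using congrArg Complex.im (LinearMap.congr_fun key (Cx.ofReal w))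
  rw [Cx.mem_iEigen_iff_map, ← sub_eq_zero]
  exact Cx.ext hre him

end IsAlmostContact

/-! ### The eigenbundle `L` in components -/

section
variable {n : ℕ} {M : Type*} [TopologicalSpace M] [ChartedSpace (EuclideanSpace ℝ (Fin n)) M]
  [IsManifold (𝓡 n) ∞ M] {g : PseudoRiemannianMetric n M} {x : M}

theorem PseudoRiemannianMetric.pairingC_mkFibC (g : PseudoRiemannianMetric n M)
    (p q p' q' : Cx (Tan n x)) (c c' : ℂ) :
    pairingC n x (g.mkFibC p q c) (g.mkFibC p' q' c') =
      g.valC x p p' - g.valC x q q' + c * c' := by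
  simp only [pairingC, PseudoRiemannianMetric.mkFibC, PseudoRiemannianMetric.valC, Cx.bil_apply,
    pairingₗ_apply, g.pairing_mkFib]
  apply Complex.ext <;> simp <;> ring

theorem PseudoRiemannianMetric.mkFibC_surj (g : PseudoRiemannianMetric n M) (u : Cx (Fib n x)) :
    ∃ p q c, u = g.mkFibC p q c := by
  obtain ⟨p, q, c, h⟩ := g.mkFib_surj u.re
  obtain ⟨p', q', c', h'⟩ := g.mkFib_surj u.im
  exact ⟨⟨p, p'⟩, ⟨q, q'⟩, ⟨c, c'⟩, Cx.ext h h'⟩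

theorem PseudoRiemannianMetric.mkFibC_inj (g : PseudoRiemannianMetric n M)
    {p q p' q' : Cx (Tan n x)} {c c' : ℂ} (h : g.mkFibC p q c = g.mkFibC p' q' c') :
    p = p' ∧ q = q' ∧ c = c' := by
  obtain ⟨a1, a2, a3⟩ := g.mkFib_inj (congrArg Cx.re h)
  obtain ⟨b1, b2, b3⟩ := g.mkFib_inj (congrArg Cx.im h)
  exact ⟨Cx.ext a1 b1, Cx.ext a2 b2, Complex.ext a3 b3⟩

theorem PseudoRiemannianMetric.neg_mkFib (g : PseudoRiemannianMetric n M) (p q : Tan n x) (c : ℝ) :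
    -g.mkFib p q c = g.mkFib (-p) (-q) (-c) := by
  rw [← neg_one_smul ℝ, g.mkFib_smul]
  simp

theorem PseudoRiemannianMetric.smul_mkFibC (g : PseudoRiemannianMetric n M)
    (r : ℂ) (p q : Cx (Tan n x)) (c : ℂ) :
    r • g.mkFibC p q c = g.mkFibC (r • p) (r • q) (r * c) := by
  ext1
  · simp only [PseudoRiemannianMetric.mkFibC, Cx.smul_re, sub_eq_add_neg,
      g.mkFib_smul, g.neg_mkFib, g.mkFib_add]
    simp [sub_eq_add_neg]
  · simp only [PseudoRiemannianMetric.mkFibC, Cx.smul_im, g.mkFib_smul, g.mkFib_add]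
    simp

variable {S : AlmostPseudoHermitian n M}

theorem AlmostPseudoHermitian.map_J_mkFibC (hg : S.G.IsStandard g) (p q : Cx (Tan n x)) (c : ℂ) :
    Cx.map (S.J x) (g.mkFibC p q c) =
      g.mkFibC (Cx.map (S.Jplus g x) p + c • Cx.ofReal (S.Xplus x)) (Cx.map (S.Jminus g x) q)
        (-g.valC x p (Cx.ofReal (S.Xplus x))) := by
  ext1
  · simp only [PseudoRiemannianMetric.mkFibC, Cx.map_re, S.J_mkFib hg]
    simp [PseudoRiemannianMetric.valC, Cx.bil_apply]
  · simp only [PseudoRiemannianMetric.mkFibC, Cx.map_im, S.J_mkFib hg]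
    simp [PseudoRiemannianMetric.valC, Cx.bil_apply]

/-- The `i`-eigenspace of `𝓕` in terms of components. -/
theorem AlmostPseudoHermitian.mkFibC_mem_iEigen (hn : Odd n) (hg : S.G.IsStandard g)
    {p q : Cx (Tan n x)} {c : ℂ} :
    g.mkFibC p q c ∈ Cx.iEigen (S.J x) ↔
      p - g.valC x p (Cx.ofReal (S.Xplus x)) • Cx.ofReal (S.Xplus x) ∈ Cx.iEigen (S.Jplus g x) ∧
      q ∈ Cx.iEigen (S.Jminus g x) ∧ c = Complex.I * g.valC x p (Cx.ofReal (S.Xplus x)) := by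
  have hp := S.isAlmostContact_plus hn hg x
  rw [Cx.mem_iEigen_iff_map, Cx.mem_iEigen_iff_map, Cx.mem_iEigen_iff_map, S.map_J_mkFibC hg,
    g.smul_mkFibC, map_sub, map_smul, hp.map_ofReal]
  generalize g.valC x p (Cx.ofReal (S.Xplus x)) = f
  constructor
  · intro h
    obtain ⟨h1, h2, h3⟩ := g.mkFibC_inj h
    have hc : c = Complex.I * f := by
      linear_combination Complex.I * h3 + c * Complex.I_mul_I
    refine ⟨?_, h2, hc⟩
    rw [eq_sub_of_add_eq h1, hc]
    module
  · rintro ⟨h1, h2, rfl⟩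
    rw [smul_zero, sub_zero] at h1
    rw [h1, h2]
    congr 1
    · module
    · linear_combination (-f) * Complex.I_mul_I

theorem AlmostPseudoHermitian.mkFibC_mem_of_plus (hn : Odd n) (hg : S.G.IsStandard g)
    {p : Cx (Tan n x)} (hp : p ∈ Cx.iEigen (S.Jplus g x)) :
    g.mkFibC p 0 0 ∈ Cx.iEigen (S.J x) := by
  have h0 : g.valC x p (Cx.ofReal (S.Xplus x)) = 0 :=
    (S.isAlmostContact_plus hn hg x).bil_vec_eq_zero hp
  rw [S.mkFibC_mem_iEigen hn hg, h0]
  simpa using hp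

theorem AlmostPseudoHermitian.mkFibC_mem_of_minus (hn : Odd n) (hg : S.G.IsStandard g)
    {q : Cx (Tan n x)} (hq : q ∈ Cx.iEigen (S.Jminus g x)) :
    g.mkFibC 0 q 0 ∈ Cx.iEigen (S.J x) := by
  rw [S.mkFibC_mem_iEigen hn hg]
  simpa using hq

/-- `X₊ + i` is the generator that `L₊` has besides `T^{1,0}₊`. -/
theorem AlmostPseudoHermitian.mkFibC_Xplus_mem (hn : Odd n) (hg : S.G.IsStandard g) (x : M) :
    g.mkFibC (Cx.ofReal (S.Xplus x)) 0 Complex.I ∈ Cx.iEigen (S.J x) := by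
  have h1 : g.valC x (Cx.ofReal (S.Xplus x)) (Cx.ofReal (S.Xplus x)) = 1 :=
    (S.isAlmostContact_plus hn hg x).bil_norm
  rw [S.mkFibC_mem_iEigen hn hg, h1]
  simp

theorem PseudoRiemannianMetric.valC_ofReal_smul (g : PseudoRiemannianMetric n M)
    (p v w : Cx (Tan n x)) (c : ℂ) : g.valC x (p - c • v) w = g.valC x p w - c * g.valC x v w := by
  simp

/-- `(L ⊕ ℂ u₀)^⊥ = L`. -/
theorem AlmostPseudoHermitian.mem_iEigen_of_pairingC_eq_zero (hn : Odd n) (hg : S.G.IsStandard g)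
    {u₀ : ∀ x : M, Fib n x} (hu₀ : S.IsNormalizedKernelSection u₀) {z : Cx (Fib n x)}
    (h1 : ∀ w ∈ Cx.iEigen (S.J x), pairingC n x z w = 0)
    (h2 : pairingC n x z (g.mkFibC 0 (Cx.ofReal (u₀ x).1) 0) = 0) : z ∈ Cx.iEigen (S.J x) := by
  obtain ⟨p, q, c, rfl⟩ := g.mkFibC_surj z
  have hp := S.isAlmostContact_plus hn hg x
  have hm := S.isAlmostContact_minus hn hg hu₀ x
  -- Pairing with `X₊ + i` fixes the scalar `c`; pairing with `T^{1,0}₊`, with `T^{1,0}₋` and with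
  -- `X₋` fixes the types of the other two components.
  have hc := h1 _ (S.mkFibC_Xplus_mem hn hg x)
  rw [g.pairingC_mkFibC] at hc h2
  simp at hc h2
  rw [S.mkFibC_mem_iEigen hn hg]
  refine ⟨hp.mem_iEigen_of_forall (g.symm x) (g.nondegenerate x) (fun w hw => ?_) ?_,
    hm.mem_iEigen_of_forall (g.symm x) (g.nondegenerate x) (fun w hw => ?_) h2, ?_⟩
  · have a1 := h1 _ (S.mkFibC_mem_of_plus hn hg hw)
    rw [g.pairingC_mkFibC] at a1
    have a2 : g.valC x (Cx.ofReal (S.Xplus x)) w = 0 := by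
      rw [g.valC_symm]
      exact hp.bil_vec_eq_zero hw
    change g.valC x _ w = 0
    rw [g.valC_ofReal_smul, a2]
    simpa using a1
  · have a2 : g.valC x (Cx.ofReal (S.Xplus x)) (Cx.ofReal (S.Xplus x)) = 1 := hp.bil_norm
    change g.valC x _ _ = 0
    rw [g.valC_ofReal_smul, a2]
    simp
  · have a1 := h1 _ (S.mkFibC_mem_of_minus hn hg hw)
    rw [g.pairingC_mkFibC] at a1
    change g.valC x _ _ = 0
    simpa using a1
  · linear_combination (-Complex.I) * hc + c * Complex.I_mul_I

end

section
variable {n : ℕ} {M : Type*} [TopologicalSpace M] [ChartedSpace (EuclideanSpace ℝ (Fin n)) M]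
  [IsManifold (𝓡 n) ∞ M] {g : PseudoRiemannianMetric n M} {x : M}

/-! ### Calculus with complex vector fields -/

theorem SmoothFieldC.add {P Q : ∀ x : M, Cx (Tan n x)} (hP : SmoothFieldC P)
    (hQ : SmoothFieldC Q) : SmoothFieldC (fun y => P y + Q y) :=
  ⟨hP.1.add hQ.1, hP.2.add hQ.2⟩

theorem SmoothFieldC.smul {f : M → ℂ} {P : ∀ x : M, Cx (Tan n x)} (hf : SmoothFunC n f)
    (hP : SmoothFieldC P) : SmoothFieldC (fun y => f y • P y) :=
  ⟨(hP.1.smul hf.1).sub (hP.2.smul hf.2), (hP.2.smul hf.1).add (hP.1.smul hf.2)⟩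

theorem SmoothFieldC.conj {P : ∀ x : M, Cx (Tan n x)} (hP : SmoothFieldC P) :
    SmoothFieldC (fun y => Cx.conj (P y)) :=
  ⟨hP.1, hP.2.neg⟩

theorem SmoothField.ofReal {X : ∀ x : M, Tan n x} (hX : SmoothField X) :
    SmoothFieldC (fun y => Cx.ofReal (X y)) :=
  ⟨hX, smoothField_zero⟩

theorem smoothFieldC_zero : SmoothFieldC (fun x : M => (0 : Cx (Tan n x))) :=
  ⟨smoothField_zero, smoothField_zero⟩

theorem smoothFunC_const (c : ℂ) : SmoothFunC n (fun _ : M => c) :=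
  ⟨smoothFun_const _, smoothFun_const _⟩

theorem SmoothFunC.const_mul (c : ℂ) {f : M → ℂ} (hf : SmoothFunC n f) :
    SmoothFunC n (fun y => c * f y) := by
  constructor
  · simp only [Complex.mul_re]
    exact ContMDiff.sub (ContMDiff.mul contMDiff_const hf.1) (ContMDiff.mul contMDiff_const hf.2)
  · simp only [Complex.mul_im]
    exact ContMDiff.add (ContMDiff.mul contMDiff_const hf.2) (ContMDiff.mul contMDiff_const hf.1)

theorem dFun_const (c : ℝ) (x : M) : (dFun (fun _ : M => c) x : Cotan n x) = 0 := by
  simp [dFun, mvfderiv]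

theorem dC_const (c : ℂ) (x : M) : dC (n := n) (fun _ : M => c) x = 0 := by
  ext z
  simp [dC, dFun_const, Cx.form_apply]
  rfl

theorem dFun_const_mul {f : M → ℝ} (hf : SmoothFun n f) (c : ℝ) :
    (dFun (fun y => c * f y) x : Cotan n x) = c • dFun f x := by
  rw [dFun_mul mdifferentiableAt_const (hf.mdifferentiableAt x), dFun_const, smul_zero, add_zero]

theorem dFun_neg {f : M → ℝ} (hf : SmoothFun n f) :
    (dFun (fun y => -f y) x : Cotan n x) = -dFun f x := by
  have h := dFun_const_mul (x := x) hf (-1)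
  refine ContinuousLinearMap.ext fun v => ?_
  have hv := congrArg (fun φ : Cotan n x => φ v) h
  simpa using hv

theorem dFun_sub {f h : M → ℝ} (hf : SmoothFun n f) (hh : SmoothFun n h) :
    (dFun (fun y => f y - h y) x : Cotan n x) = dFun f x - dFun h x := by
  have hm : SmoothFun n (fun y => -h y) := ContMDiff.neg hh
  have := dFun_add (hf.mdifferentiableAt x) (hm.mdifferentiableAt x)
  rw [dFun_neg hh] at this
  simpa [sub_eq_add_neg] using this

theorem dC_const_mul (c : ℂ) {f : M → ℂ} (hf : SmoothFunC n f) (z : Cx (Tan n x)) :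
    dC (fun y => c * f y) x z = c * dC f x z := by
  have h1 (r : ℝ) : SmoothFun n (fun y => r * (f y).re) := ContMDiff.mul contMDiff_const hf.1
  have h2 (r : ℝ) : SmoothFun n (fun y => r * (f y).im) := ContMDiff.mul contMDiff_const hf.2
  simp only [dC, Complex.mul_re, Complex.mul_im]
  rw [dFun_sub (h1 _) (h2 _), dFun_add ((h2 _).mdifferentiableAt x) ((h1 _).mdifferentiableAt x),
    dFun_const_mul hf.1, dFun_const_mul hf.1, dFun_const_mul hf.2, dFun_const_mul hf.2]
  simp only [Cx.form_apply]
  apply Complex.ext <;> simp <;> ring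

theorem PseudoRiemannianMetric.nablaC_apply (g : PseudoRiemannianMetric n M)
    (Z : ∀ x : M, Cx (Tan n x)) (z : Cx (Tan n x)) :
    g.nablaC Z x z =
      ⟨g.leviCivita (fun y => (Z y).re) x z.re - g.leviCivita (fun y => (Z y).im) x z.im,
        g.leviCivita (fun y => (Z y).re) x z.im + g.leviCivita (fun y => (Z y).im) x z.re⟩ := rfl

theorem PseudoRiemannianMetric.leviCivita_neg (g : PseudoRiemannianMetric n M)
    {X : ∀ x : M, Tan n x} (hX : SmoothField X) (v : Tan n x) :
    g.leviCivita (fun y => -X y) x v = -g.leviCivita X x v := by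
  have := g.leviCivita_const_smul (-1) (hX.diffFieldAt x) v
  simpa using this

theorem PseudoRiemannianMetric.leviCivita_sub (g : PseudoRiemannianMetric n M)
    {X Y : ∀ x : M, Tan n x} (hX : SmoothField X) (hY : SmoothField Y) (v : Tan n x) :
    g.leviCivita (fun y => X y - Y y) x v = g.leviCivita X x v - g.leviCivita Y x v := by
  have := g.leviCivita_add (hX.diffFieldAt x) (hY.neg.diffFieldAt x) v
  rw [g.leviCivita_neg hY] at this
  simpa [sub_eq_add_neg] using this

theorem PseudoRiemannianMetric.leviCivita_zero (g : PseudoRiemannianMetric n M) (v : Tan n x) :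
    g.leviCivita (fun y => 0) x v = 0 := by
  have := g.leviCivita_const_smul 0 (smoothField_zero.diffFieldAt x) v
  simpa using this

theorem PseudoRiemannianMetric.nablaC_add (g : PseudoRiemannianMetric n M)
    {P Q : ∀ x : M, Cx (Tan n x)} (hP : SmoothFieldC P) (hQ : SmoothFieldC Q)
    (z : Cx (Tan n x)) :
    g.nablaC (fun y => P y + Q y) x z = g.nablaC P x z + g.nablaC Q x z := by
  simp only [g.nablaC_apply, Cx.add_re, Cx.add_im,
    g.leviCivita_add (hP.1.diffFieldAt x) (hQ.1.diffFieldAt x),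
    g.leviCivita_add (hP.2.diffFieldAt x) (hQ.2.diffFieldAt x)]
  ext1
  · simp only [Cx.add_re]; abel
  · simp only [Cx.add_im]; abel

theorem PseudoRiemannianMetric.nablaC_smul (g : PseudoRiemannianMetric n M)
    {f : M → ℂ} {P : ∀ x : M, Cx (Tan n x)} (hf : SmoothFunC n f) (hP : SmoothFieldC P)
    (z : Cx (Tan n x)) :
    g.nablaC (fun y => f y • P y) x z = f x • g.nablaC P x z + dC f x z • P x := by
  have h1 (v : Tan n x) := g.leviCivita_smul (hf.1.mdifferentiableAt x) (hP.1.diffFieldAt x) v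
  have h2 (v : Tan n x) := g.leviCivita_smul (hf.1.mdifferentiableAt x) (hP.2.diffFieldAt x) v
  have h3 (v : Tan n x) := g.leviCivita_smul (hf.2.mdifferentiableAt x) (hP.1.diffFieldAt x) v
  have h4 (v : Tan n x) := g.leviCivita_smul (hf.2.mdifferentiableAt x) (hP.2.diffFieldAt x) v
  simp only [g.nablaC_apply, Cx.smul_re, Cx.smul_im, dC, Cx.form_apply,
    g.leviCivita_sub (hP.1.smul hf.1) (hP.2.smul hf.2),
    g.leviCivita_add ((hP.2.smul hf.1).diffFieldAt x) ((hP.1.smul hf.2).diffFieldAt x),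
    h1, h2, h3, h4]
  ext1
  · simp only [Cx.add_re, Cx.smul_re, ContinuousLinearMap.coe_coe]; module
  · simp only [Cx.add_im, Cx.smul_im, ContinuousLinearMap.coe_coe]; module

theorem PseudoRiemannianMetric.nablaC_zero (g : PseudoRiemannianMetric n M)
    (z : Cx (Tan n x)) : g.nablaC (fun y => 0) x z = 0 := by
  simp only [g.nablaC_apply, Cx.zero_re, Cx.zero_im, g.leviCivita_zero]
  ext <;> simp

theorem PseudoRiemannianMetric.nablaC_conj (g : PseudoRiemannianMetric n M)
    {P : ∀ x : M, Cx (Tan n x)} (hP : SmoothFieldC P) (z : Cx (Tan n x)) :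
    g.nablaC (fun y => Cx.conj (P y)) x (Cx.conj z) = Cx.conj (g.nablaC P x z) := by
  simp only [g.nablaC_apply, Cx.conj_re, Cx.conj_im, g.leviCivita_neg hP.2]
  ext1
  · simp
  · simp; abel

theorem PseudoRiemannianMetric.nablaC_ofReal (g : PseudoRiemannianMetric n M)
    (X : ∀ x : M, Tan n x) (v : Tan n x) :
    g.nablaC (fun y => Cx.ofReal (X y)) x (Cx.ofReal v) = Cx.ofReal (g.leviCivita X x v) := by
  simp only [g.nablaC_apply, Cx.ofReal_re, Cx.ofReal_im, g.leviCivita_zero]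
  ext <;> simp

theorem PseudoRiemannianMetric.dC_valC (g : PseudoRiemannianMetric n M)
    {P Q : ∀ x : M, Cx (Tan n x)} (hP : SmoothFieldC P) (hQ : SmoothFieldC Q)
    (v : Tan n x) :
    dC (fun y => g.valC y (P y) (Q y)) x (Cx.ofReal v) =
      g.valC x (g.nablaC P x (Cx.ofReal v)) (Q x) + g.valC x (P x) (g.nablaC Q x (Cx.ofReal v)) := by
  have a1 := hP.1.diffFieldAt x
  have a2 := hP.2.diffFieldAt x
  have b1 := hQ.1.diffFieldAt x
  have b2 := hQ.2.diffFieldAt x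
  have e1 := dFun_add (g.smooth.apply a1 b2) (g.smooth.apply a2 b1)
  have hm : MDifferentiableAt (𝓡 n) 𝓘(ℝ, ℝ) (fun y => (-1) * g.val y (P y).im (Q y).im) x :=
    mdifferentiableAt_const.mul (g.smooth.apply a2 b2)
  have e2 := dFun_add (g.smooth.apply a1 b1) hm
  rw [dFun_mul mdifferentiableAt_const (g.smooth.apply a2 b2), dFun_const] at e2
  simp only [neg_one_mul, ← sub_eq_add_neg] at e2
  simp only [PseudoRiemannianMetric.valC, Cx.bil_apply, g.valₗ_apply, dC, Cx.form_apply, e1, e2]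
  simp only [ContinuousLinearMap.coe_coe, _root_.add_apply, _root_.smul_apply, g.dFun_val a1 b1,
    g.dFun_val a2 b2, g.dFun_val a1 b2, g.dFun_val a2 b1, g.nablaC_apply, Cx.ofReal_re,
    Cx.ofReal_im]
  simp only [← g.valₗ_apply, map_zero]
  apply Complex.ext <;> simp <;> ring

/-- Two complex vector fields with constant scalar product. -/
theorem PseudoRiemannianMetric.nablaC_skew (g : PseudoRiemannianMetric n M)
    {P Q : ∀ x : M, Cx (Tan n x)} (hP : SmoothFieldC P) (hQ : SmoothFieldC Q) {c : ℂ}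
    (hc : ∀ y, g.valC y (P y) (Q y) = c) (z : Cx (Tan n x)) :
    g.valC x (g.nablaC P x z) (Q x) = -g.valC x (P x) (g.nablaC Q x z) := by
  -- Both sides are complex-linear in the direction of differentiation, so real directions suffice.
  have key (v : Tan n x) : g.valC x (g.nablaC P x (Cx.ofReal v)) (Q x)
      + g.valC x (P x) (g.nablaC Q x (Cx.ofReal v)) = 0 := by
    rw [← g.dC_valC hP hQ]
    simp only [hc, dC_const]
    rfl
  rw [eq_neg_iff_add_eq_zero, Cx.eq_re_add_im z]
  simp only [map_add, map_smul, LinearMap.add_apply, LinearMap.smul_apply, smul_eq_mul]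
  linear_combination key z.re + Complex.I * key z.im

/-! ### Sections of `E` and their components -/

variable {S : AlmostPseudoHermitian n M}

/-- The components are the anchor images of `½(1 ± 𝒢ᵉⁿᵈ) u`, so they inherit smoothness from `𝒢ᵉⁿᵈ`.
-/
theorem GeneralizedMetric.IsStandard.exists_smooth_components {G : GeneralizedMetric n M}
    (hg : G.IsStandard g) {u : ∀ x : M, Fib n x} (hu : SmoothSection u) :
    ∃ (P Q : ∀ x : M, Tan n x) (a : M → ℝ), SmoothField P ∧ SmoothField Q ∧ SmoothFun n a ∧
      ∀ x, u x = g.mkFib (P x) (Q x) (a x) := by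
  choose P Q a h using fun x => g.mkFib_surj (u x)
  have hG := G.smooth u hu
  have e1 : P = fun x => ((1 / 2 : ℝ) • (u x + G.Gend x (u x))).1 := by
    funext x
    rw [h, hg.Gend_mkFib, g.mkFib_add, g.mkFib_smul]
    simp only [PseudoRiemannianMetric.mkFib]
    module
  have e2 : Q = fun x => ((1 / 2 : ℝ) • (u x - G.Gend x (u x))).1 := by
    funext x
    rw [h, hg.Gend_mkFib]
    simp only [PseudoRiemannianMetric.mkFib, Prod.mk_sub_mk, Prod.smul_mk]
    module
  have e3 : a = fun x => (u x).2.2 := by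
    funext x
    rw [h]
    rfl
  refine ⟨P, Q, a, ?_, ?_, ?_, h⟩
  · rw [e1]; exact ((hu.add hG).const_smul _).1
  · rw [e2]; exact ((hu.sub hG).const_smul _).1
  · rw [e3]; exact hu.2.2

/-- `𝒢ᵉⁿᵈ` sends a tangent vector `X` to `i_X g`, so the smoothness of this one-form is contained in
that of `𝒢ᵉⁿᵈ`. -/
theorem GeneralizedMetric.IsStandard.smoothOneForm_val {G : GeneralizedMetric n M}
    (hg : G.IsStandard g) {P : ∀ x : M, Tan n x} (hP : SmoothField P) :
    SmoothOneForm (fun x => g.val x (P x)) := by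
  have h := (G.smooth _ hP.section).2.1
  have e : (fun x => (G.Gend x (P x, 0, 0)).2.1) = fun x => g.val x (P x) := by
    funext x
    have e' : ((P x, 0, 0) : Fib n x) = g.mkFib ((1 / 2 : ℝ) • P x) ((1 / 2 : ℝ) • P x) 0 := by
      simp only [PseudoRiemannianMetric.mkFib, sub_self, ← add_smul]
      norm_num
    rw [e', hg.Gend_mkFib]
    simp only [PseudoRiemannianMetric.mkFib, ← map_sub]
    congr 1
    module
  rwa [e] at h

theorem GeneralizedMetric.IsStandard.smoothSection_mkFib {G : GeneralizedMetric n M}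
    (hg : G.IsStandard g) {P Q : ∀ x : M, Tan n x} {a : M → ℝ} (hP : SmoothField P)
    (hQ : SmoothField Q) (ha : SmoothFun n a) :
    SmoothSection (fun x => g.mkFib (P x) (Q x) (a x)) :=
  ⟨hP.add hQ, (hg.smoothOneForm_val hP).sub (hg.smoothOneForm_val hQ), ha⟩

theorem GeneralizedMetric.IsStandard.exists_smooth_componentsC {G : GeneralizedMetric n M}
    (hg : G.IsStandard g) {u : ∀ x : M, Cx (Fib n x)} (hu : SmoothSectionC u) :
    ∃ (P Q : ∀ x : M, Cx (Tan n x)) (a : M → ℂ), SmoothFieldC P ∧ SmoothFieldC Q ∧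
      SmoothFunC n a ∧ ∀ x, u x = g.mkFibC (P x) (Q x) (a x) := by
  obtain ⟨P, Q, a, hP, hQ, ha, h⟩ := hg.exists_smooth_components hu.1
  obtain ⟨P', Q', a', hP', hQ', ha', h'⟩ := hg.exists_smooth_components hu.2
  exact ⟨fun x => ⟨P x, P' x⟩, fun x => ⟨Q x, Q' x⟩, fun x => ⟨a x, a' x⟩, ⟨hP, hP'⟩, ⟨hQ, hQ'⟩,
    ⟨ha, ha'⟩, fun x => Cx.ext (h x) (h' x)⟩

theorem GeneralizedMetric.IsStandard.smoothSectionC_mkFibC {G : GeneralizedMetric n M}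
    (hg : G.IsStandard g) {P Q : ∀ x : M, Cx (Tan n x)} {a : M → ℂ} (hP : SmoothFieldC P)
    (hQ : SmoothFieldC Q) (ha : SmoothFunC n a) :
    SmoothSectionC (fun x => g.mkFibC (P x) (Q x) (a x)) :=
  ⟨hg.smoothSection_mkFib hP.1 hQ.1 ha.1, hg.smoothSection_mkFib hP.2 hQ.2 ha.2⟩

theorem exists_smoothSection_eq [T2Space M] (G : GeneralizedMetric n M) (hg : G.IsStandard g)
    (u : Fib n x) : ∃ v : ∀ x : M, Fib n x, SmoothSection v ∧ v x = u := by
  obtain ⟨p, q, c, rfl⟩ := g.mkFib_surj u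
  obtain ⟨P, hP, rfl⟩ := exists_smoothField_eq p
  obtain ⟨Q, hQ, rfl⟩ := exists_smoothField_eq q
  exact ⟨_, hg.smoothSection_mkFib hP hQ (smoothFun_const c), rfl⟩

/-- Every element of `L` is the value of a global smooth section of `L`. -/
theorem AlmostPseudoHermitian.exists_section_eq [T2Space M] (hg : S.G.IsStandard g)
    {z : Cx (Fib n x)} (hz : z ∈ Cx.iEigen (S.J x)) :
    ∃ u : ∀ x : M, Cx (Fib n x), SmoothSectionC u ∧ (∀ y, u y ∈ Cx.iEigen (S.J y)) ∧ u x = z := by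
  obtain ⟨v, hv, hvx⟩ := exists_smoothSection_eq S.G hg z.re
  obtain ⟨w, hw, hwx⟩ := exists_smoothSection_eq S.G hg z.im
  have sJ := S.almostComplex.smooth
  -- An arbitrary extension is corrected by `-½(𝓕² + i𝓕)`. By `𝓕³ = -𝓕` this is the projection to
  -- `L`: it is `1` on the eigenvalue `i` and `0` on `-i` and `0`.
  refine ⟨fun y => ⟨-(1 / 2 : ℝ) • (S.J y (S.J y (v y)) - S.J y (w y)),
    -(1 / 2 : ℝ) • (S.J y (S.J y (w y)) + S.J y (v y))⟩, ⟨?_, ?_⟩, fun y => ?_, ?_⟩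
  · exact ((sJ _ (sJ _ hv)).sub (sJ _ hw)).const_smul _
  · exact ((sJ _ (sJ _ hw)).add (sJ _ hv)).const_smul _
  · rw [Cx.mem_iEigen]
    simp only [map_smul, map_sub, map_add, S.almostComplex.cube]
    constructor <;> module
  · rw [Cx.mem_iEigen] at hz
    have e1 : S.J x (S.J x z.re) = -z.re := by rw [hz.1, map_neg, hz.2]
    have e2 : S.J x (S.J x z.im) = -z.im := by rw [hz.2, hz.1]
    ext1
    · simp only [hvx, hwx, e1, hz.2]; module
    · simp only [hvx, hwx, e2, hz.1]; module

/-- Since `L = L₊ ⊕ L₋`, dropping the `E₋`-component of a section of `L` leaves a section of `L₊`.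
-/
theorem AlmostPseudoHermitian.exists_section_plus [T2Space M] (hn : Odd n) (hg : S.G.IsStandard g)
    {p : Cx (Tan n x)} {c : ℂ} (hz : g.mkFibC p 0 c ∈ Cx.iEigen (S.J x)) :
    ∃ (P : ∀ x : M, Cx (Tan n x)) (a : M → ℂ), SmoothFieldC P ∧ SmoothFunC n a ∧
      (∀ y, g.mkFibC (P y) 0 (a y) ∈ Cx.iEigen (S.J y)) ∧ P x = p ∧ a x = c := by
  obtain ⟨u, hu, hL, hx⟩ := S.exists_section_eq hg hz
  obtain ⟨P, Q, a, hP, hQ, ha, h⟩ := hg.exists_smooth_componentsC hu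
  obtain ⟨h1, -, h2⟩ := g.mkFibC_inj ((h x).symm.trans hx)
  refine ⟨P, a, hP, ha, fun y => ?_, h1, h2⟩
  have := hL y
  rw [h, S.mkFibC_mem_iEigen hn hg] at this
  rw [S.mkFibC_mem_iEigen hn hg]
  exact ⟨this.1, zero_mem _, this.2.2⟩

theorem AlmostPseudoHermitian.exists_section_minus [T2Space M] (hn : Odd n)
    (hg : S.G.IsStandard g) {q : Cx (Tan n x)} (hq : q ∈ Cx.iEigen (S.Jminus g x)) :
    ∃ Q : ∀ x : M, Cx (Tan n x), SmoothFieldC Q ∧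
      (∀ y, Q y ∈ Cx.iEigen (S.Jminus g y)) ∧ Q x = q := by
  obtain ⟨u, hu, hL, hx⟩ := S.exists_section_eq hg (S.mkFibC_mem_of_minus hn hg hq)
  obtain ⟨P, Q, a, hP, hQ, ha, h⟩ := hg.exists_smooth_componentsC hu
  refine ⟨Q, hQ, fun y => ?_, (g.mkFibC_inj ((h x).symm.trans hx)).2.1⟩
  have := hL y
  rw [h, S.mkFibC_mem_iEigen hn hg] at this
  exact this.2.1

theorem AlmostPseudoHermitian.smoothField_Xplus (S : AlmostPseudoHermitian n M) :
    SmoothField S.Xplus :=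
  (S.almostComplex.smooth (fun _ => (0, 0, 1))
    ⟨smoothField_zero, smoothOneForm_zero, smoothFun_const 1⟩).1

end

namespace Cx

variable {V W : Type*} [AddCommGroup V] [Module ℝ V]

theorem linearMap_eq_zero {X : Type*} [AddCommGroup X] [Module ℂ X] {φ : Cx V →ₗ[ℂ] X}
    (h : ∀ v, φ (ofReal v) = 0) : φ = 0 := by
  ext z
  rw [eq_re_add_im z, map_add, map_smul, h, h]
  simp

theorem bil_ofReal_conj (B : V →ₗ[ℝ] V →ₗ[ℝ] ℝ) (v : V) (z : Cx V) :
    bil B (ofReal v) (conj z) = (starRingEnd ℂ) (bil B (ofReal v) z) := by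
  simp only [bil_apply]
  apply Complex.ext <;> simp

end Cx

/-! ### Connections of the form `∇ + K + α ⊗ ξ` -/

section
variable {n : ℕ} {M : Type*} [TopologicalSpace M] [ChartedSpace (EuclideanSpace ℝ (Fin n)) M]
  [IsManifold (𝓡 n) ∞ M] {g : PseudoRiemannianMetric n M} {x : M}

/-- The connection `D` is `∇ + K + α ⊗ ξ`, with a two-form valued one-form `K` and a one-form valued
one-form `α`. -/
structure IsModifiedConnection (g : PseudoRiemannianMetric n M)
    (D : (∀ x : M, Tan n x) → ∀ x : M, Tan n x → Tan n x) (ξ : ∀ x : M, Tan n x)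
    (K : ∀ x : M, Tan n x →ₗ[ℝ] Tan n x →ₗ[ℝ] Tan n x →ₗ[ℝ] ℝ)
    (α : ∀ x : M, Tan n x →ₗ[ℝ] Tan n x →ₗ[ℝ] ℝ) : Prop where
  eq : ∀ Y x v w, g.valₗ x (D Y x v) w =
    g.valₗ x (g.leviCivita Y x v) w + K x v (Y x) w + α x v (Y x) * g.valₗ x (ξ x) w
  alt : ∀ x u v, K x u v v = 0
  vec : ∀ x v, α x v (ξ x) = 0

variable {D : (∀ x : M, Tan n x) → ∀ x : M, Tan n x → Tan n x} {J : ∀ x : M, Module.End ℝ (Tan n x)}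
  {ξ : ∀ x : M, Tan n x} {K : ∀ x : M, Tan n x →ₗ[ℝ] Tan n x →ₗ[ℝ] Tan n x →ₗ[ℝ] ℝ}
  {α : ∀ x : M, Tan n x →ₗ[ℝ] Tan n x →ₗ[ℝ] ℝ}

theorem IsModifiedConnection.eqC (hD : IsModifiedConnection g D ξ K α)
    (Z : ∀ x : M, Cx (Tan n x)) (x : M) (v : Tan n x) (w : Cx (Tan n x)) :
    g.valC x ⟨D (fun y => (Z y).re) x v, D (fun y => (Z y).im) x v⟩ w =
      g.valC x (g.nablaC Z x (Cx.ofReal v)) w + Cx.bil (K x v) (Z x) w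
        + Cx.bil (α x) (Cx.ofReal v) (Z x) * g.valC x (Cx.ofReal (ξ x)) w := by
  simp only [PseudoRiemannianMetric.valC, Cx.bil_apply, hD.eq, g.nablaC_apply, Cx.ofReal_re,
    Cx.ofReal_im, map_zero]
  apply Complex.ext <;> simp <;> ring

theorem IsModifiedConnection.swap (hD : IsModifiedConnection g D ξ K α) (x : M)
    (u v w : Tan n x) : K x u v w = -K x u w v :=
  (LinearMap.IsAlt.neg (B := K x u) (hD.alt x u) w v).symm

/-- `T^{1,0}` is isotropic and orthogonal to `ξ`, so pairing with `p` of type (1,0) removes `α ⊗ ξ`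
and yields the right-hand side. Conversely, these pairings determine everything: the missing ones
with `ξ` follow from metricity of `∇`, and those with type (0,1) from reality. -/
theorem preserves_iff (hJ : ∀ x, IsAlmostContact (g.valₗ x) (J x) (ξ x)) (hξ : SmoothField ξ)
    (hD : IsModifiedConnection g D ξ K α) :
    (Preserves D J ∧ ∀ x v w, g.valₗ x (D ξ x v) w = α x v w) ↔
      (∀ P : ∀ x : M, Cx (Tan n x), SmoothFieldC P → (∀ x, P x ∈ Cx.iEigen (J x)) →
        ∀ x v, ∀ p ∈ Cx.iEigen (J x),
          g.valC x (g.nablaC P x (Cx.ofReal v)) p + Cx.bil (K x v) (P x) p = 0) ∧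
      ∀ x v, ∀ p ∈ Cx.iEigen (J x),
        g.valC x (Cx.ofReal (g.leviCivita ξ x v)) p + Cx.bil (K x v) (Cx.ofReal (ξ x)) p =
          Cx.bil (α x) (Cx.ofReal v) p := by
  have hα (x : M) (v : Tan n x) : Cx.bil (α x) (Cx.ofReal v) (Cx.ofReal (ξ x)) = 0 := by
    apply Complex.ext <;> simp [Cx.bil_apply, hD.vec]
  have hDξ (x : M) (v : Tan n x) (w : Cx (Tan n x)) : g.valC x (Cx.ofReal (D ξ x v)) w =
      g.valC x (Cx.ofReal (g.leviCivita ξ x v)) w + Cx.bil (K x v) (Cx.ofReal (ξ x)) w := by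
    simp only [PseudoRiemannianMetric.valC, Cx.bil_apply, Cx.ofReal_re, Cx.ofReal_im, hD.eq,
      hD.vec]
    apply Complex.ext <;> simp
  have hξp {x : M} {p : Cx (Tan n x)} (hp : p ∈ Cx.iEigen (J x)) :
      g.valC x (Cx.ofReal (ξ x)) p = 0 := by
    rw [g.valC_symm]
    exact (hJ x).bil_vec_eq_zero hp
  have hKs {x : M} {v : Tan n x} (z w : Cx (Tan n x)) :
      Cx.bil (K x v) z w = -Cx.bil (K x v) w z := Cx.bil_swap (hD.swap x v) z w
  constructor
  · rintro ⟨hP, hα'⟩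
    refine ⟨fun P sP mP x v p hp => ?_, fun x v p hp => ?_⟩
    · have h := hD.eqC P x v p
      rw [hξp hp, mul_zero, add_zero] at h
      rw [← h]
      exact (hJ x).bil_eq_zero (hP P sP.1 sP.2 mP x v) hp
    · rw [← hDξ]
      simp only [PseudoRiemannianMetric.valC, Cx.bil_apply, Cx.ofReal_re, hα', Cx.ofReal_im,
        map_zero]
  · rintro ⟨h1, h2⟩
    constructor
    · intro P sP1 sP2 mP x v
      refine (hJ x).mem_iEigen_of_forall (g.symm x) (g.nondegenerate x) (fun p hp => ?_) ?_
      · change g.valC x _ _ = 0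
        rw [hD.eqC P x v p, h1 P ⟨sP1, sP2⟩ mP x v p hp, hξp hp]
        simp
      · change g.valC x _ _ = 0
        -- From `g(P, ξ) = 0` one gets `g(∇P, ξ) = -g(P, ∇ξ)`, so the `ξ`-component of `DP` vanishes
        -- by the equation for `∇ξ`.
        have a1 := g.nablaC_skew ⟨sP1, sP2⟩ hξ.ofReal (c := 0)
          (fun y => (hJ y).bil_vec_eq_zero (mP y)) (Cx.ofReal v)
        rw [g.nablaC_ofReal, g.valC_symm (P x)] at a1
        have a2 : g.valC x (Cx.ofReal (ξ x)) (Cx.ofReal (ξ x)) = 1 := (hJ x).bil_norm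
        rw [hD.eqC P x v, a1, a2, hKs, ← h2 x v _ (mP x)]
        ring
    · intro x v w
      have a1 := g.nablaC_skew hξ.ofReal hξ.ofReal (c := 1) (fun y => (hJ y).bil_norm)
        (Cx.ofReal v)
      rw [g.valC_symm (Cx.ofReal (ξ x)), eq_neg_iff_add_eq_zero, ← two_mul, g.nablaC_ofReal] at a1
      have a1' : g.valC x (Cx.ofReal (g.leviCivita ξ x v)) (Cx.ofReal (ξ x)) = 0 := by
        simpa using a1
      have hK0 : Cx.bil (K x v) (Cx.ofReal (ξ x)) (Cx.ofReal (ξ x)) = 0 := by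
        apply Complex.ext <;> simp [Cx.bil_apply, hD.alt]
      have hz {p : Cx (Tan n x)} (hp : p ∈ Cx.iEigen (J x)) :
          (g.valC x (Cx.ofReal (D ξ x v)) - Cx.bil (α x) (Cx.ofReal v)) p = 0 := by
        rw [LinearMap.sub_apply, hDξ, h2 x v p hp, sub_self]
      -- The two forms agree on `T^{1,0}`, on `T^{0,1}` by conjugation, and both vanish on `ξ` since
      -- `g(ξ, ξ)` is constant.
      have key : g.valC x (Cx.ofReal (D ξ x v)) - Cx.bil (α x) (Cx.ofReal v) = 0 := by
        refine (hJ x).eq_zero_of_forall (fun p hp => hz hp) (fun p hp => ?_) ?_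
        · have := hz (Cx.conj_mem_iEigen hp)
          rw [LinearMap.sub_apply, PseudoRiemannianMetric.valC, Cx.bil_ofReal_conj,
            Cx.bil_ofReal_conj, ← map_sub, map_eq_zero] at this
          exact this
        · rw [LinearMap.sub_apply, hDξ, a1', hα, hK0]
          simp
      have := congrArg Complex.re (LinearMap.congr_fun key (Cx.ofReal w))
      simp [PseudoRiemannianMetric.valC, Cx.bil_apply] at this
      linarith

/-! ### The connections `∇^±` -/

variable {T : TypeBn n M}

theorem isModifiedConnection_minus (T : TypeBn n M) (g : PseudoRiemannianMetric n M)
    (ξ : ∀ x : M, Tan n x) :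
    IsModifiedConnection g (nablaMinus T g) ξ (fun x => (1 / 2 : ℝ) • T.Hₗ x) 0 where
  eq Y x v w := by
    have e : g.valₗ x (g.sharp x (T.H x v (Y x))) w = T.Hₗ x v (Y x) w := g.val_sharp x _ w
    simp [nablaMinus, e]
  alt x u v := by
    have : T.Hₗ x u v v = 0 := T.H_alt_right x u v
    simp [this]
  vec x v := rfl

/-- Skewness of `J₊` rewrites `-g(J₊ F(v), Y)` as `F(v, J₊ Y)`, which is `α`; it vanishes on `X₊`
because `J₊ X₊ = 0`. -/
theorem isModifiedConnection_plus (hJ : ∀ x, IsAlmostContact (g.valₗ x) (J x) (ξ x))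
    (T : TypeBn n M) :
    IsModifiedConnection g (nablaPlus T g J ξ) ξ (fun x => (-(1 / 2) : ℝ) • T.Hₗ x)
      (fun x => (T.Fₗ x).compl₂ (J x)) where
  eq Y x v w := by
    have e : g.valₗ x (g.sharp x (T.H x v (Y x))) w = T.Hₗ x v (Y x) w := g.val_sharp x _ w
    have e' : g.val x (J x (g.sharp x (T.F x v))) (Y x) = -T.Fₗ x v (J x (Y x)) := by
      have h1 := (hJ x).skew (g.sharp x (T.F x v)) (Y x)
      have h2 : g.valₗ x (g.sharp x (T.F x v)) (J x (Y x)) = T.Fₗ x v (J x (Y x)) :=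
        g.val_sharp x _ _
      rw [h2] at h1
      exact h1
    simp only [nablaPlus, e']
    simp [e]
    ring
  alt x u v := by
    have : T.Hₗ x u v v = 0 := T.H_alt_right x u v
    simp [this]
  vec x v := by simp [(hJ x).map_vec]

theorem eq_of_forall_valₗ (g : PseudoRiemannianMetric n M) {v w : Tan n x}
    (h : ∀ u, g.valₗ x v u = g.valₗ x w u) : v = w := by
  rw [← sub_eq_zero]
  refine g.nondegenerate x _ fun u => ?_
  rw [← g.valₗ_apply, map_sub, LinearMap.sub_apply, h, sub_self]

/-- The conditions on `∇⁻`, in terms of the Levi-Civita connection. -/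
structure MinusCond (T : TypeBn n M) (g : PseudoRiemannianMetric n M)
    (J : ∀ x : M, Module.End ℝ (Tan n x)) (ξ : ∀ x : M, Tan n x) : Prop where
  field : ∀ P : ∀ x : M, Cx (Tan n x), SmoothFieldC P → (∀ x, P x ∈ Cx.iEigen (J x)) →
    ∀ x z, ∀ p ∈ Cx.iEigen (J x), g.valC x (g.nablaC P x z) p = -(1 / 2) * T.HC x z (P x) p
  vec : ∀ x z, ∀ p ∈ Cx.iEigen (J x),
    g.valC x (g.nablaC (fun y => Cx.ofReal (ξ y)) x z) p = -(1 / 2) * T.HC x z (Cx.ofReal (ξ x)) p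

/-- The conditions on `∇⁺`, in terms of the Levi-Civita connection. -/
structure PlusCond (T : TypeBn n M) (g : PseudoRiemannianMetric n M)
    (J : ∀ x : M, Module.End ℝ (Tan n x)) (ξ : ∀ x : M, Tan n x) : Prop where
  field : ∀ P : ∀ x : M, Cx (Tan n x), SmoothFieldC P → (∀ x, P x ∈ Cx.iEigen (J x)) →
    ∀ x z, ∀ p ∈ Cx.iEigen (J x), g.valC x (g.nablaC P x z) p = (1 / 2) * T.HC x z (P x) p
  vec : ∀ x z, ∀ p ∈ Cx.iEigen (J x),
    g.valC x (g.nablaC (fun y => Cx.ofReal (ξ y)) x z) p =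
      (1 / 2) * T.HC x z (Cx.ofReal (ξ x)) p + Complex.I * T.FC x z p

/-- Two linear maps into a dual space which agree on real vectors agree. -/
theorem Cx.eq_of_forall_ofReal {V W X : Type*} [AddCommGroup V] [Module ℝ V] [AddCommGroup W]
    [Module ℂ W] [AddCommGroup X] [Module ℂ X] {φ ψ : Cx V →ₗ[ℂ] W →ₗ[ℂ] X} {p : W}
    (h : ∀ v, φ (Cx.ofReal v) p = ψ (Cx.ofReal v) p) (z : Cx V) : φ z p = ψ z p := by
  have := Cx.linearMap_eq_zero (φ := (φ - ψ).flip p) fun v => by simp [h]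
  have := LinearMap.congr_fun this z
  simpa [sub_eq_zero] using this

theorem TypeBn.bil_smul_Hₗ (T : TypeBn n M) (c : ℝ) (v : Tan n x) (z w : Cx (Tan n x)) :
    Cx.bil ((c • T.Hₗ x) v) z w = c * T.HC x (Cx.ofReal v) z w := by
  rw [TypeBn.HC, Cx.tri_ofReal]
  simp only [Cx.bil_apply, LinearMap.smul_apply, smul_eq_mul]
  apply Complex.ext <;> simp <;> ring

theorem preserves_minus_iff (hJ : ∀ x, IsAlmostContact (g.valₗ x) (J x) (ξ x)) (hξ : SmoothField ξ)
    (T : TypeBn n M) :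
    (Preserves (nablaMinus T g) J ∧ ∀ x v, nablaMinus T g ξ x v = 0) ↔ MinusCond T g J ξ := by
  have e : (∀ x v, nablaMinus T g ξ x v = 0) ↔
      ∀ x v w, g.valₗ x (nablaMinus T g ξ x v) w =
        (0 : ∀ x : M, Tan n x →ₗ[ℝ] Tan n x →ₗ[ℝ] ℝ) x v w := by
    refine forall_congr' fun x => forall_congr' fun v => ⟨fun h w => by simp [h], fun h => ?_⟩
    exact g.nondegenerate x _ h
  have h0 (x : M) (v : Tan n x) (p : Cx (Tan n x)) :
      Cx.bil ((0 : ∀ x : M, Tan n x →ₗ[ℝ] Tan n x →ₗ[ℝ] ℝ) x) (Cx.ofReal v) p = 0 := by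
    apply Complex.ext <;> simp [Cx.bil_apply]
  rw [e, preserves_iff hJ hξ (isModifiedConnection_minus T g ξ)]
  simp only [T.bil_smul_Hₗ, ← g.nablaC_ofReal]
  constructor
  · rintro ⟨h1, h2⟩
    refine ⟨fun P sP mP x z p hp => ?_, fun x z p hp => ?_⟩
    · refine Cx.eq_of_forall_ofReal (φ := (g.valC x).comp (g.nablaC P x))
        (ψ := (-(1 / 2) : ℂ) • (T.HC x).flip (P x)) (fun v => ?_) z
      have := h1 P sP mP x v p hp
      simp at this ⊢
      linear_combination this
    · refine Cx.eq_of_forall_ofReal (φ := (g.valC x).comp (g.nablaC _ x))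
        (ψ := (-(1 / 2) : ℂ) • (T.HC x).flip (Cx.ofReal (ξ x))) (fun v => ?_) z
      have := h2 x v p hp
      rw [h0] at this
      simp at this ⊢
      linear_combination this
  · rintro ⟨h1, h2⟩
    refine ⟨fun P sP mP x v p hp => ?_, fun x v p hp => ?_⟩
    · rw [h1 P sP mP x _ p hp]
      push_cast
      ring
    · rw [h2 x _ p hp, h0]
      push_cast
      ring

/-- The one-form `F(v, J₊ ·)` prescribed for `∇⁺X₊` becomes `i F(v, ·)` on `T^{1,0}₊`; this is the
origin of the `F`-term in `PlusCond`. -/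
theorem preserves_plus_iff (hJ : ∀ x, IsAlmostContact (g.valₗ x) (J x) (ξ x)) (hξ : SmoothField ξ)
    (T : TypeBn n M) :
    (Preserves (nablaPlus T g J ξ) J ∧
      ∀ x v, nablaPlus T g J ξ ξ x v = -J x (g.sharp x (T.F x v))) ↔ PlusCond T g J ξ := by
  have hs (x : M) (v w : Tan n x) : g.valₗ x (-J x (g.sharp x (T.F x v))) w = T.Fₗ x v (J x w) := by
    rw [map_neg, LinearMap.neg_apply, (hJ x).skew, neg_neg]
    exact g.val_sharp x _ _
  have e : (∀ x v, nablaPlus T g J ξ ξ x v = -J x (g.sharp x (T.F x v))) ↔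
      ∀ x v w, g.valₗ x (nablaPlus T g J ξ ξ x v) w = (T.Fₗ x).compl₂ (J x) v w := by
    refine forall_congr' fun x => forall_congr' fun v => ⟨fun h w => by rw [h, hs]; rfl, fun h => ?_⟩
    refine eq_of_forall_valₗ g fun w => ?_
    rw [h, hs]
    rfl
  have hF {x : M} (v : Tan n x) {p : Cx (Tan n x)} (hp : p ∈ Cx.iEigen (J x)) :
      Cx.bil ((T.Fₗ x).compl₂ (J x)) (Cx.ofReal v) p = Complex.I * T.FC x (Cx.ofReal v) p := by
    have : Cx.bil ((T.Fₗ x).compl₂ (J x)) (Cx.ofReal v) p =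
        T.FC x (Cx.ofReal v) (Cx.map (J x) p) := rfl
    rw [this, Cx.mem_iEigen_iff_map.1 hp, map_smul, smul_eq_mul]
  rw [e, preserves_iff hJ hξ (isModifiedConnection_plus hJ T)]
  simp only [T.bil_smul_Hₗ, ← g.nablaC_ofReal]
  constructor
  · rintro ⟨h1, h2⟩
    refine ⟨fun P sP mP x z p hp => ?_, fun x z p hp => ?_⟩
    · refine Cx.eq_of_forall_ofReal (φ := (g.valC x).comp (g.nablaC P x))
        (ψ := ((1 / 2) : ℂ) • (T.HC x).flip (P x)) (fun v => ?_) z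
      have := h1 P sP mP x v p hp
      simp at this ⊢
      linear_combination this
    · refine Cx.eq_of_forall_ofReal (φ := (g.valC x).comp (g.nablaC _ x))
        (ψ := ((1 / 2) : ℂ) • (T.HC x).flip (Cx.ofReal (ξ x)) + Complex.I • T.FC x)
        (fun v => ?_) z
      have := h2 x v p hp
      rw [hF v hp] at this
      simp at this ⊢
      linear_combination this
  · rintro ⟨h1, h2⟩
    refine ⟨fun P sP mP x v p hp => ?_, fun x v p hp => ?_⟩
    · rw [h1 P sP mP x _ p hp]
      push_cast
      ring
    · rw [h2 x _ p hp, hF v hp]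
      push_cast
      ring

end

section
variable {n : ℕ} {M : Type*} [TopologicalSpace M] [ChartedSpace (EuclideanSpace ℝ (Fin n)) M]
  [IsManifold (𝓡 n) ∞ M] {g : PseudoRiemannianMetric n M} {x : M} {T : TypeBn n M}
  {J : ∀ x : M, Module.End ℝ (Tan n x)} {ξ : ∀ x : M, Tan n x}

/-! ### Sufficiency of the conditions -/

/-- `p + c` lies in `L₊`, described by the almost contact structure `(J, ξ)`. -/
def MemPlus (g : PseudoRiemannianMetric n M) (J : ∀ x : M, Module.End ℝ (Tan n x))
    (ξ : ∀ x : M, Tan n x) {x : M} (p : Cx (Tan n x)) (c : ℂ) : Prop :=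
  p - g.valC x p (Cx.ofReal (ξ x)) • Cx.ofReal (ξ x) ∈ Cx.iEigen (J x) ∧
    c = Complex.I * g.valC x p (Cx.ofReal (ξ x))

theorem MemPlus.exists_add {p : Cx (Tan n x)} {c : ℂ} (h : MemPlus g J ξ p c) :
    p + (Complex.I * c) • Cx.ofReal (ξ x) ∈ Cx.iEigen (J x) := by
  obtain ⟨h1, h2⟩ := h
  have e : Complex.I * c = -g.valC x p (Cx.ofReal (ξ x)) := by
    rw [h2, ← mul_assoc, Complex.I_mul_I, neg_one_mul]
  rwa [e, neg_smul, ← sub_eq_add_neg]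

/-- Merges both clauses of `PlusCond` into one formula for `⟨∇_z u, w⟩` with `u, w` in `L₊`. A
section `P + a` of `L₊` has `P = P₀ - i a X₊` with `P₀` of type (1,0), and the product rule is
applied to this expression. -/
theorem PlusCond.derivative_eq (hJ : ∀ x, IsAlmostContact (g.valₗ x) (J x) (ξ x))
    (hξ : SmoothField ξ) (hT : PlusCond T g J ξ) {P : ∀ x : M, Cx (Tan n x)} {a : M → ℂ}
    (hP : SmoothFieldC P) (ha : SmoothFunC n a) (hL : ∀ y, MemPlus g J ξ (P y) (a y))
    {p : Cx (Tan n x)} {b : ℂ} (hp : MemPlus g J ξ p b) (z : Cx (Tan n x)) :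
    g.valC x (g.nablaC P x z) p + b * dC a x z =
      (1 / 2) * T.HC x z (P x) p + a x * T.FC x z p - b * T.FC x z (P x) := by
  have hf : SmoothFunC n (fun y => Complex.I * a y) := ha.const_mul _
  have hP' := hP.add (hξ.ofReal.smul hf)
  have mP' (y : M) := (hL y).exists_add
  have mp' := hp.exists_add
  have e1 := hT.field _ hP' mP' x z _ mp'
  have e2 := hT.vec x z _ mp'
  have e3 := hT.vec x z _ (mP' x)
  have e4 := g.nablaC_skew hP' hξ.ofReal (c := 0) (fun y => (hJ y).bil_vec_eq_zero (mP' y)) z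
  have e5 := g.nablaC_skew hξ.ofReal hξ.ofReal (c := 1) (fun y => (hJ y).bil_norm) z
  rw [g.valC_symm (Cx.ofReal (ξ x)), eq_neg_iff_add_eq_zero, ← two_mul] at e5
  have e5' : g.valC x (g.nablaC (fun y => Cx.ofReal (ξ y)) x z) (Cx.ofReal (ξ x)) = 0 := by
    simpa using e5
  have hb := hp.2
  have eH : T.HC x z (Cx.ofReal (ξ x)) (Cx.ofReal (ξ x)) = 0 := by
    have := T.HC_swap_right z (Cx.ofReal (ξ x)) (Cx.ofReal (ξ x))
    rw [eq_neg_iff_add_eq_zero, ← two_mul] at this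
    simpa using this
  have eH' := T.HC_swap_right z (P x) (Cx.ofReal (ξ x))
  have eg := g.valC_symm (P x + (Complex.I * a x) • Cx.ofReal (ξ x))
    (g.nablaC (fun y => Cx.ofReal (ξ y)) x z)
  rw [eg] at e4
  have en := g.nablaC_add (x := x) hP (hξ.ofReal.smul hf) z
  rw [g.nablaC_smul hf hξ.ofReal, dC_const_mul Complex.I ha] at en
  have es := g.valC_symm (Cx.ofReal (ξ x)) p
  rw [en] at e1 e4
  simp only [map_add, map_smul, LinearMap.add_apply, LinearMap.smul_apply, smul_eq_mul, e5', eH,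
    eH', es] at e1 e2 e3 e4 ⊢
  linear_combination e1 - Complex.I * b * e4 - Complex.I * a x * e2 + Complex.I * b * e3
    + dC a x z * hb + (b * T.FC x z (P x) - a x * T.FC x z p) * Complex.I_mul_I

/-- The algebraic conditions on `F` and `H`, for complex vectors. -/
structure TensorCond (T : TypeBn n M) (Jp Jm : ∀ x : M, Module.End ℝ (Tan n x))
    (ξp ξm : ∀ x : M, Tan n x) : Prop where
  H_plus : ∀ x, ∀ a ∈ Cx.iEigen (Jp x), ∀ b ∈ Cx.iEigen (Jp x), ∀ c ∈ Cx.iEigen (Jp x),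
    T.HC x a b c = 0
  H_minus : ∀ x, ∀ a ∈ Cx.iEigen (Jm x), ∀ b ∈ Cx.iEigen (Jm x), ∀ c ∈ Cx.iEigen (Jm x),
    T.HC x a b c = 0
  H_vec_plus : ∀ x, ∀ a ∈ Cx.iEigen (Jp x), ∀ b ∈ Cx.iEigen (Jp x),
    T.HC x (Cx.ofReal (ξp x)) a b = Complex.I * T.FC x a b
  H_vec_minus : ∀ x, ∀ a ∈ Cx.iEigen (Jm x), ∀ b ∈ Cx.iEigen (Jm x),
    T.HC x (Cx.ofReal (ξm x)) a b = 0
  F_minus : ∀ x, ∀ a ∈ Cx.iEigen (Jm x), ∀ b ∈ Cx.iEigen (Jm x), T.FC x a b = 0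
  F_vec : ∀ x z, T.FC x (Cx.ofReal (ξm x)) z = 0

theorem TypeBn.FC_self (T : TypeBn n M) (z : Cx (Tan n x)) : T.FC x z z = 0 := by
  have := T.FC_swap z z
  rw [eq_neg_iff_add_eq_zero, ← two_mul] at this
  simpa using this

theorem TypeBn.HC_self_left (T : TypeBn n M) (z w : Cx (Tan n x)) : T.HC x z z w = 0 := by
  have := T.HC_swap_left z z w
  rw [eq_neg_iff_add_eq_zero, ← two_mul] at this
  simpa using this

theorem TypeBn.HC_self_right (T : TypeBn n M) (z w : Cx (Tan n x)) : T.HC x z w w = 0 := by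
  have := T.HC_swap_right z w w
  rw [eq_neg_iff_add_eq_zero, ← two_mul] at this
  simpa using this

theorem TypeBn.HC_cyc (T : TypeBn n M) (a b c : Cx (Tan n x)) :
    T.HC x c a b = T.HC x a b c := by
  rw [T.HC_swap_left, T.HC_swap_right, neg_neg]

/-- Packages the two conditions on `H` over `T^{1,0}₊` into one cyclic identity on `L₊`, obtained by
subtracting from each vector its multiple of `X₊`. -/
theorem TensorCond.H_memPlus {Jp Jm : ∀ x : M, Module.End ℝ (Tan n x)} {ξp ξm : ∀ x : M, Tan n x}
    (h : TensorCond T Jp Jm ξp ξm) {p q r : Cx (Tan n x)} {a b c : ℂ} (hp : MemPlus g Jp ξp p a)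
    (hq : MemPlus g Jp ξp q b) (hr : MemPlus g Jp ξp r c) :
    T.HC x p q r = c * T.FC x p q + a * T.FC x q r + b * T.FC x r p := by
  have mp := hp.exists_add
  have mq := hq.exists_add
  have mr := hr.exists_add
  have e0 := h.H_plus x _ mp _ mq _ mr
  have e1 := h.H_vec_plus x _ mp _ mq
  have e2 := h.H_vec_plus x _ mq _ mr
  have e3 := h.H_vec_plus x _ mr _ mp
  set ξ := Cx.ofReal (ξp x)
  have k1 : T.HC x p q ξ = T.HC x ξ p q := (T.HC_cyc p q ξ).symm
  have k2 : T.HC x p ξ r = T.HC x ξ r p := T.HC_cyc ξ r p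
  have k3 (w : Cx (Tan n x)) : T.HC x ξ w ξ = 0 := by rw [T.HC_swap_left, T.HC_self_right, neg_zero]
  simp only [map_add, map_smul, LinearMap.add_apply, LinearMap.smul_apply, smul_eq_mul, T.FC_self,
    T.HC_self_left, T.HC_self_right, T.FC_swap _ ξ, k1, k2, k3] at e0 e1 e2 e3 ⊢
  linear_combination e0 - Complex.I * c * e1 - Complex.I * a * e2 - Complex.I * b * e3
    - (c * T.FC x p q + a * T.FC x q r + b * T.FC x r p) * Complex.I_mul_I

/-- The conditions imply that the sections of `L` are closed under the Dorfman bracket. -/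
theorem AlmostPseudoHermitian.isBnGenComplex_of_conditions (S : AlmostPseudoHermitian n M)
    (hn : Odd n) (hg : S.G.IsStandard g) {u₀ : ∀ x : M, Fib n x}
    (hu₀ : S.IsNormalizedKernelSection u₀) (hp : PlusCond T g (S.Jplus g) S.Xplus)
    (hm : MinusCond T g (S.Jminus g) (fun x => (u₀ x).1))
    (ht : TensorCond T (S.Jplus g) (S.Jminus g) S.Xplus (fun x => (u₀ x).1)) :
    IsBnGenComplex T S.J := by
  refine ⟨S.almostComplex, fun u v hu hv mu mv x => ?_⟩
  have cp := S.isAlmostContact_plus hn hg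
  have cm := S.isAlmostContact_minus hn hg hu₀
  have hξ := S.smoothField_Xplus
  have hη : SmoothField (fun x => (u₀ x).1) := hu₀.smooth.1
  obtain ⟨P, Q, a, hP, hQ, ha, eu⟩ := hg.exists_smooth_componentsC hu
  obtain ⟨P', Q', b, hP', hQ', hb, ev⟩ := hg.exists_smooth_componentsC hv
  have mP (y : M) : MemPlus g (S.Jplus g) S.Xplus (P y) (a y) ∧ Q y ∈ Cx.iEigen (S.Jminus g y) := by
    have := mu y
    rw [eu, S.mkFibC_mem_iEigen hn hg] at this
    exact ⟨⟨this.1, this.2.2⟩, this.2.1⟩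
  have mP' (y : M) :
      MemPlus g (S.Jplus g) S.Xplus (P' y) (b y) ∧ Q' y ∈ Cx.iEigen (S.Jminus g y) := by
    have := mv y
    rw [ev, S.mkFibC_mem_iEigen hn hg] at this
    exact ⟨⟨this.1, this.2.2⟩, this.2.1⟩
  have F := pairingC_dorfmanC T g hu hv hP hQ hP' hQ' eu ev x
  refine S.mem_iEigen_of_pairingC_eq_zero hn hg hu₀ (fun w hw => ?_) ?_
  · obtain ⟨p, q, c, rfl⟩ := g.mkFibC_surj w
    rw [S.mkFibC_mem_iEigen hn hg] at hw
    obtain ⟨h1, mq, h2⟩ := hw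
    have mp : MemPlus g (S.Jplus g) S.Xplus p c := ⟨h1, h2⟩
    -- After the derivatives are replaced, the mixed `E₊`/`E₋` terms in `H` cancel identically. What
    -- survives is the cyclic identity on `L₊`, `H` on `T^{1,0}₋`, and `F` on `T^{1,0}₋`.
    have a1 := hp.derivative_eq cp hξ hP' hb (fun y => (mP' y).1) mp (P x + Q x)
    have a2 := hp.derivative_eq cp hξ hP ha (fun y => (mP y).1) mp (P' x + Q' x)
    have a3 := hp.derivative_eq cp hξ hP ha (fun y => (mP y).1) (mP' x).1 (p + q)
    have b1 := hm.field Q' hQ' (fun y => (mP' y).2) x (P x + Q x) q mq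
    have b2 := hm.field Q hQ (fun y => (mP y).2) x (P' x + Q' x) q mq
    have b3 := hm.field Q hQ (fun y => (mP y).2) x (p + q) (Q' x) (mP' x).2
    have c1 := ht.H_memPlus (mP x).1 (mP' x).1 mp
    have c2 := ht.H_minus x _ (mP x).2 _ (mP' x).2 _ mq
    have c3 := ht.F_minus x _ (mP x).2 _ (mP' x).2
    have c4 := ht.F_minus x _ (mP' x).2 _ mq
    have c5 := ht.F_minus x _ (mP x).2 _ mq
    rw [F]
    simp only [map_add, LinearMap.add_apply, T.HC_swap_left (P' x) (P x),
      T.HC_swap_left (Q' x) (P x), T.HC_swap_left (P' x) (Q x), T.HC_swap_left (Q' x) (Q x),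
      T.HC_cyc _ _ p, T.HC_cyc _ _ q, T.FC_swap p, T.FC_swap q, T.FC_swap (P' x) (P x),
      T.FC_swap (Q' x) (P x)] at a1 a2 a3 b1 b2 b3 c1 ⊢
    linear_combination a1 - a2 + a3 - b1 + b2 - b3 + c1 + c2 + c * c3 + a x * c4 - b x * c5
  · rw [F]
    have b1 := hm.vec x (P x + Q x) _ (mP' x).2
    have b2 := hm.vec x (P' x + Q' x) _ (mP x).2
    have b3 := hm.field Q hQ (fun y => (mP y).2) x (Cx.ofReal (u₀ x).1) (Q' x) (mP' x).2
    have a3 := hp.derivative_eq cp hξ hP ha (fun y => (mP y).1) (mP' x).1 (Cx.ofReal (u₀ x).1)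
    -- `X₋` is not of type (1,0), so the derivative is moved from `Q'` and `Q` onto `X₋`, where the
    -- second clause of `MinusCond` applies.
    have d1 := g.nablaC_skew hQ' hη.ofReal (c := 0) (fun y => (cm y).bil_vec_eq_zero (mP' y).2)
      (P x + Q x)
    have d2 := g.nablaC_skew hQ hη.ofReal (c := 0) (fun y => (cm y).bil_vec_eq_zero (mP y).2)
      (P' x + Q' x)
    rw [g.valC_symm (Q' x), b1] at d1
    rw [g.valC_symm (Q x), b2] at d2
    have f1 := ht.F_vec x
    have f2 (z : Cx (Tan n x)) : T.FC x z (Cx.ofReal (u₀ x).1) = 0 := by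
      rw [T.FC_swap, f1, neg_zero]
    have h1 := ht.H_vec_minus x _ (mP x).2 _ (mP' x).2
    rw [zero_add, d1, d2, b3]
    simp only [map_zero, zero_mul, add_zero, zero_sub, f2, mul_zero]
    simp only [f1, mul_zero, sub_zero, add_zero] at a3
    set η := Cx.ofReal (u₀ x).1
    simp only [map_add, LinearMap.add_apply, T.HC_swap_left _ η, ← T.HC_cyc _ _ η] at a3 ⊢
    simp only [T.HC_swap_right η (P' x) (Q x), T.HC_swap_right η (Q' x) (Q x)]
    linear_combination a3 + h1

end

section
variable {n : ℕ} {M : Type*} [TopologicalSpace M] [ChartedSpace (EuclideanSpace ℝ (Fin n)) M]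
  [IsManifold (𝓡 n) ∞ M] {g : PseudoRiemannianMetric n M} {x : M} {T : TypeBn n M}

/-! ### The structure `(𝒢, 𝒢ᵉⁿᵈ 𝓕)` -/

theorem GeneralizedMetric.IsStandard.map_Gend_mkFibC {G : GeneralizedMetric n M}
    (hg : G.IsStandard g) (p q : Cx (Tan n x)) (c : ℂ) :
    Cx.map (G.Gend x) (g.mkFibC p q c) = g.mkFibC p (-q) c :=
  Cx.ext (hg.Gend_mkFib ..) (hg.Gend_mkFib ..)

variable {S : AlmostPseudoHermitian n M}

/-- `𝒢ᵉⁿᵈ` flips the sign of `J₋`, and the `i`-eigenvectors of `-J₋` are the conjugates of those of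
`J₋`. -/
theorem AlmostPseudoHermitian.mkFibC_mem_iEigen_comp (hn : Odd n) (hg : S.G.IsStandard g)
    {p q : Cx (Tan n x)} {c : ℂ} :
    g.mkFibC p q c ∈ Cx.iEigen (S.G.Gend x * S.J x) ↔
      g.mkFibC p (Cx.conj q) c ∈ Cx.iEigen (S.J x) := by
  have e : Cx.map (S.G.Gend x * S.J x) (g.mkFibC p q c) =
      Cx.map (S.G.Gend x) (Cx.map (S.J x) (g.mkFibC p q c)) := rfl
  have hq : -Cx.map (S.Jminus g x) q = Complex.I • q ↔
      Cx.map (S.Jminus g x) (Cx.conj q) = Complex.I • Cx.conj q := by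
    simp only [Cx.ext_iff]
    simp [neg_eq_iff_eq_neg]
  rw [Cx.mem_iEigen_iff_map, Cx.mem_iEigen_iff_map, e, S.map_J_mkFibC hg, S.map_J_mkFibC hg,
    hg.map_Gend_mkFibC, g.smul_mkFibC, g.smul_mkFibC]
  constructor
  · intro h
    obtain ⟨h1, h2, h3⟩ := g.mkFibC_inj h
    rw [h1, hq.1 h2, h3]
  · intro h
    obtain ⟨h1, h2, h3⟩ := g.mkFibC_inj h
    rw [h1, hq.2 h2, h3]

theorem GeneralizedMetric.IsStandard.Gend_Gend {G : GeneralizedMetric n M}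
    (hg : G.IsStandard g) (u : Fib n x) : G.Gend x (G.Gend x u) = u := by
  obtain ⟨p, q, c, rfl⟩ := g.mkFib_surj u
  rw [hg.Gend_mkFib, hg.Gend_mkFib, neg_neg]

/-- `𝒢ᵉⁿᵈ` is an involution commuting with `𝓕`, so `(𝒢ᵉⁿᵈ 𝓕)² = 𝓕²`, and the rank depends only on
the square. -/
theorem AlmostPseudoHermitian.finrank_iEigen_comp (hg : S.G.IsStandard g) (x : M) :
    Module.finrank ℂ (Cx.iEigen (S.G.Gend x * S.J x)) = n := by
  have hsq : S.G.Gend x * S.J x * (S.G.Gend x * S.J x) = S.J x * S.J x := by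
    refine LinearMap.ext fun u => ?_
    change S.G.Gend x (S.J x (S.G.Gend x (S.J x u))) = S.J x (S.J x u)
    rw [← S.Gend_J, hg.Gend_Gend]
  have h1 := Cx.finrank_ker_sq_add_one (S.G.Gend x * S.J x)
  have h2 := Cx.finrank_ker_sq_add_one (S.J x)
  rw [hsq, h2, S.almostComplex.rank] at h1
  omega

theorem AlmostPseudoHermitian.mem_iEigen_of_mkFibC (hn : Odd n) (hg : S.G.IsStandard g)
    {p q : Cx (Tan n x)} {c : ℂ} (h : g.mkFibC p q c ∈ Cx.iEigen (S.J x)) :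
    g.mkFibC p 0 c ∈ Cx.iEigen (S.J x) ∧ g.mkFibC 0 q 0 ∈ Cx.iEigen (S.J x) := by
  simp only [S.mkFibC_mem_iEigen hn hg] at h ⊢
  exact ⟨⟨h.1, Submodule.zero_mem _, h.2.2⟩, by simp, h.2.1, by simp⟩

theorem Cx.conj_zero {V : Type*} [AddCommGroup V] : Cx.conj (0 : Cx V) = 0 := by
  ext <;> simp

/-- The summands `L₊` and `L₋` are mutually orthogonal and `g` is real, so conjugating `L₋` alone
preserves isotropy and leaves the real vectors orthogonal to the eigenbundle unchanged. -/
theorem AlmostPseudoHermitian.isBnGenAlmostComplex_comp (hn : Odd n) (hg : S.G.IsStandard g) :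
    IsBnGenAlmostComplex (fun x => S.G.Gend x * S.J x) where
  smooth u hu := S.G.smooth _ (S.almostComplex.smooth u hu)
  isotropic x z hz w hw := by
    change pairingC n x z w = 0
    obtain ⟨p, q, c, rfl⟩ := g.mkFibC_surj z
    obtain ⟨p', q', c', rfl⟩ := g.mkFibC_surj w
    obtain ⟨h1, h2⟩ := S.mem_iEigen_of_mkFibC hn hg ((S.mkFibC_mem_iEigen_comp hn hg).1 hz)
    obtain ⟨h3, h4⟩ := S.mem_iEigen_of_mkFibC hn hg ((S.mkFibC_mem_iEigen_comp hn hg).1 hw)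
    have e1 : pairingC n x _ _ = 0 := S.almostComplex.isotropic x _ h1 _ h3
    have e2 : pairingC n x _ _ = 0 := S.almostComplex.isotropic x _ h2 _ h4
    rw [g.pairingC_mkFibC] at e1 e2 ⊢
    have e3 : g.valC x (Cx.conj q) (Cx.conj q') = 0 := by simpa using e2
    rw [PseudoRiemannianMetric.valC, Cx.bil_conj, map_eq_zero] at e3
    have e4 : g.valC x q q' = 0 := e3
    simp only [map_zero, sub_zero] at e1
    linear_combination e1 - e4
  rank := S.finrank_iEigen_comp hg
  eq_zero x u hu := by
    obtain ⟨p, q, c, rfl⟩ := g.mkFib_surj u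
    have e : (⟨g.mkFib p q c, 0⟩ : Cx (Fib n x)) =
        g.mkFibC (Cx.ofReal p) (Cx.ofReal q) (c : ℂ) :=
      Cx.ext rfl (by simp [PseudoRiemannianMetric.mkFibC, PseudoRiemannianMetric.mkFib]; rfl)
    have key : S.J x (g.mkFib p q c) = 0 := by
      refine S.almostComplex.eq_zero x _ fun z hz => ?_
      change pairingC n x _ z = 0
      obtain ⟨p', q', c', rfl⟩ := g.mkFibC_surj z
      obtain ⟨h1, h2⟩ := S.mem_iEigen_of_mkFibC hn hg hz
      rw [← Cx.conj_conj q'] at h2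
      rw [← Cx.conj_zero] at h1
      have e1 : pairingC n x _ _ = 0 := hu _ ((S.mkFibC_mem_iEigen_comp hn hg).2 h1)
      have e2 : pairingC n x _ _ = 0 := hu _ ((S.mkFibC_mem_iEigen_comp hn hg).2 h2)
      rw [e, g.pairingC_mkFibC] at e1 e2 ⊢
      have e3 : g.valC x (Cx.ofReal q) (Cx.conj q') = 0 := by simpa using e2
      rw [PseudoRiemannianMetric.valC, Cx.bil_ofReal_conj, map_eq_zero] at e3
      have e4 : g.valC x (Cx.ofReal q) q' = 0 := e3
      simp only [map_zero, sub_zero] at e1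
      linear_combination e1 - e4
    change S.G.Gend x (S.J x (g.mkFib p q c)) = 0
    rw [key, map_zero]

/-- The almost pseudo-Hermitian structure `(𝒢, 𝒢ᵉⁿᵈ 𝓕)`. -/
noncomputable def AlmostPseudoHermitian.comp (S : AlmostPseudoHermitian n M) (hn : Odd n)
    (hg : S.G.IsStandard g) : AlmostPseudoHermitian n M where
  G := S.G
  J x := S.G.Gend x * S.J x
  almostComplex := S.isBnGenAlmostComplex_comp hn hg
  commute x := by rw [mul_assoc, S.commute]

theorem AlmostPseudoHermitian.comp_Jplus (hn : Odd n) (hg : S.G.IsStandard g) :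
    (S.comp hn hg).Jplus g = S.Jplus g := by
  funext x
  refine LinearMap.ext fun p => ?_
  have e : g.toEplus x p = g.mkFib p 0 0 := by
    simp [PseudoRiemannianMetric.mkFib, PseudoRiemannianMetric.toEplus]
  change (S.G.Gend x (S.J x (g.toEplus x p))).1 = _
  rw [e, S.J_plus hg, hg.Gend_mkFib]
  simp [PseudoRiemannianMetric.mkFib]

theorem AlmostPseudoHermitian.comp_Jminus (hn : Odd n) (hg : S.G.IsStandard g) :
    (S.comp hn hg).Jminus g = fun x => -S.Jminus g x := by
  funext x
  refine LinearMap.ext fun q => ?_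
  have e : g.toEminus x q = g.mkFib 0 q 0 := by
    simp [PseudoRiemannianMetric.mkFib, PseudoRiemannianMetric.toEminus]
  change (S.G.Gend x (S.J x (g.toEminus x q))).1 = _
  rw [e, S.J_minus hg, hg.Gend_mkFib]
  simp [PseudoRiemannianMetric.mkFib]

theorem AlmostPseudoHermitian.comp_Xplus (hn : Odd n) (hg : S.G.IsStandard g) :
    (S.comp hn hg).Xplus = S.Xplus := by
  funext x
  have e : ((0, 0, 1) : Fib n x) = g.mkFib 0 0 1 := by simp [PseudoRiemannianMetric.mkFib]
  change (S.G.Gend x (S.J x (0, 0, 1))).1 = _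
  rw [e, S.J_one hg, hg.Gend_mkFib]
  simp [PseudoRiemannianMetric.mkFib]

theorem AlmostPseudoHermitian.IsNormalizedKernelSection.comp (hn : Odd n)
    (hg : S.G.IsStandard g) {u₀ : ∀ x : M, Fib n x} (h : S.IsNormalizedKernelSection u₀) :
    (S.comp hn hg).IsNormalizedKernelSection u₀ where
  smooth := h.smooth
  mem_ker x := by
    change S.G.Gend x (S.J x (u₀ x)) = 0
    rw [h.mem_ker, map_zero]
  norm := h.norm

/-! ### Passing from `J₋` to `-J₋` -/

variable {J : ∀ x : M, Module.End ℝ (Tan n x)} {ξ : ∀ x : M, Tan n x}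

theorem Cx.conj_ofReal {V : Type*} [AddCommGroup V] (v : V) :
    Cx.conj (Cx.ofReal v) = Cx.ofReal v := by
  ext <;> simp

theorem PseudoRiemannianMetric.valC_conj (g : PseudoRiemannianMetric n M) (z w : Cx (Tan n x)) :
    g.valC x (Cx.conj z) (Cx.conj w) = (starRingEnd ℂ) (g.valC x z w) :=
  Cx.bil_conj _ z w

theorem TypeBn.FC_conj (T : TypeBn n M) (z w : Cx (Tan n x)) :
    T.FC x (Cx.conj z) (Cx.conj w) = (starRingEnd ℂ) (T.FC x z w) :=
  Cx.bil_conj _ z w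

theorem TypeBn.HC_conj (T : TypeBn n M) (a b c : Cx (Tan n x)) :
    T.HC x (Cx.conj a) (Cx.conj b) (Cx.conj c) = (starRingEnd ℂ) (T.HC x a b c) :=
  Cx.tri_conj _ a b c

/-- The equations have real coefficients, so conjugating every argument, including the direction
`z`, exchanges the eigenbundles of `J₋` and `-J₋`. -/
theorem MinusCond.neg (hξ : SmoothField ξ) (h : MinusCond T g J ξ) :
    MinusCond T g (fun x => -J x) ξ where
  field P hP mP x z p hp := by
    have e := h.field _ hP.conj (fun y => Cx.conj_mem_iEigen (mP y)) x (Cx.conj z) _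
      (Cx.conj_mem_iEigen hp)
    rw [g.nablaC_conj hP, g.valC_conj, T.HC_conj] at e
    have e' := congrArg (starRingEnd ℂ) e
    have e2 : (starRingEnd ℂ) 2 = 2 := map_ofNat _ 2
    simpa [e2] using e'
  vec x z p hp := by
    have e := h.vec x (Cx.conj z) _ (Cx.conj_mem_iEigen hp)
    have en := g.nablaC_conj (x := x) hξ.ofReal z
    simp only [Cx.conj_ofReal] at en
    rw [en, g.valC_conj, ← Cx.conj_ofReal (ξ x), T.HC_conj] at e
    have e' := congrArg (starRingEnd ℂ) e
    have e2 : (starRingEnd ℂ) 2 = 2 := map_ofNat _ 2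
    simpa [e2] using e'

theorem TensorCond.neg {Jp Jm : ∀ x : M, Module.End ℝ (Tan n x)} {ξp ξm : ∀ x : M, Tan n x}
    (h : TensorCond T Jp Jm ξp ξm) : TensorCond T Jp (fun x => -Jm x) ξp ξm where
  H_plus := h.H_plus
  H_minus x a ha b hb c hc := by
    have e := h.H_minus x _ (Cx.conj_mem_iEigen ha) _ (Cx.conj_mem_iEigen hb) _
      (Cx.conj_mem_iEigen hc)
    rwa [T.HC_conj, map_eq_zero] at e
  H_vec_plus := h.H_vec_plus
  H_vec_minus x a ha b hb := by
    have e := h.H_vec_minus x _ (Cx.conj_mem_iEigen ha) _ (Cx.conj_mem_iEigen hb)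
    rwa [← Cx.conj_ofReal (ξm x), T.HC_conj, map_eq_zero] at e
  F_minus x a ha b hb := by
    have e := h.F_minus x _ (Cx.conj_mem_iEigen ha) _ (Cx.conj_mem_iEigen hb)
    rwa [T.FC_conj, map_eq_zero] at e
  F_vec := h.F_vec

/-- The integrability criterion is used twice: for `𝓕`, and for `𝒢ᵉⁿᵈ 𝓕`, whose components are the
same except for the sign of `J₋`. -/
theorem AlmostPseudoHermitian.isPseudoKahler_of_conditions (S : AlmostPseudoHermitian n M)
    (hn : Odd n) (hg : S.G.IsStandard g) {u₀ : ∀ x : M, Fib n x}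
    (hu₀ : S.IsNormalizedKernelSection u₀) (hp : PlusCond T g (S.Jplus g) S.Xplus)
    (hm : MinusCond T g (S.Jminus g) (fun x => (u₀ x).1))
    (ht : TensorCond T (S.Jplus g) (S.Jminus g) S.Xplus (fun x => (u₀ x).1)) :
    S.IsPseudoKahler T := by
  refine ⟨S.isBnGenComplex_of_conditions hn hg hu₀ hp hm ht, ?_⟩
  have hg' : (S.comp hn hg).G.IsStandard g := hg
  refine (S.comp hn hg).isBnGenComplex_of_conditions hn hg' (hu₀.comp hn hg) ?_ ?_ ?_
  · rwa [S.comp_Jplus, S.comp_Xplus]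
  · rw [S.comp_Jminus]
    exact hm.neg hu₀.smooth.1
  · rw [S.comp_Jminus, S.comp_Jplus, S.comp_Xplus]
    exact ht.neg

end

theorem Cx.eq_zero_of_mem_of_conj_mem {V : Type*} [AddCommGroup V] [Module ℝ V]
    {J : Module.End ℝ V} {z : Cx V} (h : z ∈ Cx.iEigen J) (h' : Cx.conj z ∈ Cx.iEigen J) :
    z = 0 := by
  rw [Cx.mem_iEigen] at h h'
  simp only [Cx.conj_re, Cx.conj_im, map_neg, neg_neg] at h'
  have key (v : V) (hv : v = -v) : v = 0 := by
    have := eq_neg_iff_add_eq_zero.1 hv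
    rw [← two_smul ℝ] at this
    simpa using this
  exact Cx.ext (key _ (h.2.symm.trans (neg_eq_iff_eq_neg.1 h'.2))) (key _ (h'.1.symm.trans h.1))

/-- The equation at `X₊ + i ∈ L₊` and the one at its conjugate `X₊ - i` differ only in the sign of
`ik`, so together they separate `φ(ξ)` from `k`. -/
theorem IsAlmostContact.eq_zero_of_forall_conj {V : Type*} [AddCommGroup V] [Module ℝ V]
    {B : V →ₗ[ℝ] V →ₗ[ℝ] ℝ} {J : Module.End ℝ V} {ξ : V} (h : IsAlmostContact B J ξ)
    {φ : Cx V →ₗ[ℂ] ℂ} {k : ℂ} (h1 : ∀ z ∈ Cx.iEigen J, φ z = 0)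
    (h2 : ∀ z ∈ Cx.iEigen J, φ (Cx.conj z) = 0) (h3 : φ (Cx.ofReal ξ) + Complex.I * k = 0)
    (h4 : φ (Cx.ofReal ξ) - Complex.I * k = 0) : φ = 0 ∧ k = 0 := by
  refine ⟨h.eq_zero_of_forall h1 (fun z hz => ?_) (by linear_combination (h3 + h4) / 2), ?_⟩
  · rw [← Cx.conj_conj z]
    exact h2 _ (Cx.conj_mem_iEigen hz)
  · linear_combination (-Complex.I / 2) * (h3 - h4) + k * Complex.I_mul_I

section
variable {n : ℕ} {M : Type*} [TopologicalSpace M] [ChartedSpace (EuclideanSpace ℝ (Fin n)) M]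
  [IsManifold (𝓡 n) ∞ M] {g : PseudoRiemannianMetric n M} {x : M} {T : TypeBn n M}
  {S : AlmostPseudoHermitian n M} {u₀ : ∀ x : M, Fib n x}

/-! ### Necessity of the conditions -/

theorem AlmostPseudoHermitian.pairingC_kernel (hn : Odd n) (hg : S.G.IsStandard g)
    (hu₀ : S.IsNormalizedKernelSection u₀) {z : Cx (Fib n x)} (hz : z ∈ Cx.iEigen (S.J x)) :
    pairingC n x z (g.mkFibC 0 (Cx.ofReal (u₀ x).1) 0) = 0 := by
  obtain ⟨p, q, c, rfl⟩ := g.mkFibC_surj z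
  have e : g.valC x q (Cx.ofReal (u₀ x).1) = 0 :=
    (S.isAlmostContact_minus hn hg hu₀ x).bil_vec_eq_zero ((S.mkFibC_mem_iEigen hn hg).1 hz).2.1
  rw [g.pairingC_mkFibC, e]
  simp

theorem AlmostPseudoHermitian.mkFibC_mem_iEigen_plus (hn : Odd n) (hg : S.G.IsStandard g)
    {p : Cx (Tan n x)} {c : ℂ} :
    g.mkFibC p 0 c ∈ Cx.iEigen (S.J x) ↔ MemPlus g (S.Jplus g) S.Xplus p c := by
  rw [S.mkFibC_mem_iEigen hn hg]
  exact ⟨fun h => ⟨h.1, h.2.2⟩, fun h => ⟨h.1, Submodule.zero_mem _, h.2⟩⟩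

theorem AlmostPseudoHermitian.memPlus_of_mem (hn : Odd n) (hg : S.G.IsStandard g)
    {p : Cx (Tan n x)} (hp : p ∈ Cx.iEigen (S.Jplus g x)) :
    MemPlus g (S.Jplus g) S.Xplus p 0 :=
  (S.mkFibC_mem_iEigen_plus hn hg).1 (S.mkFibC_mem_of_plus hn hg hp)

theorem AlmostPseudoHermitian.memPlus_Xplus (hn : Odd n) (hg : S.G.IsStandard g) (x : M) :
    MemPlus g (S.Jplus g) S.Xplus (Cx.ofReal (S.Xplus x)) Complex.I :=
  (S.mkFibC_mem_iEigen_plus hn hg).1 (S.mkFibC_Xplus_mem hn hg x)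

/-- Sections of `L₊` lie in the eigenbundles of both `𝓕` and `𝒢ᵉⁿᵈ 𝓕`. Hence the `E₋`-part `s` of
their bracket and its conjugate are both `i`-eigenvectors of `J₋`, so `s = 0`. Pairing with an
arbitrary `z` in `E₋` leaves only the derivative along `z`. -/
theorem AlmostPseudoHermitian.derivative_plus (hn : Odd n) (hg : S.G.IsStandard g)
    (hK : S.IsPseudoKahler T) {P P' : ∀ x : M, Cx (Tan n x)} {a b : M → ℂ}
    (hP : SmoothFieldC P) (ha : SmoothFunC n a)
    (mP : ∀ y, g.mkFibC (P y) 0 (a y) ∈ Cx.iEigen (S.J y))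
    (hP' : SmoothFieldC P') (hb : SmoothFunC n b)
    (mP' : ∀ y, g.mkFibC (P' y) 0 (b y) ∈ Cx.iEigen (S.J y)) (z : Cx (Tan n x)) :
    g.valC x (g.nablaC P x z) (P' x) + b x * dC a x z =
      (1 / 2) * T.HC x (P x) (P' x) z + b x * T.FC x (P x) z - a x * T.FC x (P' x) z := by
  have hu := hg.smoothSectionC_mkFibC hP smoothFieldC_zero ha
  have hv := hg.smoothSectionC_mkFibC hP' smoothFieldC_zero hb
  have h1 := hK.1.integrable _ _ hu hv mP mP' x
  have h2 := hK.2.integrable _ _ hu hv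
    (fun y => (S.mkFibC_mem_iEigen_comp hn hg).2 (by rw [Cx.conj_zero]; exact mP y))
    (fun y => (S.mkFibC_mem_iEigen_comp hn hg).2 (by rw [Cx.conj_zero]; exact mP' y)) x
  have F := pairingC_dorfmanC T g hu hv hP smoothFieldC_zero hP' smoothFieldC_zero
    (fun _ => rfl) (fun _ => rfl) x 0 z 0
  obtain ⟨r, s, d, e⟩ := g.mkFibC_surj
    (dorfmanC T (fun y => g.mkFibC (P y) 0 (a y)) (fun y => g.mkFibC (P' y) 0 (b y)) x)
  rw [e] at h1 h2 F
  have hs : s = 0 := Cx.eq_zero_of_mem_of_conj_mem ((S.mkFibC_mem_iEigen hn hg).1 h1).2.1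
    ((S.mkFibC_mem_iEigen hn hg).1 ((S.mkFibC_mem_iEigen_comp hn hg).1 h2)).2.1
  rw [hs, g.pairingC_mkFibC] at F
  simp only [g.nablaC_zero, map_zero, LinearMap.zero_apply, add_zero, zero_add, zero_mul, mul_zero,
    sub_zero] at F
  linear_combination -F

theorem AlmostPseudoHermitian.IsPseudoKahler.plusCond [T2Space M] (hn : Odd n)
    (hg : S.G.IsStandard g) (hK : S.IsPseudoKahler T) : PlusCond T g (S.Jplus g) S.Xplus where
  field P hP mP x z p hp := by
    obtain ⟨P', b, hP', hb, mP', e1, e2⟩ :=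
      S.exists_section_plus hn hg (S.mkFibC_mem_of_plus hn hg hp)
    have h := S.derivative_plus hn hg hK hP (smoothFunC_const 0)
      (fun y => S.mkFibC_mem_of_plus hn hg (mP y)) hP' hb mP' z
    rw [e1, e2] at h
    rw [T.HC_cyc]
    linear_combination h
  vec x z p hp := by
    obtain ⟨P', b, hP', hb, mP', e1, e2⟩ :=
      S.exists_section_plus hn hg (S.mkFibC_mem_of_plus hn hg hp)
    have h := S.derivative_plus hn hg hK S.smoothField_Xplus.ofReal (smoothFunC_const Complex.I)
      (S.mkFibC_Xplus_mem hn hg) hP' hb mP' z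
    rw [e1, e2] at h
    rw [T.HC_cyc, T.FC_swap]
    linear_combination h

/-- The bracket of two sections of `L₊` is orthogonal to `L₊` by isotropy of `L`; the derivatives
being known from `PlusCond`, only this cyclic identity remains. -/
theorem AlmostPseudoHermitian.HC_eq_of_memPlus [T2Space M] (hn : Odd n)
    (hg : S.G.IsStandard g) (hK : S.IsPseudoKahler T) {p q r : Cx (Tan n x)} {a b c : ℂ}
    (hp : MemPlus g (S.Jplus g) S.Xplus p a) (hq : MemPlus g (S.Jplus g) S.Xplus q b)
    (hr : MemPlus g (S.Jplus g) S.Xplus r c) :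
    T.HC x p q r = c * T.FC x p q + a * T.FC x q r + b * T.FC x r p := by
  have hC := hK.plusCond hn hg
  have cp := S.isAlmostContact_plus hn hg
  obtain ⟨P, a', hP, ha, mP, rfl, rfl⟩ :=
    S.exists_section_plus hn hg ((S.mkFibC_mem_iEigen_plus hn hg).2 hp)
  obtain ⟨P', b', hP', hb, mP', rfl, rfl⟩ :=
    S.exists_section_plus hn hg ((S.mkFibC_mem_iEigen_plus hn hg).2 hq)
  have hu := hg.smoothSectionC_mkFibC hP smoothFieldC_zero ha
  have hv := hg.smoothSectionC_mkFibC hP' smoothFieldC_zero hb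
  have F := pairingC_dorfmanC T g hu hv hP smoothFieldC_zero hP' smoothFieldC_zero
    (fun _ => rfl) (fun _ => rfl) x r 0 c
  have F0 : pairingC n x _ _ = 0 := S.almostComplex.isotropic x _
    (hK.1.integrable _ _ hu hv mP mP' x) _ ((S.mkFibC_mem_iEigen_plus hn hg).2 hr)
  have mP₁ (y : M) := (S.mkFibC_mem_iEigen_plus hn hg).1 (mP y)
  have mP₂ (y : M) := (S.mkFibC_mem_iEigen_plus hn hg).1 (mP' y)
  have a1 := hC.derivative_eq cp S.smoothField_Xplus hP' hb mP₂ hr (P x)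
  have a2 := hC.derivative_eq cp S.smoothField_Xplus hP ha mP₁ hr (P' x)
  have a3 := hC.derivative_eq cp S.smoothField_Xplus hP ha mP₁ hq r
  rw [F0] at F
  simp only [g.nablaC_zero, map_zero, add_zero, sub_zero, T.HC_swap_left (P' x) (P x), T.HC_cyc _ _ r, T.FC_swap r,
    T.FC_swap (P' x) (P x)] at F a1 a2 a3 ⊢
  linear_combination -F - a1 + a2 - a3

/-- The pairing of a bracket of sections of `L₋` with `L₊`. It is known only for directions `p` in
`L₊`; the other directions require `𝒢ᵉⁿᵈ 𝓕`. -/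
theorem AlmostPseudoHermitian.derivative_minus (hn : Odd n) (hg : S.G.IsStandard g)
    (hC : IsBnGenComplex T S.J) {Q Q' : ∀ x : M, Cx (Tan n x)} (hQ : SmoothFieldC Q)
    (mQ : ∀ y, Q y ∈ Cx.iEigen (S.Jminus g y)) (hQ' : SmoothFieldC Q')
    (mQ' : ∀ y, Q' y ∈ Cx.iEigen (S.Jminus g y)) {p : Cx (Tan n x)} {c : ℂ}
    (hp : MemPlus g (S.Jplus g) S.Xplus p c) :
    g.valC x (g.nablaC Q x p) (Q' x) + (1 / 2) * T.HC x (Q x) (Q' x) p =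
      c * T.FC x (Q x) (Q' x) := by
  have hu := hg.smoothSectionC_mkFibC smoothFieldC_zero hQ (smoothFunC_const 0)
  have hv := hg.smoothSectionC_mkFibC smoothFieldC_zero hQ' (smoothFunC_const 0)
  have F := pairingC_dorfmanC T g hu hv smoothFieldC_zero hQ smoothFieldC_zero hQ'
    (fun _ => rfl) (fun _ => rfl) x p 0 c
  have F0 : pairingC n x _ _ = 0 := S.almostComplex.isotropic x _
    (hC.integrable _ _ hu hv (fun y => S.mkFibC_mem_of_minus hn hg (mQ y))
      (fun y => S.mkFibC_mem_of_minus hn hg (mQ' y)) x) _ ((S.mkFibC_mem_iEigen_plus hn hg).2 hp)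
  rw [F0] at F
  simp only [g.nablaC_zero, dC_const, map_zero, LinearMap.zero_apply, add_zero, zero_add, zero_mul,
    mul_zero, sub_zero] at F
  linear_combination F

/-- The bracket of a section of `L₊` with one of `L₋` lies in `L` and is therefore orthogonal to
`u₋`. -/
theorem AlmostPseudoHermitian.derivative_vec_minus (hn : Odd n) (hg : S.G.IsStandard g)
    (hu₀ : S.IsNormalizedKernelSection u₀) (hC : IsBnGenComplex T S.J) [T2Space M]
    {q : Cx (Tan n x)} (hq : q ∈ Cx.iEigen (S.Jminus g x)) {p : Cx (Tan n x)} {c : ℂ}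
    (hp : MemPlus g (S.Jplus g) S.Xplus p c) :
    g.valC x (g.nablaC (fun y => Cx.ofReal (u₀ y).1) x p) q
      + (1 / 2) * T.HC x p (Cx.ofReal (u₀ x).1) q + c * T.FC x q (Cx.ofReal (u₀ x).1) = 0 := by
  obtain ⟨P, a, hP, ha, mP, rfl, rfl⟩ :=
    S.exists_section_plus hn hg ((S.mkFibC_mem_iEigen_plus hn hg).2 hp)
  obtain ⟨Q, hQ, mQ, rfl⟩ := S.exists_section_minus hn hg hq
  have hη : SmoothField (fun x => (u₀ x).1) := hu₀.smooth.1
  have hu := hg.smoothSectionC_mkFibC hP smoothFieldC_zero ha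
  have hv := hg.smoothSectionC_mkFibC smoothFieldC_zero hQ (smoothFunC_const 0)
  have F := pairingC_dorfmanC T g hu hv hP smoothFieldC_zero smoothFieldC_zero hQ
    (fun _ => rfl) (fun _ => rfl) x 0 (Cx.ofReal (u₀ x).1) 0
  rw [S.pairingC_kernel hn hg hu₀ (hC.integrable _ _ hu hv mP
    (fun y => S.mkFibC_mem_of_minus hn hg (mQ y)) x)] at F
  have d := g.nablaC_skew hQ hη.ofReal (c := 0)
    (fun y => (S.isAlmostContact_minus hn hg hu₀ y).bil_vec_eq_zero (mQ y)) (P x)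
  rw [g.valC_symm (Q x)] at d
  simp only [g.nablaC_zero, dC_const, map_zero, LinearMap.zero_apply, add_zero, zero_add, zero_mul,
    mul_zero, sub_zero, zero_sub] at F
  rw [T.HC_swap_right]
  linear_combination -F + d

/-- Integrability of `𝒢ᵉⁿᵈ 𝓕`, applied to conjugate sections and conjugated back, extends
`derivative_minus` to the conjugate of `L₊`. All complex directions are then covered, and the
directions `X₊ ± i` isolate `F(Q, Q') = 0`. -/
theorem AlmostPseudoHermitian.minusCond_aux [T2Space M] (hn : Odd n) (hg : S.G.IsStandard g)
    (hK : S.IsPseudoKahler T) {Q Q' : ∀ x : M, Cx (Tan n x)} (hQ : SmoothFieldC Q)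
    (mQ : ∀ y, Q y ∈ Cx.iEigen (S.Jminus g y)) (hQ' : SmoothFieldC Q')
    (mQ' : ∀ y, Q' y ∈ Cx.iEigen (S.Jminus g y)) :
    (g.valC x).flip (Q' x) ∘ₗ g.nablaC Q x + (1 / 2 : ℂ) • T.HC x (Q x) (Q' x) = 0 ∧
      T.FC x (Q x) (Q' x) = 0 := by
  have hg' : (S.comp hn hg).G.IsStandard g := hg
  have D {p : Cx (Tan n x)} {c : ℂ} (hp : MemPlus g (S.Jplus g) S.Xplus p c) :=
    S.derivative_minus hn hg hK.1 hQ mQ hQ' mQ' hp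
  have D' {p : Cx (Tan n x)} {c : ℂ} (hp : MemPlus g (S.Jplus g) S.Xplus p c) :
      g.valC x (g.nablaC Q x (Cx.conj p)) (Q' x) + (1 / 2) * T.HC x (Q x) (Q' x) (Cx.conj p) =
        (starRingEnd ℂ) c * T.FC x (Q x) (Q' x) := by
    have h := (S.comp hn hg).derivative_minus hn hg' hK.2 hQ.conj
      (fun y => by rw [S.comp_Jminus]; exact Cx.conj_mem_iEigen_neg (mQ y)) hQ'.conj
      (fun y => by rw [S.comp_Jminus]; exact Cx.conj_mem_iEigen_neg (mQ' y)) (p := p) (c := c)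
      (by rwa [S.comp_Jplus, S.comp_Xplus])
    have hN := g.nablaC_conj hQ (Cx.conj p)
    rw [Cx.conj_conj] at hN
    have hH := T.HC_conj (Q x) (Q' x) (Cx.conj p)
    rw [Cx.conj_conj] at hH
    rw [hN, g.valC_conj, hH, T.FC_conj] at h
    have h' := congrArg (starRingEnd ℂ) h
    have e2 : (starRingEnd ℂ) 2 = 2 := map_ofNat _ 2
    simpa [e2] using h'
  have hξ := S.memPlus_Xplus hn hg x
  have K := (S.isAlmostContact_plus hn hg x).eq_zero_of_forall_conj
    (φ := (g.valC x).flip (Q' x) ∘ₗ g.nablaC Q x + (1 / 2 : ℂ) • T.HC x (Q x) (Q' x))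
    (k := -T.FC x (Q x) (Q' x)) (fun z hz => ?_) (fun z hz => ?_) ?_ ?_
  · exact ⟨K.1, neg_eq_zero.1 K.2⟩
  · have := D (S.memPlus_of_mem hn hg hz)
    simp only [LinearMap.add_apply, LinearMap.comp_apply, LinearMap.flip_apply,
      LinearMap.smul_apply, smul_eq_mul]
    linear_combination this
  · have := D' (S.memPlus_of_mem hn hg hz)
    simp only [LinearMap.add_apply, LinearMap.comp_apply, LinearMap.flip_apply,
      LinearMap.smul_apply, smul_eq_mul]
    rw [this, map_zero, zero_mul]
  · have := D hξ
    simp only [LinearMap.add_apply, LinearMap.comp_apply, LinearMap.flip_apply,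
      LinearMap.smul_apply, smul_eq_mul]
    linear_combination this
  · have := D' hξ
    rw [Cx.conj_ofReal, Complex.conj_I] at this
    simp only [LinearMap.add_apply, LinearMap.comp_apply, LinearMap.flip_apply,
      LinearMap.smul_apply, smul_eq_mul]
    linear_combination this

/-- The same conjugation argument for `∇X₋`; here `X₊ ± i` isolate `F(q, X₋) = 0`. -/
theorem AlmostPseudoHermitian.minusCond_vec_aux [T2Space M] (hn : Odd n) (hg : S.G.IsStandard g)
    (hu₀ : S.IsNormalizedKernelSection u₀) (hK : S.IsPseudoKahler T) {q : Cx (Tan n x)}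
    (hq : q ∈ Cx.iEigen (S.Jminus g x)) :
    (g.valC x).flip q ∘ₗ g.nablaC (fun y => Cx.ofReal (u₀ y).1) x
        + (1 / 2 : ℂ) • ((T.HC x).flip (Cx.ofReal (u₀ x).1)).flip q = 0 ∧
      T.FC x q (Cx.ofReal (u₀ x).1) = 0 := by
  have hg' : (S.comp hn hg).G.IsStandard g := hg
  have hη : SmoothField (fun x => (u₀ x).1) := hu₀.smooth.1
  have D {p : Cx (Tan n x)} {c : ℂ} (hp : MemPlus g (S.Jplus g) S.Xplus p c) :=
    S.derivative_vec_minus hn hg hu₀ hK.1 hq hp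
  have D' {p : Cx (Tan n x)} {c : ℂ} (hp : MemPlus g (S.Jplus g) S.Xplus p c) :
      g.valC x (g.nablaC (fun y => Cx.ofReal (u₀ y).1) x (Cx.conj p)) q
        + (1 / 2) * T.HC x (Cx.conj p) (Cx.ofReal (u₀ x).1) q
        + (starRingEnd ℂ) c * T.FC x q (Cx.ofReal (u₀ x).1) = 0 := by
    have h := (S.comp hn hg).derivative_vec_minus hn hg' (hu₀.comp hn hg) hK.2 (q := Cx.conj q)
      (by rw [S.comp_Jminus]; exact Cx.conj_mem_iEigen_neg hq) (p := p) (c := c)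
      (by rwa [S.comp_Jplus, S.comp_Xplus])
    have hN := g.nablaC_conj hη.ofReal (Cx.conj p)
    simp only [Cx.conj_conj, Cx.conj_ofReal] at hN
    have hH := T.HC_conj (Cx.conj p) (Cx.ofReal (u₀ x).1) q
    rw [Cx.conj_conj, Cx.conj_ofReal] at hH
    have hF := T.FC_conj q (Cx.ofReal (u₀ x).1)
    rw [Cx.conj_ofReal] at hF
    rw [hN, g.valC_conj, hH, hF] at h
    have h' := congrArg (starRingEnd ℂ) h
    have e2 : (starRingEnd ℂ) 2 = 2 := map_ofNat _ 2
    simpa [e2] using h'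
  have hξ := S.memPlus_Xplus hn hg x
  refine (S.isAlmostContact_plus hn hg x).eq_zero_of_forall_conj
    (fun z hz => ?_) (fun z hz => ?_) ?_ ?_ <;>
  simp only [LinearMap.add_apply, LinearMap.comp_apply, LinearMap.flip_apply,
    LinearMap.smul_apply, smul_eq_mul]
  · linear_combination D (S.memPlus_of_mem hn hg hz)
  · have := D' (S.memPlus_of_mem hn hg hz)
    rwa [map_zero, zero_mul, add_zero] at this
  · linear_combination D hξ
  · have := D' hξ
    rw [Cx.conj_ofReal, Complex.conj_I] at this
    linear_combination this

theorem AlmostPseudoHermitian.IsPseudoKahler.minusCond [T2Space M] (hn : Odd n)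
    (hg : S.G.IsStandard g) (hu₀ : S.IsNormalizedKernelSection u₀) (hK : S.IsPseudoKahler T) :
    MinusCond T g (S.Jminus g) (fun x => (u₀ x).1) where
  field P hP mP x z p hp := by
    obtain ⟨Q, hQ, mQ, rfl⟩ := S.exists_section_minus hn hg hp
    have h := LinearMap.congr_fun (S.minusCond_aux (x := x) hn hg hK hP mP hQ mQ).1 z
    simp only [LinearMap.add_apply, LinearMap.comp_apply, LinearMap.flip_apply,
      LinearMap.smul_apply, smul_eq_mul, LinearMap.zero_apply] at h
    rw [T.HC_cyc]
    linear_combination h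
  vec x z p hp := by
    have h := LinearMap.congr_fun (S.minusCond_vec_aux hn hg hu₀ hK hp).1 z
    simp only [LinearMap.add_apply, LinearMap.comp_apply, LinearMap.flip_apply,
      LinearMap.smul_apply, smul_eq_mul, LinearMap.zero_apply] at h
    linear_combination h

theorem AlmostPseudoHermitian.IsPseudoKahler.tensorCond [T2Space M] (hn : Odd n)
    (hg : S.G.IsStandard g) (hu₀ : S.IsNormalizedKernelSection u₀) (hK : S.IsPseudoKahler T) :
    TensorCond T (S.Jplus g) (S.Jminus g) S.Xplus (fun x => (u₀ x).1) := by
  have hm := hK.minusCond hn hg hu₀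
  have cm := S.isAlmostContact_minus hn hg hu₀
  have hη : SmoothField (fun x => (u₀ x).1) := hu₀.smooth.1
  -- Brackets of sections of `L₋` are now tested inside `E₋`, against vectors orthogonal to `L`:
  -- type (1,0) vectors or `X₋`.
  have bracket {x : M} {Q Q' : ∀ x : M, Cx (Tan n x)} (hQ : SmoothFieldC Q)
      (mQ : ∀ y, Q y ∈ Cx.iEigen (S.Jminus g y)) (hQ' : SmoothFieldC Q')
      (mQ' : ∀ y, Q' y ∈ Cx.iEigen (S.Jminus g y)) {q : Cx (Tan n x)}
      (hq : ∀ z ∈ Cx.iEigen (S.J x), pairingC n x z (g.mkFibC 0 q 0) = 0) :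
      -g.valC x (g.nablaC Q' x (Q x)) q + g.valC x (g.nablaC Q x (Q' x)) q
        - g.valC x (g.nablaC Q x q) (Q' x) - (1 / 2) * T.HC x (Q x) (Q' x) q = 0 := by
    have hu := hg.smoothSectionC_mkFibC smoothFieldC_zero hQ (smoothFunC_const 0)
    have hv := hg.smoothSectionC_mkFibC smoothFieldC_zero hQ' (smoothFunC_const 0)
    have F := pairingC_dorfmanC T g hu hv smoothFieldC_zero hQ smoothFieldC_zero hQ'
      (fun _ => rfl) (fun _ => rfl) x 0 q 0
    rw [hq _ (hK.1.integrable _ _ hu hv (fun y => S.mkFibC_mem_of_minus hn hg (mQ y))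
      (fun y => S.mkFibC_mem_of_minus hn hg (mQ' y)) x)] at F
    simp only [g.nablaC_zero, dC_const, map_zero, LinearMap.zero_apply, add_zero, zero_add,
      zero_mul, mul_zero, sub_zero, zero_sub] at F
    linear_combination -F
  refine ⟨fun x a ha b hb c hc => ?_, fun x a ha b hb c hc => ?_, fun x a ha b hb => ?_,
    fun x a ha b hb => ?_, fun x a ha b hb => ?_, fun x => ?_⟩
  · rw [S.HC_eq_of_memPlus hn hg hK (S.memPlus_of_mem hn hg ha) (S.memPlus_of_mem hn hg hb)
      (S.memPlus_of_mem hn hg hc)]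
    simp
  · obtain ⟨Q, hQ, mQ, rfl⟩ := S.exists_section_minus hn hg ha
    obtain ⟨Q', hQ', mQ', rfl⟩ := S.exists_section_minus hn hg hb
    have h := bracket hQ mQ hQ' mQ' fun z hz =>
      S.almostComplex.isotropic x z hz _ (S.mkFibC_mem_of_minus hn hg hc)
    -- The three derivatives contribute `½H` each and the explicit term `-½H`, so the sum is `H`
    -- itself.
    rw [hm.field _ hQ mQ x _ _ hc, hm.field _ hQ' mQ' x _ _ hc, hm.field _ hQ mQ x _ _ (mQ' x),
      T.HC_swap_left (Q' x), T.HC_cyc (Q x) (Q' x) c] at h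
    linear_combination h
  · rw [S.HC_eq_of_memPlus hn hg hK (S.memPlus_Xplus hn hg x) (S.memPlus_of_mem hn hg ha)
      (S.memPlus_of_mem hn hg hb)]
    simp
  · obtain ⟨Q, hQ, mQ, rfl⟩ := S.exists_section_minus hn hg ha
    obtain ⟨Q', hQ', mQ', rfl⟩ := S.exists_section_minus hn hg hb
    have h := bracket (x := x) hQ mQ hQ' mQ' fun z hz => S.pairingC_kernel hn hg hu₀ hz
    have d1 := g.nablaC_skew hQ' hη.ofReal (c := 0) (fun y => (cm y).bil_vec_eq_zero (mQ' y)) (Q x)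
    have d2 := g.nablaC_skew hQ hη.ofReal (c := 0) (fun y => (cm y).bil_vec_eq_zero (mQ y)) (Q' x)
    rw [g.valC_symm (Q' x), hm.vec x _ _ (mQ' x)] at d1
    rw [g.valC_symm (Q x), hm.vec x _ _ (mQ x)] at d2
    rw [d1, d2, hm.field _ hQ mQ x _ _ (mQ' x), T.HC_swap_left (Q x) (Cx.ofReal (u₀ x).1),
      T.HC_swap_left (Q' x) (Cx.ofReal (u₀ x).1), T.HC_swap_right _ (Q' x),
      ← T.HC_cyc (Q x) (Q' x)] at h
    linear_combination h
  · obtain ⟨Q, hQ, mQ, rfl⟩ := S.exists_section_minus hn hg ha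
    obtain ⟨Q', hQ', mQ', rfl⟩ := S.exists_section_minus hn hg hb
    exact (S.minusCond_aux (x := x) hn hg hK hQ mQ hQ' mQ').2
  · have k {z : Cx (Tan n x)} (hz : z ∈ Cx.iEigen (S.Jminus g x)) :
        T.FC x (Cx.ofReal (u₀ x).1) z = 0 := by
      rw [T.FC_swap, (S.minusCond_vec_aux hn hg hu₀ hK hz).2, neg_zero]
    -- `i_{X₋}F` vanishes on `T^{1,0}₋`, on its conjugate because `F` and `X₋` are real, and on `X₋`
    -- by skewness.
    refine fun z => LinearMap.congr_fun ((cm x).eq_zero_of_forall (fun z hz => k hz)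
      (fun z hz => ?_) (T.FC_self _)) z
    have := k (Cx.conj_mem_iEigen hz)
    rwa [← Cx.conj_ofReal, T.FC_conj, map_eq_zero] at this

end

/-! ### The algebraic conditions in complex notation -/

section
variable {n : ℕ} {M : Type*} [TopologicalSpace M] [ChartedSpace (EuclideanSpace ℝ (Fin n)) M]
  [IsManifold (𝓡 n) ∞ M] {x : M} {T : TypeBn n M}

theorem TypeBn.trilin_eq (T : TypeBn n M) (a b c : Cx (Tan n x)) :
    Cx.trilin (fun u v w => T.H x u v w) a b c = T.HC x a b c := rfl

theorem TypeBn.bilin_H_eq (T : TypeBn n M) (v : Tan n x) (a b : Cx (Tan n x)) :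
    Cx.bilin (fun u w => T.H x v u w) a b = T.HC x (Cx.ofReal v) a b :=
  (Cx.tri_ofReal (T.Hₗ x) v a b).symm

theorem TypeBn.bilin_F_eq (T : TypeBn n M) (a b : Cx (Tan n x)) :
    Cx.bilin (fun v w => T.F x v w) a b = T.FC x a b := rfl

theorem TypeBn.forall_FC_ofReal_iff (T : TypeBn n M) (v : Tan n x) :
    (∀ z, T.FC x (Cx.ofReal v) z = 0) ↔ ∀ w, T.F x v w = 0 := by
  have e (w : Tan n x) : (T.FC x (Cx.ofReal v) (Cx.ofReal w)).re = T.F x v w := by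
    simp [TypeBn.FC, Cx.bil_apply]
    rfl
  refine ⟨fun h w => by rw [← e, h]; rfl, fun h z => ?_⟩
  apply Complex.ext <;> simp [TypeBn.FC, Cx.bil_apply] <;> exact h _

theorem tensorCond_iff {Jp Jm : ∀ x : M, Module.End ℝ (Tan n x)} {ξp ξm : ∀ x : M, Tan n x} :
    ((∀ x, ∀ a ∈ Cx.iEigen (Jp x), ∀ b ∈ Cx.iEigen (Jp x), ∀ c ∈ Cx.iEigen (Jp x),
          Cx.trilin (fun u v w => T.H x u v w) a b c = 0) ∧
        (∀ x, ∀ a ∈ Cx.iEigen (Jm x), ∀ b ∈ Cx.iEigen (Jm x), ∀ c ∈ Cx.iEigen (Jm x),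
          Cx.trilin (fun u v w => T.H x u v w) a b c = 0) ∧
        (∀ x, ∀ a ∈ Cx.iEigen (Jp x), ∀ b ∈ Cx.iEigen (Jp x),
          Cx.bilin (fun v w => T.H x (ξp x) v w) a b =
            Complex.I * Cx.bilin (fun v w => T.F x v w) a b) ∧
        (∀ x, ∀ a ∈ Cx.iEigen (Jm x), ∀ b ∈ Cx.iEigen (Jm x),
          Cx.bilin (fun v w => T.H x (ξm x) v w) a b = 0) ∧
        (∀ x, ∀ a ∈ Cx.iEigen (Jm x), ∀ b ∈ Cx.iEigen (Jm x),
          Cx.bilin (fun v w => T.F x v w) a b = 0) ∧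
        (∀ x v, T.F x (ξm x) v = 0)) ↔ TensorCond T Jp Jm ξp ξm := by
  simp only [T.trilin_eq, T.bilin_H_eq, T.bilin_F_eq, ← T.forall_FC_ofReal_iff]
  exact ⟨fun ⟨h1, h2, h3, h4, h5, h6⟩ => ⟨h1, h2, h3, h4, h5, h6⟩,
    fun ⟨h1, h2, h3, h4, h5, h6⟩ => ⟨h1, h2, h3, h4, h5, h6⟩⟩

end

end BnGeom

theorem mainTheorem2 {n : ℕ} (hn : Odd n) {M : Type*} [TopologicalSpace M] [T2Space M]
    [SecondCountableTopology M] [ChartedSpace (EuclideanSpace ℝ (Fin n)) M]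
    [IsManifold (𝓡 n) ∞ M]
    (T : TypeBn n M) (S : AlmostPseudoHermitian n M)
    (g : PseudoRiemannianMetric n M) (hg : S.G.IsStandard g)
    (u₀ : ∀ x : M, Fib n x) (hu₀ : S.IsNormalizedKernelSection u₀)
    (Jp Jm : ∀ x : M, Module.End ℝ (Tan n x)) (Xp Xm : ∀ x : M, Tan n x)
    (hJp : Jp = S.Jplus g) (hJm : Jm = S.Jminus g)
    (hXp : Xp = S.Xplus) (hXm : Xm = fun x => (u₀ x).1) :
    S.IsPseudoKahler T ↔
      ((Preserves (nablaPlus T g Jp Xp) Jp ∧ Preserves (nablaMinus T g) Jm ∧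
        (∀ x v, nablaMinus T g Xm x v = 0) ∧
        (∀ x v, nablaPlus T g Jp Xp Xp x v = -Jp x (g.sharp x (T.F x v)))) ∧
      ((∀ x, ∀ a ∈ Cx.iEigen (Jp x), ∀ b ∈ Cx.iEigen (Jp x), ∀ c ∈ Cx.iEigen (Jp x),
          Cx.trilin (fun u v w => T.H x u v w) a b c = 0) ∧
        (∀ x, ∀ a ∈ Cx.iEigen (Jm x), ∀ b ∈ Cx.iEigen (Jm x), ∀ c ∈ Cx.iEigen (Jm x),
          Cx.trilin (fun u v w => T.H x u v w) a b c = 0) ∧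
        (∀ x, ∀ a ∈ Cx.iEigen (Jp x), ∀ b ∈ Cx.iEigen (Jp x),
          Cx.bilin (fun v w => T.H x (Xp x) v w) a b =
            Complex.I * Cx.bilin (fun v w => T.F x v w) a b) ∧
        (∀ x, ∀ a ∈ Cx.iEigen (Jm x), ∀ b ∈ Cx.iEigen (Jm x),
          Cx.bilin (fun v w => T.H x (Xm x) v w) a b = 0) ∧
        (∀ x, ∀ a ∈ Cx.iEigen (Jm x), ∀ b ∈ Cx.iEigen (Jm x),
          Cx.bilin (fun v w => T.F x v w) a b = 0) ∧
        (∀ x v, T.F x (Xm x) v = 0))) := by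
  subst hJp hJm hXp hXm
  have cp := preserves_plus_iff (S.isAlmostContact_plus hn hg) S.smoothField_Xplus T
  have cm := preserves_minus_iff (S.isAlmostContact_minus hn hg hu₀) hu₀.smooth.1 T
  rw [tensorCond_iff]
  constructor
  · intro hK
    obtain ⟨p1, p2⟩ := cp.2 (hK.plusCond hn hg)
    obtain ⟨m1, m2⟩ := cm.2 (hK.minusCond hn hg hu₀)
    exact ⟨⟨p1, m1, m2, p2⟩, hK.tensorCond hn hg hu₀⟩
  · rintro ⟨⟨p1, m1, m2, p2⟩, ht⟩
    exact S.isPseudoKahler_of_conditions hn hg hu₀ (cp.1 ⟨p1, p2⟩) (cm.1 ⟨m1, m2⟩) ht
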